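/- **Setting.** Let $\mathcal H$ be a complex Hilbert space, and let $(H_\nu)_{\nu\in\Sigma}$, $(A_\nu)_{\nu\in\Sigma}$ be families of (possibly unbounded) self-adjoint operators on $\mathcal H$, with domains $D(H_\nu)$, $D(A_\nu)$. Let $\lambda_\nu\in\mathbb R$, $\alpha_\nu>0$, $\delta_\nu>0$ and $f_\nu\in C_0^\infty(\mathbb R,\mathbb R)$. Assume that for every $\nu\in\Sigma$ the following conditions hold (the index $\nu$ is dropped in (a)–(c)). **(a)** There is a subspace $\mathcal D\subset D(H)\cap D(A)$, dense in $\mathcal H$ and a core for $A$, and a sequence $(\zeta_n)$ of bounded operators on $\mathcal H$ such that, for all $n$: $\zeta_nD(H)\subset D(H)$; $\zeta_nD(A)\subset D(A)$; $\zeta_n(H-z)^{-1}\mathcal D\subset\mathcal D$ for all $z\notin\mathrm{spec}(H)$; $\zeta_n g(H)\mathcal H\subset\mathcal D$ for all $g\in C_0^\infty(\mathbb R)$; and, as $n\to\infty$, $\zeta_n\varphi\to\varphi$ for $\varphi\in\mathcal H$, $A\zeta_n\varphi\to A\varphi$ for $\varphi\in D(A)$, $H\zeta_n\varphi\to H\varphi$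 for $\varphi\in D(H)$. Moreover $(H-z)^{-1}D(A)\subset D(A)$ for all $z\notin\mathrm{spec}(H)$. **(b)** There is a bounded operator $[H,A]^0$ from $D(H)$ (with the graph norm) to $\mathcal H$ and a constant $C_{H,A}>0$ such that, for all $\varphi,\psi\in\mathcal D$, $$(A\varphi,H\psi)-(H\varphi,A\psi)=([H,A]^0\varphi,\psi),$$ $$\big|(A\varphi,i[H,A]^0\psi)-(i[H,A]^0\varphi,A\psi)\big|\le C_{H,A}\,\|\psi\|\,\|(H+i)\varphi\|.$$ **(c)** $0\le f\le1$, $f(E)=1$ if $|E-\lambda|<2\delta$, $f(E)=0$ if $|E-\lambda|>3\delta$, and $$f(H)\,i[H,A]^0f(H)\ \ge\ \alpha f(H)^2 .$$ Put $N=\|[H,A]^0(H+i)^{-1}\|$, $S=\big(1+\alpha^{-1}\|[H,A]^0f(H)\|\big)^2$, $\Delta_f=\frac1{2\pi}\int_{\mathbb R}|t\hat f(t)|\,dt$ with $\hat f(t)=\int_{\mathbb R} e^{-itE}f(E)\,dE$, and $$C_0=\delta^{-2}(1+|\lambda|+2\delta)(1+S)^2N,$$ $$C_{1/2}=2\alpha^{-1/2}\delta^{-1}(1+|\lambda|+3\delta)\,S\,N\,\big(1+\delta\alpha^{-1}\Delta_fN(1+|\lambda|+3\delta)\big),$$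 $$C_1=\alpha^{-1}(1+|\lambda|+3\delta)\big(C_{H,A}+2\Delta_fN^2(1+|\lambda|+3\delta)\big);$$ write $C_{0,\nu},C_{1/2,\nu},C_{1,\nu}$ for these constants at the index $\nu$. **Theorem.** Assume that $\varepsilon_\nu:=\delta_\nu\alpha_\nu^{-1}\le1$ for all $\nu\in\Sigma$, that $f_\nu(E)=f((E-\lambda_\nu)/\delta_\nu)$ for some fixed $f\in C_0^\infty(\mathbb R)$, and that there exists $C>0$ such that, for all $\nu\in\Sigma$, $$C_{0,\nu}\le C\varepsilon_\nu^{-1}\delta_\nu^{-1},\quad C_{1/2,\nu}\le C\varepsilon_\nu^{-1/2}\delta_\nu^{-1/2},\quad C_{1,\nu}\le C\varepsilon_\nu^{-1},\quad \|[H_\nu,A_\nu]^0f_\nu(H_\nu)\|\le C\alpha_\nu .$$ Write $\langle A_\nu\rangle^{-s}=(1+A_\nu^2)^{-s/2}$. Then for all $1/2<s\le1$ there exists $C_s>0$ such that, for all $\nu\in\Sigma$ and all $z\notin\mathrm{spec}(H_\nu)$ with $|\mathrm{Re}\,z-\lambda_\nu|\le\delta_\nu$, $$\big\|\langle A_\nu\rangle^{-s}(H_\nu-z)^{-1}\langle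 A_\nu\rangle^{-s}\big\|\le C_s\,\delta_\nu^{-1}.$$ Furthermore, for all $\nu\in\Sigma$ and $\mu\in(\lambda_\nu-\delta_\nu,\lambda_\nu+\delta_\nu)$, the limits $$\langle A_\nu\rangle^{-s}(H_\nu-\mu\pm i0)^{-1}\langle A_\nu\rangle^{-s}:=\lim_{\varepsilon\to0^+}\langle A_\nu\rangle^{-s}(H_\nu-\mu\pm i\varepsilon)^{-1}\langle A_\nu\rangle^{-s}$$ exist in operator norm and are continuous in $\mu\in(\lambda_\nu-\delta_\nu,\lambda_\nu+\delta_\nu)$ with respect to the operator norm. -/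

import Mathlib

open Filter Topology
open scoped ContDiff

noncomputable section

namespace Mourre

variable {E : Type*} [NormedAddCommGroup E] [InnerProductSpace ℂ E]

/-- `R` is a bounded everywhere defined two-sided inverse of `T - z : D(T) → E`. -/
structure IsResolventAt (T : E →ₗ.[ℂ] E) (z : ℂ) (R : E →L[ℂ] E) : Prop where
  mem_domain : ∀ x : E, R x ∈ T.domain
  right_inv : ∀ x : E, T ⟨R x, mem_domain x⟩ - z • R x = x
  left_inv : ∀ φ : T.domain, R (T φ - z • (φ : E)) = φ

/-- The resolvent set of an unbounded operator, i.e. the complement of its spectrum. -/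
def resolventSet (T : E →ₗ.[ℂ] E) : Set ℂ :=
  {z | ∃ R : E →L[ℂ] E, IsResolventAt T z R}

open Classical in
/-- The resolvent `(T - z)⁻¹` as a bounded operator, for `z` in the resolvent set (and `0` for the
other `z`). -/
def resolvent (T : E →ₗ.[ℂ] E) (z : ℂ) : E →L[ℂ] E :=
  if h : ∃ R : E →L[ℂ] E, IsResolventAt T z R then h.choose else 0

theorem IsResolventAt.unique {T : E →ₗ.[ℂ] E} {z : ℂ} {R S : E →L[ℂ] E}
    (hR : IsResolventAt T z R) (hS : IsResolventAt T z S) : R = S := by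
  ext x
  have h := hR.left_inv ⟨S x, hS.mem_domain x⟩
  rw [hS.right_inv x] at h
  exact h

theorem resolvent_spec {T : E →ₗ.[ℂ] E} {z : ℂ} (hz : z ∈ resolventSet T) :
    IsResolventAt T z (resolvent T z) := by
  have h : ∃ R : E →L[ℂ] E, IsResolventAt T z R := hz
  rw [resolvent, dif_pos h]
  exact h.choose_spec

section Symmetric

variable [CompleteSpace E]

theorem symm_of_isSelfAdjoint {T : E →ₗ.[ℂ] E} (hT : IsSelfAdjoint T) (φ ψ : T.domain) :
    inner ℂ (T φ) (ψ : E) = inner ℂ (φ : E) (T ψ) := by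
  have h := LinearPMap.adjoint_isFormalAdjoint (T := T) hT.dense_domain
  rw [LinearPMap.isSelfAdjoint_def.1 hT] at h
  exact h φ ψ

theorem norm_sub_smul_ge {T : E →ₗ.[ℂ] E} (hT : IsSelfAdjoint T) (z : ℂ) (φ : T.domain) :
    |z.im| * ‖(φ : E)‖ ≤ ‖T φ - z • (φ : E)‖ := by
  have hreal : (inner ℂ (φ : E) (T φ)).im = 0 := by
    have h1 := symm_of_isSelfAdjoint hT φ φ
    have h2 := inner_conj_symm (𝕜 := ℂ) (φ : E) (T φ)
    rw [h1] at h2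
    exact Complex.conj_eq_iff_im.1 h2
  have him : (inner ℂ (φ : E) (T φ - z • (φ : E))).im = - z.im * ‖(φ : E)‖ ^ 2 := by
    rw [inner_sub_right, inner_smul_right, inner_self_eq_norm_sq_to_K, Complex.sub_im, hreal]
    simp [← Complex.ofReal_pow]
  have hle : |z.im| * ‖(φ : E)‖ ^ 2 ≤ ‖(φ : E)‖ * ‖T φ - z • (φ : E)‖ := by
    calc |z.im| * ‖(φ : E)‖ ^ 2 = |(inner ℂ (φ : E) (T φ - z • (φ : E))).im| := by
          rw [him, abs_mul, abs_neg, abs_of_nonneg (sq_nonneg ‖(φ : E)‖)]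
      _ ≤ ‖inner ℂ (φ : E) (T φ - z • (φ : E))‖ := Complex.abs_im_le_norm _
      _ ≤ _ := norm_inner_le_norm _ _
  rcases eq_or_lt_of_le (norm_nonneg (φ : E)) with h0 | h0
  · rw [← h0]; simp
  · by_contra! hcon
    have := mul_lt_mul_of_pos_left hcon h0
    nlinarith

/-- Non-real numbers belong to the resolvent set of a self-adjoint operator. -/
theorem mem_resolventSet_of_im_ne_zero {T : E →ₗ.[ℂ] E} (hT : IsSelfAdjoint T) {z : ℂ}
    (hz : z.im ≠ 0) : z ∈ resolventSet T := by
  have hpos : 0 < |z.im| := abs_pos.2 hz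
  let L : T.domain →ₗ[ℂ] E := T.toFun - z • T.domain.subtype
  have hL : ∀ φ : T.domain, L φ = T φ - z • (φ : E) := fun φ => rfl
  have hbd : ∀ φ : T.domain, ‖(φ : E)‖ ≤ |z.im|⁻¹ * ‖L φ‖ := fun φ => by
    rw [hL, inv_mul_eq_div, le_div_iff₀ hpos, mul_comm]
    exact norm_sub_smul_ge hT z φ
  have hinj : Function.Injective L := by
    rw [← LinearMap.ker_eq_bot, LinearMap.ker_eq_bot']
    intro φ hφ
    have h := hbd φ
    rw [hφ, norm_zero, mul_zero] at h
    exact Subtype.ext (norm_le_zero_iff.1 h)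
  have hclosed : IsClosed (LinearMap.range L : Set E) := by
    apply IsSeqClosed.isClosed
    intro y y₀ hy hlim
    choose φ hφ using hy
    have hcau : CauchySeq fun n => (φ n : E) := by
      rw [Metric.cauchySeq_iff]
      intro ε hε
      obtain ⟨N, hN⟩ := Metric.cauchySeq_iff.1 hlim.cauchySeq (|z.im| * ε) (by positivity)
      refine ⟨N, fun m hm n hn => ?_⟩
      have h := hN m hm n hn
      rw [dist_eq_norm] at h ⊢
      have h2 := hbd (φ m - φ n)
      rw [map_sub, hφ, hφ, inv_mul_eq_div, le_div_iff₀ hpos] at h2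
      have h3 : ‖(φ m : E) - φ n‖ * |z.im| < |z.im| * ε := lt_of_le_of_lt h2 h
      rw [mul_comm] at h3
      exact lt_of_mul_lt_mul_left h3 hpos.le
    obtain ⟨x₀, hx₀⟩ := cauchySeq_tendsto_of_complete hcau
    have hTlim : Tendsto (fun n => T (φ n)) atTop (𝓝 (y₀ + z • x₀)) := by
      have h : ∀ n, T (φ n) = y n + z • (φ n : E) := fun n => by
        rw [← hφ n, hL]; simp
      simp_rw [h]
      exact hlim.add (hx₀.const_smul z)
    have hgr : ((x₀, y₀ + z • x₀) : E × E) ∈ (T.graph : Set (E × E)) := by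
      have hcl : IsClosed (T.graph : Set (E × E)) := hT.isClosed
      exact hcl.mem_of_tendsto (hx₀.prodMk_nhds hTlim)
        (Eventually.of_forall fun n => T.mem_graph (φ n))
    obtain ⟨ψ, h1, h2⟩ := (LinearPMap.mem_graph_iff T).1 hgr
    refine ⟨ψ, ?_⟩
    rw [hL, h2]
    simp only at h1
    rw [h1]; simp
  have horth : (LinearMap.range L)ᗮ = ⊥ := by
    rw [Submodule.eq_bot_iff]
    intro y hy
    have hy' : ∀ φ : T.domain, inner ℂ y (T φ) = z * inner ℂ y (φ : E) := fun φ => by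
      have h := (Submodule.mem_orthogonal' _ _).1 hy (L φ) ⟨φ, rfl⟩
      rw [hL, inner_sub_right, inner_smul_right, sub_eq_zero] at h
      exact h
    have hw : ∀ φ : T.domain, inner ℂ ((starRingEnd ℂ z) • y) (φ : E) = inner ℂ y (T φ) :=
      fun φ => by rw [hy' φ, inner_smul_left]; simp
    have hmem : y ∈ T.adjoint.domain := LinearPMap.mem_adjoint_domain_of_exists y ⟨_, hw⟩
    have hval := LinearPMap.adjoint_apply_eq hT.dense_domain ⟨y, hmem⟩ hw
    have key : ∃ h : y ∈ T.domain, T ⟨y, h⟩ = (starRingEnd ℂ z) • y := by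
      have := LinearPMap.isSelfAdjoint_def.1 hT
      have hg : (y, (starRingEnd ℂ z) • y) ∈ T.adjoint.graph :=
        (LinearPMap.mem_graph_iff _).2 ⟨⟨y, hmem⟩, rfl, hval⟩
      rw [this] at hg
      obtain ⟨ψ, h1, h2⟩ := (LinearPMap.mem_graph_iff T).1 hg
      simp only at h1 h2
      subst h1
      exact ⟨ψ.2, h2⟩
    obtain ⟨h, hTy⟩ := key
    have h3 := norm_sub_smul_ge hT (starRingEnd ℂ z) ⟨y, h⟩
    rw [hTy] at h3
    simp only [sub_self, norm_zero, Complex.conj_im, abs_neg] at h3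
    have : ‖y‖ ≤ 0 := by
      by_contra! hc
      nlinarith [mul_pos hpos hc]
    exact norm_le_zero_iff.1 this
  have hsurj : Function.Surjective L := by
    rw [← LinearMap.range_eq_top]
    have : CompleteSpace (LinearMap.range L) := hclosed.completeSpace_coe
    exact (Submodule.orthogonal_eq_bot_iff).1 horth
  let e : T.domain ≃ₗ[ℂ] E := LinearEquiv.ofBijective L ⟨hinj, hsurj⟩
  have he : ∀ x, L (e.symm x) = x := fun x => e.apply_symm_apply x
  refine ⟨LinearMap.mkContinuous (T.domain.subtype ∘ₗ e.symm.toLinearMap) |z.im|⁻¹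
    (fun x => by simpa [he] using hbd (e.symm x)), ?_, ?_, ?_⟩
  · intro x; exact (e.symm x).2
  · intro x; exact he x
  · intro φ
    change ((e.symm (L φ) : T.domain) : E) = φ
    exact congrArg Subtype.val (e.symm_apply_apply φ)

/-- The bounded operator `g(T)`, for `T` self-adjoint and `g` a continuous function on `ℝ` which
vanishes at infinity. The bounded operator `R = (T + i)⁻¹` is normal, its spectrum consists of the
numbers `w = 1 / (x + i)` with `x` in the spectrum of `T`, and possibly of `0` (the point at
infinity). As `x = Re (1 / w)`, the operator `g(T)` is the continuous function
`w ↦ g (Re (1 / w))`, `0 ↦ 0` of `R`. -/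
def functionOf (T : E →ₗ.[ℂ] E) (g : ℝ → ℂ) : E →L[ℂ] E :=
  cfc (fun w : ℂ => if w = 0 then 0 else g (w⁻¹).re) (resolvent T (-Complex.I))

/-- The weight `⟨T⟩^{-s} = (1 + T²)^{-s/2}`. -/
def bracketNegPow (T : E →ₗ.[ℂ] E) (s : ℝ) : E →L[ℂ] E :=
  functionOf T (fun x => (((1 + x ^ 2) ^ (-s / 2) : ℝ) : ℂ))

/-- The operator `f(T)` for a real function `f`. -/
def realFunctionOf (T : E →ₗ.[ℂ] E) (f : ℝ → ℝ) : E →L[ℂ] E :=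
  functionOf T (fun x => (f x : ℂ))

end Symmetric

open Classical in
/-- The composition `K B` of an operator `K` defined on `D(T)` with a bounded operator `B` whose
range is contained in `D(T)`. -/
def compDom {T : E →ₗ.[ℂ] E} (K : T.domain →ₗ[ℂ] E) (B : E →L[ℂ] E) : E → E :=
  fun x => if h : B x ∈ T.domain then K ⟨B x, h⟩ else 0

/-- The operator norm. -/
def opNorm (L : E → E) : ℝ :=
  sInf {c : ℝ | 0 ≤ c ∧ ∀ x : E, ‖L x‖ ≤ c * ‖x‖}

/-- Condition (a): assumptions on domains. -/
structure DomainConditions [CompleteSpace E] (H A : E →ₗ.[ℂ] E) (D : Submodule ℂ E)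
    (ζ : ℕ → E →L[ℂ] E) : Prop where
  le_domain_H : D ≤ H.domain
  le_domain_A : D ≤ A.domain
  dense : Dense (D : Set E)
  core_A : A.HasCore D
  stable_H : ∀ n, ∀ φ ∈ H.domain, ζ n φ ∈ H.domain
  stable_A : ∀ n, ∀ φ ∈ A.domain, ζ n φ ∈ A.domain
  regularity : ∀ n, ∀ z ∈ resolventSet H, ∀ φ ∈ D, ζ n (resolvent H z φ) ∈ D
  regularity_inf : ∀ n, ∀ g : ℝ → ℂ, ContDiff ℝ ∞ g → HasCompactSupport g →
    ∀ φ : E, ζ n (functionOf H g φ) ∈ D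
  strong : ∀ φ : E, Tendsto (fun n => ζ n φ) atTop (𝓝 φ)
  strong_A : ∀ φ : A.domain,
    Tendsto (fun n => A ⟨ζ n φ, stable_A n φ φ.2⟩) atTop (𝓝 (A φ))
  strong_H : ∀ φ : H.domain,
    Tendsto (fun n => H ⟨ζ n φ, stable_H n φ φ.2⟩) atTop (𝓝 (H φ))
  resolvent_stable : ∀ z ∈ resolventSet H, ∀ φ ∈ A.domain, resolvent H z φ ∈ A.domain

/-- Condition (b): assumptions on commutators. The operator `K : D(H) → E` is `[H, A]⁰` and `c` is
the constant `C_{H,A}`. -/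
structure CommutatorConditions (H A : E →ₗ.[ℂ] E) (D : Submodule ℂ E)
    (K : H.domain →ₗ[ℂ] E) (c : ℝ) : Prop where
  bounded : ∃ M : ℝ, ∀ φ : H.domain, ‖K φ‖ ≤ M * (‖(φ : E)‖ + ‖H φ‖)
  pos : 0 < c
  comm : ∀ φ ∈ D, ∀ ψ ∈ D, ∀ (hφ : φ ∈ H.domain) (hφ' : φ ∈ A.domain)
    (hψ : ψ ∈ H.domain) (hψ' : ψ ∈ A.domain),
    inner ℂ (A ⟨φ, hφ'⟩) (H ⟨ψ, hψ⟩) - inner ℂ (H ⟨φ, hφ⟩) (A ⟨ψ, hψ'⟩) =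
      inner ℂ (K ⟨φ, hφ⟩) ψ
  double_comm : ∀ φ ∈ D, ∀ ψ ∈ D, ∀ (hφ : φ ∈ H.domain) (hφ' : φ ∈ A.domain)
    (hψ : ψ ∈ H.domain) (hψ' : ψ ∈ A.domain),
    ‖inner ℂ (A ⟨φ, hφ'⟩) (Complex.I • K ⟨ψ, hψ⟩) -
        inner ℂ (Complex.I • K ⟨φ, hφ⟩) (A ⟨ψ, hψ'⟩)‖ ≤
      c * ‖ψ‖ * ‖H ⟨φ, hφ⟩ + Complex.I • φ‖

/-- Condition (c): positive commutator estimate `f(H) i[H,A]⁰ f(H) ≥ α f(H)²` at `lam`. -/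
structure PositiveCommutator [CompleteSpace E] (H : E →ₗ.[ℂ] E) (K : H.domain →ₗ[ℂ] E)
    (lam α δ : ℝ) (f : ℝ → ℝ) : Prop where
  δ_pos : 0 < δ
  α_pos : 0 < α
  smooth : ContDiff ℝ ∞ f
  compact_support : HasCompactSupport f
  nonneg : ∀ x, 0 ≤ f x
  le_one : ∀ x, f x ≤ 1
  eq_one : ∀ x, |x - lam| < 2 * δ → f x = 1
  eq_zero : ∀ x, 3 * δ < |x - lam| → f x = 0
  estimate : ∀ φ : E,
    α * (inner ℂ φ (realFunctionOf H f (realFunctionOf H f φ))).re ≤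
      (inner ℂ φ
        (realFunctionOf H f (Complex.I • compDom K (realFunctionOf H f) φ))).re

/-- `N_{[H,A]} = ‖[H,A]⁰ (H + i)⁻¹‖`. -/
def commN {H : E →ₗ.[ℂ] E} (K : H.domain →ₗ[ℂ] E) : ℝ :=
  opNorm (compDom K (resolvent H (-Complex.I)))

/-- `‖[H,A]⁰ f(H)‖`. -/
def commF [CompleteSpace E] {H : E →ₗ.[ℂ] E} (K : H.domain →ₗ[ℂ] E) (f : ℝ → ℝ) : ℝ :=
  opNorm (compDom K (realFunctionOf H f))

/-- `S = (1 + α⁻¹ ‖[H,A]⁰ f(H)‖)²`. -/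
def commS [CompleteSpace E] {H : E →ₗ.[ℂ] E} (K : H.domain →ₗ[ℂ] E) (f : ℝ → ℝ) (α : ℝ) : ℝ :=
  (1 + α⁻¹ * commF K f) ^ 2

/-- `Δ_f = (2π)⁻¹ ∫ |t f̂(t)| dt`, where `f̂(t) = ∫ e^{-itx} f(x) dx`. -/
def fourierDelta (f : ℝ → ℝ) : ℝ :=
  (2 * Real.pi)⁻¹ *
    ∫ t : ℝ, |t| * ‖∫ x : ℝ, Complex.exp (-(Complex.I * (t : ℂ) * (x : ℂ))) * (f x : ℂ)‖

/-- The constant `C_0`. -/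
def constZero [CompleteSpace E] {H : E →ₗ.[ℂ] E} (K : H.domain →ₗ[ℂ] E) (lam α δ : ℝ)
    (f : ℝ → ℝ) : ℝ :=
  (δ ^ 2)⁻¹ * (1 + |lam| + 2 * δ) * (1 + commS K f α) ^ 2 * commN K

/-- The constant `C_{1/2}`. -/
def constHalf [CompleteSpace E] {H : E →ₗ.[ℂ] E} (K : H.domain →ₗ[ℂ] E) (lam α δ : ℝ)
    (f : ℝ → ℝ) : ℝ :=
  2 * α ^ (-(1 / 2) : ℝ) * δ⁻¹ * (1 + |lam| + 3 * δ) * commS K f α * commN K *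
    (1 + δ * α⁻¹ * fourierDelta f * commN K * (1 + |lam| + 3 * δ))

/-- The constant `C_1`; here `c` is the constant `C_{H,A}`. -/
def constOne {H : E →ₗ.[ℂ] E} (K : H.domain →ₗ[ℂ] E) (c lam α δ : ℝ) (f : ℝ → ℝ) : ℝ :=
  α⁻¹ * (1 + |lam| + 3 * δ) *
    (c + 2 * fourierDelta f * commN K ^ 2 * (1 + |lam| + 3 * δ))

end Mourre

end

/-!
The proof is Mourre's method of differential inequalities, carried out with a regularisation which
only involves resolvents, so that all bounds scale correctly in `δ` and `α`.

Fix an index, let `θ = δ / α ≤ 1`, and let `z` lie in the strip `|Re z - λ| ≤ δ`, `0 ≤ Im z ≤ δ`.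
With `w = z + iδ`, put `B = θδ² (H - w̄)⁻¹ i[H, A]⁰ (H - w)⁻¹`. This operator is bounded and
self-adjoint, of norm `O(δ)`. The positive commutator estimate makes it bounded below by a multiple
of `δ` on the range of `f(H)` (`re_inner_regularised_ge`), and the hypotheses on the double
commutator make `[A, B]` bounded (`exists_hasComm_regularised`). The hypotheses on the constants say
that these bounds are uniform in the index, in units of `δ` (`exists_commutatorData`). The
commutator `[A, (H - w)⁻¹]` is computed by extending the form identity from the core `D` to the
closure of the joint graph of `A` and `H` on `D`.

The operator `H - z - iτB`, with `τ > 0` small, is invertible with an inverse `G(τ)` of norm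
`O(1 / (τδ))`, even for real `z`: `B` controls the part of a vector near the energy `λ`, and `H - z`
is bounded below by `δ` on the other part (`EnergyData.energy_aux`). Let
`D(τ) = (1 - iτA)⁻¹ ⟨A⟩⁻ˢ` and `F(τ) = D(τ)⋆ G(τ) D(τ)`. The energy estimate also shows that
`δ‖G D‖` and `δ‖D⋆ G‖` are `O(τ^(-1/2) (1 + δ‖F‖)^(1/2))`. The derivative of `G` is `iGBG`, which up
to terms with an additional factor `G⁻¹` is the commutator `-θ G [H, A]⁰ G`
(`CommutatorData.pertInv_mul_B_mul_pertInv`), that is, up to a term with `[A, B]`, the commutator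
`-θ [A, G]`. Between the weights, `A` costs only `τ^(s - 1)`. Altogether
`δ‖F'‖ ≤ C τ^(s - 3/2) (1 + δ‖F‖)` (`CommutatorData.exists_hasDerivAt_sandwich`).

As `s > 1/2`, this inequality is integrable at `τ = 0` (`gronwall_of_singular`). Thus `δF(τ)` is
bounded by a constant which depends on `s` and on the constant `C` of the hypotheses only, and it
converges as `τ → 0`, uniformly in `z`. The limit is continuous in the closed strip, and coincides
with the sandwiched resolvent wherever the latter exists (`exists_continuousOn_strip`). Restricted
to the real axis, it provides the boundary values from above; those from below are the adjoints.

All operators are written in terms of the bounded operator `R = (H + i)⁻¹`: for bounded `V`, the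
operator `H + V` is represented by `(H + V)(H + i)⁻¹ = 1 + (V - i)R`, see `shiftOp` and `pertInv`.
The spectral estimates for `f(H)` and `⟨A⟩⁻ˢ` come from comparing functions on the spectrum of `R`
(`norm_cfc_resolvent_le`).
-/

noncomputable section

namespace Mourre

section

variable {E : Type*} [NormedAddCommGroup E] [InnerProductSpace ℂ E]

/-! ### Resolvents of unbounded operators -/

theorem resolvent_sub_resolvent {T : E →ₗ.[ℂ] E} {z w : ℂ} (hz : z ∈ resolventSet T)
    (hw : w ∈ resolventSet T) :
    resolvent T z - resolvent T w = (z - w) • (resolvent T w * resolvent T z) := by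
  ext x
  have h := (resolvent_spec hw).left_inv ⟨_, (resolvent_spec hz).mem_domain x⟩
  have h1 := (resolvent_spec hz).right_inv x
  rw [sub_eq_iff_eq_add] at h1
  rw [h1, add_sub_assoc, ← sub_smul, map_add, map_smul] at h
  simp only [sub_apply, smul_apply,
    mul_apply_eq_comp]
  exact sub_eq_of_eq_add' h.symm

theorem commute_resolvent {T : E →ₗ.[ℂ] E} {z w : ℂ} (hz : z ∈ resolventSet T)
    (hw : w ∈ resolventSet T) : Commute (resolvent T z) (resolvent T w) := by
  rcases eq_or_ne z w with rfl | hne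
  · exact Commute.refl _
  have h1 := resolvent_sub_resolvent hz hw
  have h2 := resolvent_sub_resolvent hw hz
  rw [← neg_sub, h1, ← neg_sub z w, neg_smul, neg_inj] at h2
  exact (smul_right_injective _ (sub_ne_zero.2 hne) h2).symm

theorem resolvent_mem_domain {T : E →ₗ.[ℂ] E} {z : ℂ} (hz : z ∈ resolventSet T) (x : E) :
    resolvent T z x ∈ T.domain :=
  (resolvent_spec hz).mem_domain x

theorem apply_resolvent {T : E →ₗ.[ℂ] E} {z : ℂ} (hz : z ∈ resolventSet T) (x : E) :
    T ⟨resolvent T z x, resolvent_mem_domain hz x⟩ = x + z • resolvent T z x := by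
  rw [← sub_eq_iff_eq_add]
  exact (resolvent_spec hz).right_inv x

section SelfAdjoint

variable [CompleteSpace E]

/-- Stated without division, so that it also covers real `z`. -/
theorem norm_resolvent_apply_le {T : E →ₗ.[ℂ] E} (hT : IsSelfAdjoint T) {z : ℂ}
    (hz : z ∈ resolventSet T) (x : E) : |z.im| * ‖resolvent T z x‖ ≤ ‖x‖ := by
  have h := norm_sub_smul_ge hT z ⟨_, resolvent_mem_domain hz x⟩
  rwa [apply_resolvent hz, add_sub_cancel_right] at h

theorem norm_resolvent_le {T : E →ₗ.[ℂ] E} (hT : IsSelfAdjoint T) {z : ℂ} (hz : z.im ≠ 0) :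
    ‖resolvent T z‖ ≤ |z.im|⁻¹ := by
  refine ContinuousLinearMap.opNorm_le_bound _ (by positivity) fun x => ?_
  rw [inv_mul_eq_div, le_div_iff₀ (abs_pos.2 hz), mul_comm]
  exact norm_resolvent_apply_le hT (mem_resolventSet_of_im_ne_zero hT hz) x

theorem star_resolvent {T : E →ₗ.[ℂ] E} (hT : IsSelfAdjoint T) {z : ℂ} (hz : z.im ≠ 0) :
    star (resolvent T z) = resolvent T (starRingEnd ℂ z) := by
  have hz' : (starRingEnd ℂ z).im ≠ 0 := by simpa using hz
  have h1 := mem_resolventSet_of_im_ne_zero hT hz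
  have h2 := mem_resolventSet_of_im_ne_zero hT hz'
  rw [ContinuousLinearMap.star_eq_adjoint]
  refine ((ContinuousLinearMap.eq_adjoint_iff _ _).2 fun x y => ?_).symm
  have h := symm_of_isSelfAdjoint hT ⟨_, resolvent_mem_domain h2 x⟩
    ⟨_, resolvent_mem_domain h1 y⟩
  rw [apply_resolvent h1, apply_resolvent h2, inner_add_left, inner_add_right, inner_smul_left,
    inner_smul_right, Complex.conj_conj] at h
  exact (add_right_cancel h).symm

theorem neg_I_mem_resolventSet {T : E →ₗ.[ℂ] E} (hT : IsSelfAdjoint T) :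
    -Complex.I ∈ resolventSet T :=
  mem_resolventSet_of_im_ne_zero hT (by simp)

/-- The resolvent at `-i` of a self-adjoint operator satisfies the algebraic identity which
expresses the symmetry of the operator. -/
theorem star_resolvent_sub {T : E →ₗ.[ℂ] E} (hT : IsSelfAdjoint T) :
    star (resolvent T (-Complex.I)) - resolvent T (-Complex.I) =
      (2 * Complex.I) • (star (resolvent T (-Complex.I)) * resolvent T (-Complex.I)) := by
  have h1 := neg_I_mem_resolventSet hT
  have h2 : Complex.I ∈ resolventSet T := mem_resolventSet_of_im_ne_zero hT (by simp)
  have h := star_resolvent hT (z := -Complex.I) (by simp)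
  rw [map_neg, Complex.conj_I, neg_neg] at h
  rw [h, resolvent_sub_resolvent h2 h1, (commute_resolvent h1 h2).eq]
  congr 1
  ring

theorem isStarNormal_resolvent {T : E →ₗ.[ℂ] E} (hT : IsSelfAdjoint T) :
    IsStarNormal (resolvent T (-Complex.I)) := by
  have h := star_resolvent hT (z := -Complex.I) (by simp)
  constructor
  rw [h]
  exact commute_resolvent (mem_resolventSet_of_im_ne_zero hT (by simp))
    (neg_I_mem_resolventSet hT)

end SelfAdjoint

/-! ### Bounded perturbations of resolvents -/

/-- If `R = (H + i)⁻¹` then `shiftOp R V` is the bounded operator `(H + V)(H + i)⁻¹`. -/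
def shiftOp (R V : E →L[ℂ] E) : E →L[ℂ] E :=
  1 + (V - Complex.I • 1) * R

/-- If `R = (H + i)⁻¹` then `shiftInv R V` is the operator `(H + i)(H + V)⁻¹`, provided `H + V` is
invertible. -/
def shiftInv (R V : E →L[ℂ] E) : E →L[ℂ] E :=
  Ring.inverse (shiftOp R V)

/-- If `R = (H + i)⁻¹` then `pertInv R V` is the operator `(H + V)⁻¹`, provided `H + V` is
invertible. -/
def pertInv (R V : E →L[ℂ] E) : E →L[ℂ] E :=
  R * shiftInv R V

theorem shiftOp_mul_shiftInv {R V : E →L[ℂ] E} (h : IsUnit (shiftOp R V)) :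
    shiftOp R V * shiftInv R V = 1 :=
  Ring.mul_inverse_cancel _ h

theorem shiftInv_mul_shiftOp {R V : E →L[ℂ] E} (h : IsUnit (shiftOp R V)) :
    shiftInv R V * shiftOp R V = 1 :=
  Ring.inverse_mul_cancel _ h

theorem pertInv_mul_shiftOp {R V : E →L[ℂ] E} (h : IsUnit (shiftOp R V)) :
    pertInv R V * shiftOp R V = R := by
  rw [pertInv, mul_assoc, shiftInv_mul_shiftOp h, mul_one]

/-- The second resolvent identity. -/
theorem pertInv_sub_pertInv {R V V' : E →L[ℂ] E} (h : IsUnit (shiftOp R V))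
    (h' : IsUnit (shiftOp R V')) :
    pertInv R V - pertInv R V' = pertInv R V * (V' - V) * pertInv R V' := by
  have h1 : pertInv R V - pertInv R V' =
      R * (shiftInv R V * (shiftOp R V' - shiftOp R V) * shiftInv R V') := by
    rw [mul_sub, shiftInv_mul_shiftOp h, sub_mul, mul_assoc, shiftOp_mul_shiftInv h', mul_one,
      one_mul, mul_sub]
    rfl
  rw [h1, shiftOp, shiftOp, pertInv, pertInv]
  noncomm_ring

theorem shiftInv_sub_shiftInv {R V V' : E →L[ℂ] E} (h : IsUnit (shiftOp R V))
    (h' : IsUnit (shiftOp R V')) :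
    shiftInv R V - shiftInv R V' = shiftInv R V * (V' - V) * pertInv R V' := by
  have h1 : shiftInv R V - shiftInv R V' =
      shiftInv R V * (shiftOp R V' - shiftOp R V) * shiftInv R V' := by
    rw [mul_sub, shiftInv_mul_shiftOp h, sub_mul, mul_assoc, shiftOp_mul_shiftInv h', mul_one,
      one_mul]
  rw [h1, shiftOp, shiftOp, pertInv]
  noncomm_ring

section Complete

variable [CompleteSpace E]

/-- The adjoint of `(H + V)⁻¹` is `(H + V⋆)⁻¹`. -/
theorem star_pertInv {R V : E →L[ℂ] E} (hR : star R - R = (2 * Complex.I) • (star R * R))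
    (h : IsUnit (shiftOp R V)) (h' : IsUnit (shiftOp R (star V))) :
    star (pertInv R V) = pertInv R (star V) := by
  have h1 : star (shiftOp R V) * R = star R * shiftOp R (star V) := by
    have h2 : star R = R + (2 * Complex.I) • (star R * R) := by rw [← hR]; abel
    have h3 : star (shiftOp R V) = 1 + star R * (star V + Complex.I • 1) := by
      simp [shiftOp, star_smul, sub_eq_add_neg]
    rw [h3, shiftOp]
    simp only [mul_sub, sub_mul, mul_add, add_mul, smul_mul_assoc, mul_smul_comm, one_mul,
      mul_one, mul_assoc]
    nth_rw 3 [h2]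
    module
  have h4 : star (shiftInv R V) * star (shiftOp R V) = 1 := by
    rw [← star_mul, shiftOp_mul_shiftInv h, star_one]
  calc star (pertInv R V) = star (shiftInv R V) * (star R * shiftOp R (star V)) *
        shiftInv R (star V) := by
        rw [pertInv, star_mul, mul_assoc, mul_assoc, shiftOp_mul_shiftInv h', mul_one]
    _ = pertInv R (star V) := by
        rw [← h1, ← mul_assoc, h4, one_mul, pertInv]

/-- A lower bound for `H + V` and for its adjoint `H + V⋆` makes `H + V` invertible. -/
theorem isUnit_shiftOp {R V : E →L[ℂ] E} [IsStarNormal R]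
    (hR : star R - R = (2 * Complex.I) • (star R * R))
    {c : ℝ} (hc : 0 < c) (h : ∀ x, c * ‖R x‖ ≤ ‖shiftOp R V x‖)
    (h' : ∀ x, c * ‖R x‖ ≤ ‖shiftOp R (star V) x‖) : IsUnit (shiftOp R V) := by
  rw [ContinuousLinearMap.isUnit_iff_bijective]
  set M : ℝ := ‖V - Complex.I • (1 : E →L[ℂ] E)‖ with hM
  have hM0 : 0 ≤ M := norm_nonneg _
  have hbd : ∀ x, ‖x‖ ≤ (1 + M / c) * ‖shiftOp R V x‖ := fun x => by
    have h1 : x = shiftOp R V x - (V - Complex.I • (1 : E →L[ℂ] E)) (R x) := by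
      simp [shiftOp]
    have h2 : ‖R x‖ ≤ ‖shiftOp R V x‖ / c := by
      rw [le_div_iff₀ hc, mul_comm]; exact h x
    calc ‖x‖ ≤ ‖shiftOp R V x‖ + M * ‖R x‖ := by
          nth_rw 1 [h1]
          exact (norm_sub_le _ _).trans
            (add_le_add le_rfl (ContinuousLinearMap.le_opNorm _ _))
      _ ≤ ‖shiftOp R V x‖ + M * (‖shiftOp R V x‖ / c) := by gcongr
      _ = _ := by ring
  have hanti : AntilipschitzWith (1 + M / c).toNNReal (shiftOp R V) := by
    refine ContinuousLinearMap.antilipschitz_of_bound _ fun x => ?_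
    rw [Real.coe_toNNReal _ (by positivity)]
    exact hbd x
  refine ⟨hanti.injective, ?_⟩
  have hclosed : IsClosed (Set.range (shiftOp R V)) :=
    hanti.isClosed_range (shiftOp R V).uniformContinuous
  have horth : (LinearMap.range (shiftOp R V).toLinearMap)ᗮ = ⊥ := by
    rw [Submodule.eq_bot_iff]
    intro y hy
    have h0 : star (shiftOp R V) y = 0 := by
      rw [ContinuousLinearMap.star_eq_adjoint, ← inner_self_eq_zero (𝕜 := ℂ),
        ContinuousLinearMap.adjoint_inner_left]
      exact (Submodule.mem_orthogonal' _ _).1 hy _ ⟨_, rfl⟩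
    have h3 : star (shiftOp R V) = 1 + star R * (star V + Complex.I • 1) := by
      simp [shiftOp, star_smul, sub_eq_add_neg]
    set v := (star V + Complex.I • (1 : E →L[ℂ] E)) y with hv
    have h4 : y = - star R v := by
      rw [h3] at h0
      exact eq_neg_of_add_eq_zero_left h0
    -- `y` lies in the range of `R`, that is, in the domain of `H`, and `(H + V⋆) y = 0`
    have h5 : star R = R * (1 + (2 * Complex.I) • star R) := by
      rw [mul_add, mul_one, mul_smul_comm, ← star_comm_self' R, ← hR]
      abel
    have h6 : y = R (-(star V - Complex.I • (1 : E →L[ℂ] E)) y) := by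
      nth_rw 1 [h4, h5]
      rw [mul_apply_eq_comp, ← map_neg]
      congr 1
      have h7 : star R v = - y := by rw [← neg_eq_iff_eq_neg, ← h4]
      rw [add_apply, smul_apply, h7]
      simp only [one_apply_eq_self, smul_apply, hv, sub_apply, add_apply]
      module
    have h7 := h' (-(star V - Complex.I • (1 : E →L[ℂ] E)) y)
    have h8 : shiftOp R (star V) (-(star V - Complex.I • (1 : E →L[ℂ] E)) y) = 0 := by
      rw [shiftOp, add_apply, mul_apply_eq_comp, ← h6]
      simp
    rw [h8, norm_zero, ← h6] at h7
    exact norm_le_zero_iff.1 (by nlinarith [norm_nonneg y])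
  have : CompleteSpace (LinearMap.range (shiftOp R V).toLinearMap) :=
    IsClosed.completeSpace_coe (s := (LinearMap.range (shiftOp R V).toLinearMap : Set E))
      (hs := by rw [LinearMap.coe_range]; exact hclosed)
  have htop := (Submodule.orthogonal_eq_bot_iff).1 horth
  exact LinearMap.range_eq_top.1 htop

end Complete

end

section

variable {E : Type*} [NormedAddCommGroup E] [InnerProductSpace ℂ E] [CompleteSpace E]

/-! ### Functional calculus of a self-adjoint operator -/

/-- The function of `w = (x + i)⁻¹` which represents the function `g` of `x`; it vanishes at
`w = 0`, the point which corresponds to `x = ∞`. -/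
def liftFn (g : ℝ → ℂ) (w : ℂ) : ℂ :=
  if w = 0 then 0 else g (w⁻¹).re

@[simp] theorem liftFn_zero (g : ℝ → ℂ) : liftFn g 0 = 0 := if_pos rfl

theorem ofReal_add_I_ne_zero (x : ℝ) : (x : ℂ) + Complex.I ≠ 0 := fun h => by
  simpa using congrArg Complex.im h

@[simp] theorem liftFn_inv (g : ℝ → ℂ) (x : ℝ) : liftFn g ((x : ℂ) + Complex.I)⁻¹ = g x := by
  rw [liftFn, if_neg (inv_ne_zero (ofReal_add_I_ne_zero x)), inv_inv]
  simp

theorem functionOf_eq (T : E →ₗ.[ℂ] E) (g : ℝ → ℂ) :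
    functionOf T g = cfc (liftFn g) (resolvent T (-Complex.I)) := rfl

/-- The spectrum of `(T + i)⁻¹` is contained in the image of `ℝ ∪ {∞}`: by the symmetry of `T`,
every point `w` of the spectrum satisfies `w̄ - w = 2i w̄w`. -/
theorem eq_zero_or_eq_inv_of_mem_spectrum {T : E →ₗ.[ℂ] E} (hT : IsSelfAdjoint T) {w : ℂ}
    (hw : w ∈ spectrum ℂ (resolvent T (-Complex.I))) :
    w = 0 ∨ ∃ x : ℝ, w = ((x : ℂ) + Complex.I)⁻¹ := by
  have := isStarNormal_resolvent hT
  set R := resolvent T (-Complex.I)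
  have h1 : cfc (fun w : ℂ => star w - w) R = star R - R := by
    rw [cfc_sub (fun w : ℂ => star w) (fun w => w), cfc_star_id R, cfc_id' ℂ R]
  have h2 : cfc (fun w : ℂ => (2 * Complex.I) * (star w * w)) R =
      (2 * Complex.I) • (star R * R) := by
    rw [cfc_const_mul (2 * Complex.I) (fun w : ℂ => star w * w),
      cfc_mul (fun w : ℂ => star w) (fun w => w), cfc_star_id R, cfc_id' ℂ R]
  have h3 := (star_resolvent_sub hT)
  rw [← h1, ← h2, cfc_eq_cfc_iff_eqOn] at h3
  have h4 := h3 hw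
  by_cases h0 : w = 0
  · exact Or.inl h0
  refine Or.inr ⟨(w⁻¹).re, ?_⟩
  have hs : (starRingEnd ℂ) w ≠ 0 := by simpa using h0
  have h5 : w⁻¹ - (starRingEnd ℂ) w⁻¹ = 2 * Complex.I := by
    rw [map_inv₀]
    simp only [Complex.star_def] at h4
    field_simp
    linear_combination h4
  have h6 : (w⁻¹).im = 1 := by
    have := congrArg Complex.im h5
    simp only [Complex.sub_im, Complex.conj_im, Complex.mul_im, Complex.re_ofNat, Complex.I_im,
      Complex.im_ofNat, Complex.I_re] at this
    linarith
  rw [← inv_inv w]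
  congr 1
  rw [inv_inv]
  apply Complex.ext <;> simp [h6]

/-- The decay of `g` at infinity is what makes `liftFn g` continuous at `0`. -/
theorem continuousOn_liftFn {T : E →ₗ.[ℂ] E} (hT : IsSelfAdjoint T) {g : ℝ → ℂ}
    (hg : Continuous g) (hg0 : Tendsto g (cocompact ℝ) (𝓝 0)) :
    ContinuousOn (liftFn g) (spectrum ℂ (resolvent T (-Complex.I))) := by
  intro w hw
  by_cases h0 : w = 0
  · subst h0
    rw [← continuousWithinAt_sdiff_self, ContinuousWithinAt, liftFn_zero]
    have h1 : Tendsto (fun w : ℂ => (w⁻¹).re)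
        (𝓝[spectrum ℂ (resolvent T (-Complex.I)) \ {0}] 0) (cocompact ℝ) := by
      rw [← Metric.cobounded_eq_cocompact, ← tendsto_norm_atTop_iff_cobounded]
      have h2 : Tendsto (fun w : ℂ => ‖w⁻¹‖ - 1)
          (𝓝[spectrum ℂ (resolvent T (-Complex.I)) \ {0}] 0) atTop := by
        refine tendsto_atTop_add_const_right _ _ ?_
        refine (tendsto_norm_inv_nhdsNE_zero_atTop).mono_left
          (nhdsWithin_mono _ fun w hw => hw.2)
      refine tendsto_atTop_mono' _ ?_ h2
      filter_upwards [self_mem_nhdsWithin] with w hw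
      obtain ⟨x, rfl⟩ := (eq_zero_or_eq_inv_of_mem_spectrum hT hw.1).resolve_left hw.2
      have := norm_add_le (x : ℂ) Complex.I
      simp only [inv_inv, Complex.norm_I, Complex.norm_real, Complex.add_re, Complex.ofReal_re,
        Complex.I_re, add_zero] at this ⊢
      linarith
    refine (hg0.comp h1).congr' ?_
    filter_upwards [self_mem_nhdsWithin] with w hw
    rw [liftFn, if_neg (by simpa using hw.2)]
    rfl
  · have h1 : ContinuousAt (fun w : ℂ => g (w⁻¹).re) w :=
      hg.continuousAt.comp (Complex.continuous_re.continuousAt.comp (continuousAt_inv₀ h0))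
    refine (h1.congr ?_).continuousWithinAt
    filter_upwards [isOpen_ne.mem_nhds h0] with v hv
    rw [liftFn, if_neg hv]

open scoped ComplexOrder in
/-- The functional calculus is monotone: a pointwise bound `|f| ≤ |g|` on the spectrum of a normal
operator `a` implies `‖f(a) x‖ ≤ ‖g(a) x‖`. -/
theorem norm_cfc_apply_le {a : E →L[ℂ] E} [IsStarNormal a] {f g : ℂ → ℂ}
    (hf : ContinuousOn f (spectrum ℂ a)) (hg : ContinuousOn g (spectrum ℂ a))
    (h : ∀ w ∈ spectrum ℂ a, ‖f w‖ ≤ ‖g w‖) (x : E) : ‖cfc f a x‖ ≤ ‖cfc g a x‖ := by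
  have hsq : ∀ {f : ℂ → ℂ}, ContinuousOn f (spectrum ℂ a) →
      cfc (fun w => star (f w) * f w) a = star (cfc f a) * cfc f a := fun hf => by
    rw [cfc_mul _ _ a hf.star hf, cfc_star]
  have hns : ∀ {f : ℂ → ℂ}, inner ℂ ((star (cfc f a) * cfc f a) x) x =
      ((‖cfc f a x‖ ^ 2 : ℝ) : ℂ) :=
    fun {f} => by
      rw [mul_apply_eq_comp, ContinuousLinearMap.star_eq_adjoint,
        ContinuousLinearMap.adjoint_inner_left, inner_self_eq_norm_sq_to_K]
      norm_cast
  have h0 : (0 : E →L[ℂ] E) ≤ star (cfc g a) * cfc g a - star (cfc f a) * cfc f a := by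
    rw [← hsq hf, ← hsq hg, ← cfc_sub (fun w => star (g w) * g w) (fun w => star (f w) * f w) a
      (hg.star.mul hg) (hf.star.mul hf)]
    refine cfc_nonneg fun w hw => ?_
    have h1 : ∀ v : ℂ, star v * v = ((‖v‖ ^ 2 : ℝ) : ℂ) := fun v => by
      rw [Complex.star_def, ← Complex.normSq_eq_conj_mul_self, Complex.normSq_eq_norm_sq]
    rw [h1, h1, ← Complex.ofReal_sub]
    have h2 := h w hw
    exact_mod_cast sub_nonneg.2 (pow_le_pow_left₀ (norm_nonneg _) h2 2)
  have h1 := ((ContinuousLinearMap.nonneg_iff_isPositive _).1 h0).2 x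
  rw [ContinuousLinearMap.reApplyInnerSelf_apply, sub_apply, inner_sub_left, hns, hns,
    ← Complex.ofReal_sub] at h1
  exact le_of_sq_le_sq (sub_nonneg.1 h1) (norm_nonneg _)

/-- Comparison of `g₁(T)(p₁(T + i) + q₁)φ` with `g₂(T)(p₂(T + i) + q₂)φ`, where
`φ = (T + i)⁻¹ψ`. -/
theorem norm_cfc_resolvent_le {T : E →ₗ.[ℂ] E} (hT : IsSelfAdjoint T) {g₁ g₂ : ℂ → ℂ}
    (hg₁ : ContinuousOn g₁ (spectrum ℂ (resolvent T (-Complex.I))))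
    (hg₂ : ContinuousOn g₂ (spectrum ℂ (resolvent T (-Complex.I)))) {p₁ q₁ p₂ q₂ : ℂ}
    (h0 : ‖g₁ 0 * p₁‖ ≤ ‖g₂ 0 * p₂‖)
    (h : ∀ x : ℝ, ‖g₁ ((x : ℂ) + Complex.I)⁻¹ * (p₁ * (x + Complex.I) + q₁)‖ ≤
      ‖g₂ ((x : ℂ) + Complex.I)⁻¹ * (p₂ * (x + Complex.I) + q₂)‖) (ψ : E) :
    ‖cfc g₁ (resolvent T (-Complex.I)) (p₁ • ψ + q₁ • resolvent T (-Complex.I) ψ)‖ ≤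
      ‖cfc g₂ (resolvent T (-Complex.I)) (p₂ • ψ + q₂ • resolvent T (-Complex.I) ψ)‖ := by
  have := isStarNormal_resolvent hT
  set R := resolvent T (-Complex.I)
  have key : ∀ {g : ℂ → ℂ}, ContinuousOn g (spectrum ℂ R) → ∀ p q : ℂ,
      cfc g R (p • ψ + q • R ψ) = cfc (fun w => g w * (p + q * w)) R ψ := fun {g} hg p q => by
    have h1 : cfc (fun w : ℂ => p + q * w) R = p • 1 + q • R := by
      rw [cfc_add R (fun _ => p) (fun w => q * w), cfc_const p R, cfc_const_mul_id q R,
        Algebra.algebraMap_eq_smul_one]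
    rw [cfc_mul g (fun w => p + q * w) R hg, h1]
    simp
  have hc : ∀ p q : ℂ, ContinuousOn (fun w : ℂ => p + q * w) (spectrum ℂ R) := fun p q => by
    fun_prop
  rw [key hg₁, key hg₂]
  refine norm_cfc_apply_le (hg₁.mul (hc _ _)) (hg₂.mul (hc _ _)) (fun w hw => ?_) ψ
  rcases eq_zero_or_eq_inv_of_mem_spectrum hT hw with rfl | ⟨x, rfl⟩
  · simpa using h0
  · have h1 : ∀ p q : ℂ, p + q * ((x : ℂ) + Complex.I)⁻¹ =
        (p * (x + Complex.I) + q) * ((x : ℂ) + Complex.I)⁻¹ := fun p q => by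
      field_simp [ofReal_add_I_ne_zero x]
    simp only [Pi.mul_apply]
    rw [h1, h1, ← mul_assoc, ← mul_assoc, norm_mul, norm_mul _ ((x : ℂ) + Complex.I)⁻¹]
    exact mul_le_mul_of_nonneg_right (h x) (norm_nonneg _)

theorem commute_functionOf_resolvent {T : E →ₗ.[ℂ] E} (hT : IsSelfAdjoint T) (g : ℝ → ℂ) {z : ℂ}
    (hz : z ∈ resolventSet T) : Commute (functionOf T g) (resolvent T z) := by
  refine Commute.cfc (commute_resolvent (neg_I_mem_resolventSet hT) hz) ?_ _
  rw [star_resolvent hT (by simp)]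
  exact commute_resolvent (mem_resolventSet_of_im_ne_zero hT (by simp)) hz

theorem star_functionOf_ofReal (T : E →ₗ.[ℂ] E) (g : ℝ → ℝ) :
    star (functionOf T fun x => (g x : ℂ)) = functionOf T fun x => (g x : ℂ) := by
  rw [functionOf_eq, ← cfc_star]
  congr 1
  funext w
  by_cases h : w = 0 <;> simp [liftFn, h]

section Cutoff

variable {T : E →ₗ.[ℂ] E} (hT : IsSelfAdjoint T) {f : ℝ → ℝ} (hf : Continuous f)
  (hfs : HasCompactSupport f) (hf0 : ∀ x, 0 ≤ f x) (hf1 : ∀ x, f x ≤ 1)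

include hT hf hfs

theorem continuousOn_liftFn_ofReal :
    ContinuousOn (liftFn fun x => (f x : ℂ)) (spectrum ℂ (resolvent T (-Complex.I))) :=
  continuousOn_liftFn hT (by fun_prop)
    ((Complex.continuous_ofReal.tendsto' 0 0 Complex.ofReal_zero).comp hfs.is_zero_at_infty)

theorem one_sub_realFunctionOf :
    1 - realFunctionOf T f =
      cfc (fun w => 1 - liftFn (fun x => (f x : ℂ)) w) (resolvent T (-Complex.I)) := by
  have := isStarNormal_resolvent hT
  rw [cfc_sub (fun _ : ℂ => 1) _ _ continuousOn_const (continuousOn_liftFn_ofReal hT hf hfs),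
    cfc_const_one ℂ (resolvent T (-Complex.I))]
  rfl

include hf0 hf1

/-- The spectral part of `φ = (T + i)⁻¹ψ` away from the energy `lam` is controlled by
`(T - z)φ`. -/
theorem norm_one_sub_realFunctionOf_resolvent_le {lam δ : ℝ}
    (hf2 : ∀ x, |x - lam| < 2 * δ → f x = 1) {z : ℂ} (hz : |z.re - lam| ≤ δ) (ψ : E) :
    δ * ‖(1 - realFunctionOf T f) (resolvent T (-Complex.I) ψ)‖ ≤
      ‖ψ - (z + Complex.I) • resolvent T (-Complex.I) ψ‖ := by
  have := isStarNormal_resolvent hT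
  have hδ : 0 ≤ δ := (abs_nonneg _).trans hz
  rw [one_sub_realFunctionOf hT hf hfs]
  have h := norm_cfc_resolvent_le hT
    (continuousOn_const.sub (continuousOn_liftFn_ofReal hT hf hfs)) (g₁ := fun w => 1 - _)
    (g₂ := fun _ => 1) continuousOn_const (p₁ := 0) (q₁ := δ) (p₂ := 1)
    (q₂ := -(z + Complex.I)) (by simp)
    (fun x => by
      rw [liftFn_inv, norm_mul, norm_mul, ← Complex.ofReal_one, ← Complex.ofReal_sub,
        Complex.norm_real, Real.norm_of_nonneg (by linarith [hf1 x])]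
      simp only [zero_mul, zero_add, Complex.norm_real, Real.norm_of_nonneg hδ, Complex.ofReal_one,
        one_mul, norm_one]
      by_cases hx : |x - lam| < 2 * δ
      · rw [hf2 x hx]
        simp
      · have h1 : (x : ℂ) + Complex.I + -(z + Complex.I) = x - z := by ring
        rw [h1]
        have h2 := Complex.abs_re_le_norm (x - z)
        rw [Complex.sub_re, Complex.ofReal_re] at h2
        have h3 := abs_sub_le x z.re lam
        nlinarith [hf0 x]) ψ
  rw [zero_smul, zero_add, map_smul, norm_smul, Complex.norm_real, Real.norm_of_nonneg hδ,
    cfc_const_one ℂ (resolvent T (-Complex.I)), one_apply_eq_self, one_smul, neg_smul,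
    ← sub_eq_add_neg] at h
  exact h

omit hf0 hf1 in
/-- On the spectral subspace of the cutoff `f`, the operator `T - w` is bounded by `c`. -/
theorem norm_realFunctionOf_sub_le {w : ℂ} {c : ℝ} (hc : 0 ≤ c)
    (hfc : ∀ x : ℝ, f x ≠ 0 → ‖(x : ℂ) - w‖ ≤ c) (ψ : E) :
    ‖realFunctionOf T f (ψ - (w + Complex.I) • resolvent T (-Complex.I) ψ)‖ ≤
      c * ‖realFunctionOf T f (resolvent T (-Complex.I) ψ)‖ := by
  have h := norm_cfc_resolvent_le hT
    (continuousOn_liftFn_ofReal hT hf hfs) (continuousOn_liftFn_ofReal hT hf hfs) (p₁ := 1)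
    (q₁ := -(w + Complex.I)) (p₂ := 0) (q₂ := c) (by simp)
    (fun x => by
      rw [liftFn_inv, norm_mul, norm_mul]
      by_cases hx : f x = 0
      · simp [hx]
      · refine mul_le_mul_of_nonneg_left ?_ (norm_nonneg _)
        have h1 : 1 * ((x : ℂ) + Complex.I) + -(w + Complex.I) = x - w := by ring
        rw [h1, zero_mul, zero_add, Complex.norm_real, Real.norm_of_nonneg hc]
        exact hfc x hx) ψ
  rw [zero_smul, zero_add, map_smul, norm_smul, Complex.norm_real, Real.norm_of_nonneg hc,
    one_smul, neg_smul, ← sub_eq_add_neg] at h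
  exact h

end Cutoff

section Weight

variable {T : E →ₗ.[ℂ] E} (hT : IsSelfAdjoint T) {s : ℝ} (hs : 0 < s)

include hT hs

theorem continuousOn_liftFn_bracket :
    ContinuousOn (liftFn fun x => (((1 + x ^ 2) ^ (-s / 2) : ℝ) : ℂ))
      (spectrum ℂ (resolvent T (-Complex.I))) := by
  have hpos : ∀ x : ℝ, 0 < 1 + x ^ 2 := fun x => by positivity
  refine continuousOn_liftFn hT ?_ ?_
  · refine Complex.continuous_ofReal.comp (Continuous.rpow_const (by fun_prop) fun x => ?_)
    exact Or.inl (hpos x).ne'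
  · have h1 : Tendsto (fun x : ℝ => 1 + x ^ 2) (cocompact ℝ) atTop := by
      refine tendsto_atTop_add_const_left _ _ ?_
      have h2 := (tendsto_pow_atTop (α := ℝ) two_ne_zero).comp
        (tendsto_norm_cocompact_atTop (E := ℝ))
      refine h2.congr fun x => ?_
      simp
    have h2 := (tendsto_rpow_neg_atTop (half_pos hs)).comp h1
    have h3 := (Complex.continuous_ofReal.tendsto 0).comp h2
    rw [Complex.ofReal_zero] at h3
    refine h3.congr fun x => ?_
    simp [neg_div]

theorem norm_bracketNegPow_apply_le (ψ : E) : ‖bracketNegPow T s ψ‖ ≤ ‖ψ‖ := by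
  have := isStarNormal_resolvent hT
  have h := norm_cfc_resolvent_le hT (continuousOn_liftFn_bracket hT hs)
    (g₂ := fun _ => 1) continuousOn_const (p₁ := 1) (q₁ := 0) (p₂ := 1) (q₂ := 0) (by simp)
    (fun x => by
      rw [liftFn_inv, norm_mul, norm_mul]
      refine mul_le_mul_of_nonneg_right ?_ (norm_nonneg _)
      rw [Complex.norm_real, norm_one, Real.norm_of_nonneg (by positivity)]
      exact Real.rpow_le_one_of_one_le_of_nonpos (by nlinarith [sq_nonneg x]) (by linarith)) ψ
  rw [← functionOf_eq, ← bracketNegPow] at h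
  simpa [cfc_const_one ℂ (resolvent T (-Complex.I))] using h

/-- The interpolation bound `‖⟨T⟩⁻ˢ T (1 - iτT)⁻¹‖ ≤ τˢ⁻¹`, applied to vectors of the form
`(1 - iτT)(T + i)⁻¹ψ`. -/
theorem norm_bracketNegPow_sub_le (hs' : s ≤ 1) {τ : ℝ} (hτ : 0 < τ) (ψ : E) :
    ‖bracketNegPow T s (ψ - Complex.I • resolvent T (-Complex.I) ψ)‖ ≤
      τ ^ (s - 1) * ‖resolvent T (-Complex.I) ψ -
        (Complex.I * τ) • (ψ - Complex.I • resolvent T (-Complex.I) ψ)‖ := by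
  have := isStarNormal_resolvent hT
  have hτs : 0 ≤ τ ^ (s - 1) := by positivity
  have h := norm_cfc_resolvent_le hT (continuousOn_liftFn_bracket hT hs)
    (g₂ := fun _ => ((τ ^ (s - 1) : ℝ) : ℂ)) continuousOn_const (p₁ := 1) (q₁ := -Complex.I)
    (p₂ := -(Complex.I * τ)) (q₂ := 1 - τ) (by rw [liftFn_zero, zero_mul, norm_zero]; positivity)
    (fun x => by
      have h1 : (1 : ℂ) * (x + Complex.I) + -Complex.I = x := by ring
      have h2 : -(Complex.I * τ) * ((x : ℂ) + Complex.I) + (1 - τ) =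
          1 - Complex.I * ((τ * x : ℝ) : ℂ) := by
        push_cast
        linear_combination (-τ : ℂ) * Complex.I_mul_I
      rw [liftFn_inv, h1, h2, norm_mul, norm_mul, Complex.norm_real, Complex.norm_real,
        Complex.norm_real, Real.norm_of_nonneg (by positivity), Real.norm_of_nonneg hτs]
      set y : ℝ := |x|
      have hy : 0 ≤ y := abs_nonneg x
      rw [Real.norm_eq_abs]
      have h3 : max 1 (τ * y) ≤ ‖1 - Complex.I * ((τ * x : ℝ) : ℂ)‖ := by
        refine max_le ?_ ?_
        · simpa using Complex.abs_re_le_norm (1 - Complex.I * ((τ * x : ℝ) : ℂ))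
        · have := Complex.abs_im_le_norm (1 - Complex.I * ((τ * x : ℝ) : ℂ))
          simpa [abs_mul, abs_of_pos hτ] using this
      refine le_trans ?_ (mul_le_mul_of_nonneg_left h3 hτs)
      rcases hy.eq_or_lt with h0 | h0
      · change _ * y ≤ _
        rw [← h0]
        simp only [mul_zero]
        positivity
      have h4 : (1 + x ^ 2) ^ (-s / 2) ≤ y ^ (-s) := by
        have h5 : y ^ (-s) = (y ^ 2) ^ (-s / 2) := by
          rw [← Real.rpow_natCast, ← Real.rpow_mul hy]
          congr 1
          push_cast
          ring
        rw [h5]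
        refine Real.rpow_le_rpow_of_nonpos (by positivity) ?_ (by linarith)
        rw [sq_abs]
        linarith
      calc (1 + x ^ 2) ^ (-s / 2) * y ≤ y ^ (-s) * y := by gcongr
        _ = y ^ (1 - s) := by
          rw [sub_eq_neg_add, Real.rpow_add h0, Real.rpow_one]
        _ = τ ^ (s - 1) * (τ * y) ^ (1 - s) := by
          rw [Real.mul_rpow hτ.le hy, ← mul_assoc, ← Real.rpow_add hτ]
          simp
        _ ≤ τ ^ (s - 1) * max 1 (τ * y) := by
          gcongr
          rcases le_total 1 (τ * y) with h5 | h5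
          · rw [max_eq_right h5]
            nth_rw 2 [← Real.rpow_one (τ * y)]
            exact Real.rpow_le_rpow_of_exponent_le h5 (by linarith)
          · rw [max_eq_left h5]
            exact Real.rpow_le_one (by positivity) h5 (by linarith)) ψ
  rw [cfc_const _ (resolvent T (-Complex.I)), Algebra.algebraMap_eq_smul_one, smul_apply,
    one_apply_eq_self, norm_smul, Complex.norm_real, Real.norm_of_nonneg hτs, one_smul, neg_smul,
    ← sub_eq_add_neg] at h
  refine h.trans_eq ?_
  congr 2
  simp only [smul_sub, sub_smul, smul_smul, one_smul, neg_smul]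
  have h5 : Complex.I * (τ : ℂ) * Complex.I = -τ := by
    linear_combination (τ : ℂ) * Complex.I_mul_I
  rw [h5]
  module

end Weight

end

section

variable {E : Type*} [NormedAddCommGroup E] [InnerProductSpace ℂ E] [CompleteSpace E]

/-! ### Bounded operators with a bounded commutator -/

theorem exists_mem_domain_of_inner {A : E →ₗ.[ℂ] E} (hA : IsSelfAdjoint A) {y w : E}
    (h : ∀ φ : A.domain, inner ℂ w (φ : E) = inner ℂ y (A φ)) :
    ∃ hy : y ∈ A.domain, A ⟨y, hy⟩ = w := by
  have hmem : y ∈ A.adjoint.domain := LinearPMap.mem_adjoint_domain_of_exists y ⟨w, h⟩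
  have hval := LinearPMap.adjoint_apply_eq hA.dense_domain ⟨y, hmem⟩ h
  have hg : (y, w) ∈ A.adjoint.graph := (LinearPMap.mem_graph_iff _).2 ⟨⟨y, hmem⟩, rfl, hval⟩
  rw [LinearPMap.isSelfAdjoint_def.1 hA] at hg
  obtain ⟨ψ, h1, h2⟩ := (LinearPMap.mem_graph_iff A).1 hg
  simp only at h1 h2
  subst h1
  exact ⟨ψ.2, h2⟩

/-- `S'` is the commutator `[A, S]`: the bounded operator `S` preserves the domain of `A`, and
`A S - S A` is the restriction of `S'` to this domain. -/
def HasComm (A : E →ₗ.[ℂ] E) (S S' : E →L[ℂ] E) : Prop :=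
  ∀ ψ : A.domain, ∃ h : S ψ ∈ A.domain, A ⟨S ψ, h⟩ = S (A ψ) + S' ψ

theorem hasComm_of_inner {A : E →ₗ.[ℂ] E} (hA : IsSelfAdjoint A) {S S' : E →L[ℂ] E}
    (h : ∀ φ ψ : A.domain, inner ℂ (A φ) (S ψ) - inner ℂ (φ : E) (S (A ψ)) =
      inner ℂ (φ : E) (S' ψ)) : HasComm A S S' := fun ψ => by
  refine exists_mem_domain_of_inner hA fun φ => ?_
  rw [← inner_conj_symm, ← inner_conj_symm (S ψ), inner_add_right, ← h φ ψ, add_sub_cancel]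

theorem HasComm.inner_sub {A : E →ₗ.[ℂ] E} (hA : IsSelfAdjoint A) {S S' : E →L[ℂ] E}
    (h : HasComm A S S') (φ ψ : A.domain) :
    inner ℂ (A φ) (S ψ) - inner ℂ (φ : E) (S (A ψ)) = inner ℂ (φ : E) (S' ψ) := by
  obtain ⟨h1, h2⟩ := h ψ
  rw [symm_of_isSelfAdjoint hA φ ⟨_, h1⟩, h2, inner_add_right, add_sub_cancel_left]

/-- A bounded operator whose commutator with `A` is bounded as a quadratic form has a commutator
which is a bounded operator. -/
theorem exists_hasComm_of_bound {A : E →ₗ.[ℂ] E} (hA : IsSelfAdjoint A) {S : E →L[ℂ] E} {b : ℝ}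
    (hb : 0 ≤ b) (h : ∀ φ ψ : A.domain, ‖inner ℂ (A φ) (S ψ) - inner ℂ (φ : E) (S (A ψ))‖ ≤
      b * ‖(φ : E)‖ * ‖(ψ : E)‖) : ∃ S' : E →L[ℂ] E, ‖S'‖ ≤ b ∧ HasComm A S S' := by
  have hd : Dense (A.domain : Set E) := hA.dense_domain
  have hmem : ∀ ψ : A.domain, S ψ ∈ A.domain := fun ψ => by
    have h1 : S ψ ∈ A.adjoint.domain := by
      rw [LinearPMap.mem_adjoint_domain_iff]
      refine AddMonoidHomClass.continuous_of_bound _ (b * ‖(ψ : E)‖ + ‖S (A ψ)‖) fun φ => ?_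
      have h2 : inner ℂ (S ψ) (A φ) =
          (starRingEnd ℂ) (inner ℂ (A φ) (S ψ) - inner ℂ (φ : E) (S (A ψ))) +
            inner ℂ (S (A ψ)) (φ : E) := by
        rw [map_sub, inner_conj_symm, inner_conj_symm, sub_add_cancel]
      change ‖inner ℂ (S ψ) (A φ)‖ ≤ _
      rw [h2]
      refine (norm_add_le _ _).trans ?_
      rw [RCLike.norm_conj, add_mul]
      refine add_le_add ((h φ ψ).trans_eq ?_) (norm_inner_le_norm _ _)
      rw [Submodule.coe_norm]
      ring
    rwa [LinearPMap.isSelfAdjoint_def.1 hA] at h1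
  let L : A.domain →ₗ[ℂ] E :=
    { toFun := fun ψ => A ⟨S ψ, hmem ψ⟩ - S (A ψ)
      map_add' := fun x y => by
        have : (⟨S ((x + y : A.domain) : E), hmem _⟩ : A.domain) =
          ⟨S x, hmem x⟩ + ⟨S y, hmem y⟩ := by ext; simp
        rw [this, LinearPMap.map_add, LinearPMap.map_add, map_add]
        abel
      map_smul' := fun c x => by
        have : (⟨S ((c • x : A.domain) : E), hmem _⟩ : A.domain) = c • ⟨S x, hmem x⟩ := by
          ext; simp
        rw [this, LinearPMap.map_smul, LinearPMap.map_smul, map_smul, RingHom.id_apply, smul_sub] }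
  have hL : ∀ ψ, L ψ = A ⟨S ψ, hmem ψ⟩ - S (A ψ) := fun _ => rfl
  have hLb : ∀ ψ, ‖L ψ‖ ≤ b * ‖A.domain.subtype ψ‖ := fun ψ => by
    have h1 : ∀ x : E, ‖inner ℂ x (L ψ)‖ ≤ b * ‖(ψ : E)‖ * ‖x‖ := by
      refine fun x => hd.induction (P := fun x => ‖inner ℂ x (L ψ)‖ ≤ b * ‖(ψ : E)‖ * ‖x‖) ?_ ?_ x
      · intro φ hφ
        have h2 := h ⟨φ, hφ⟩ ψ
        rw [symm_of_isSelfAdjoint hA ⟨φ, hφ⟩ ⟨S ψ, hmem ψ⟩, ← inner_sub_right, ← hL] at h2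
        refine h2.trans_eq ?_
        simp only
        ring
      · exact isClosed_le (by fun_prop) (by fun_prop)
    have h2 := h1 (L ψ)
    rw [inner_self_eq_norm_sq_to_K] at h2
    simp only [Complex.coe_algebraMap, norm_pow, Complex.norm_real, norm_norm] at h2
    rcases (norm_nonneg (L ψ)).eq_or_lt with h3 | h3
    · rw [← h3]; positivity
    · rw [pow_two] at h2
      exact le_of_mul_le_mul_right h2 h3
  have hdr : DenseRange A.domain.subtype := by
    rw [DenseRange]
    simpa using hd
  refine ⟨L.extendOfNorm A.domain.subtype,
    LinearMap.opNorm_extendOfNorm_le hdr hb hLb, fun ψ => ⟨hmem ψ, ?_⟩⟩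
  have h1 := LinearMap.extendOfNorm_eq hdr ⟨b, hLb⟩ ψ
  rw [Submodule.subtype_apply] at h1
  rw [h1, hL]
  abel

omit [CompleteSpace E] in
theorem HasComm.one (A : E →ₗ.[ℂ] E) : HasComm A 1 0 := fun ψ => ⟨ψ.2, by simp⟩

omit [CompleteSpace E] in
theorem HasComm.add {A : E →ₗ.[ℂ] E} {S S' T T' : E →L[ℂ] E} (hS : HasComm A S S')
    (hT : HasComm A T T') : HasComm A (S + T) (S' + T') := fun ψ => by
  obtain ⟨h1, h2⟩ := hS ψ
  obtain ⟨h3, h4⟩ := hT ψ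
  refine ⟨A.domain.add_mem h1 h3, ?_⟩
  have := LinearPMap.map_add A ⟨_, h1⟩ ⟨_, h3⟩
  rw [h2, h4] at this
  refine this.trans ?_
  simp only [add_apply]
  abel

omit [CompleteSpace E] in
theorem HasComm.smul {A : E →ₗ.[ℂ] E} {S S' : E →L[ℂ] E} (c : ℂ) (hS : HasComm A S S') :
    HasComm A (c • S) (c • S') := fun ψ => by
  obtain ⟨h1, h2⟩ := hS ψ
  refine ⟨A.domain.smul_mem c h1, ?_⟩
  have := LinearPMap.map_smul A c ⟨_, h1⟩
  rw [h2] at this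
  refine this.trans ?_
  simp

omit [CompleteSpace E] in
theorem HasComm.mul {A : E →ₗ.[ℂ] E} {S S' T T' : E →L[ℂ] E} (hS : HasComm A S S')
    (hT : HasComm A T T') : HasComm A (S * T) (S * T' + S' * T) := fun ψ => by
  obtain ⟨h1, h2⟩ := hT ψ
  obtain ⟨h3, h4⟩ := hS ⟨_, h1⟩
  refine ⟨h3, h4.trans ?_⟩
  rw [h2]
  simp [add_assoc]

/-! ### The regularisation `(1 - iτA)⁻¹` -/

/-- The operator `(1 - iτA)⁻¹`, for `τ > 0`. -/
def smoothing (A : E →ₗ.[ℂ] E) (τ : ℝ) : E →L[ℂ] E :=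
  (Complex.I / τ) • resolvent A (-(Complex.I / τ))

/-- The bounded operator `A (1 - iτA)⁻¹`, for `τ > 0`. -/
def smoothed (A : E →ₗ.[ℂ] E) (τ : ℝ) : E →L[ℂ] E :=
  (Complex.I / τ) • (1 - smoothing A τ)

section Smoothing

variable {A : E →ₗ.[ℂ] E} (hA : IsSelfAdjoint A) {τ : ℝ} (hτ : 0 < τ)

include hA hτ

omit [CompleteSpace E] hA hτ in
theorem im_neg_I_div (τ : ℝ) : (-(Complex.I / τ)).im = -τ⁻¹ := by
  rw [Complex.neg_im, Complex.div_ofReal_im, Complex.I_im, one_div]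

theorem neg_I_div_mem_resolventSet : -(Complex.I / τ) ∈ resolventSet A :=
  mem_resolventSet_of_im_ne_zero hA
    (by rw [im_neg_I_div τ]; exact neg_ne_zero.2 (inv_ne_zero hτ.ne'))

theorem smoothing_mem_domain (x : E) : smoothing A τ x ∈ A.domain :=
  A.domain.smul_mem _ (resolvent_mem_domain (neg_I_div_mem_resolventSet hA hτ) x)

theorem apply_smoothing (x : E) :
    A ⟨smoothing A τ x, smoothing_mem_domain hA hτ x⟩ = smoothed A τ x := by
  have h1 := apply_resolvent (neg_I_div_mem_resolventSet hA hτ) x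
  have h2 := LinearPMap.map_smul A (Complex.I / τ)
    ⟨_, resolvent_mem_domain (neg_I_div_mem_resolventSet hA hτ) x⟩
  refine h2.trans ?_
  rw [h1, smoothed, smoothing]
  simp only [smul_apply, sub_apply, one_apply_eq_self]
  module

theorem smoothing_sub_apply (φ : A.domain) :
    smoothing A τ ((φ : E) - (Complex.I * τ) • A φ) = φ := by
  have h1 := (resolvent_spec (neg_I_div_mem_resolventSet hA hτ)).left_inv φ
  have hτ' : (τ : ℂ) ≠ 0 := by exact_mod_cast hτ.ne'
  have h2 : (φ : E) - (Complex.I * τ) • A φ =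
      (-(Complex.I * τ)) • (A φ - (-(Complex.I / τ)) • (φ : E)) := by
    rw [smul_sub, smul_smul]
    have : -(Complex.I * (τ : ℂ)) * -(Complex.I / τ) = -1 := by
      field_simp
      exact Complex.I_sq
    rw [this]
    module
  rw [h2, map_smul, smoothing, smul_apply, h1, smul_smul]
  have : -(Complex.I * (τ : ℂ)) * (Complex.I / τ) = 1 := by
    field_simp
    simp
  rw [this, one_smul]

omit [CompleteSpace E] hA in
theorem sub_smoothed (x : E) :
    smoothing A τ x - (Complex.I * τ) • smoothed A τ x = x := by
  have hτ' : (τ : ℂ) ≠ 0 := by exact_mod_cast hτ.ne'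
  rw [smoothed, smul_apply, smul_smul]
  have : (Complex.I * (τ : ℂ)) * (Complex.I / τ) = -1 := by
    field_simp
    simp
  rw [this, sub_apply, one_apply_eq_self]
  module

theorem smoothing_apply (φ : A.domain) : smoothing A τ (A φ) = smoothed A τ φ := by
  have h1 := smoothing_sub_apply hA hτ φ
  have h2 := sub_smoothed (A := A) hτ (φ : E)
  have hτ' : Complex.I * (τ : ℂ) ≠ 0 := mul_ne_zero Complex.I_ne_zero (by exact_mod_cast hτ.ne')
  rw [map_sub, map_smul] at h1
  refine smul_right_injective E hτ' ?_
  exact sub_right_injective (h1.trans h2.symm)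

theorem norm_smoothing_apply_le (x : E) : ‖smoothing A τ x‖ ≤ ‖x‖ := by
  have h := norm_resolvent_apply_le hA (neg_I_div_mem_resolventSet hA hτ) x
  rw [im_neg_I_div τ, abs_neg, abs_of_pos (inv_pos.2 hτ)] at h
  rw [smoothing, smul_apply, norm_smul]
  simpa [abs_of_pos hτ] using h

theorem norm_smoothing_apply_sub_le (φ : A.domain) :
    ‖smoothing A τ φ - φ‖ ≤ τ * ‖A φ‖ := by
  have h := sub_smoothed (A := A) hτ (φ : E)
  rw [sub_eq_iff_eq_add] at h
  nth_rw 1 [h]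
  rw [add_sub_cancel_left, ← smoothing_apply hA hτ, norm_smul, norm_mul, Complex.norm_I, one_mul,
    Complex.norm_real, Real.norm_of_nonneg hτ.le]
  exact mul_le_mul_of_nonneg_left (norm_smoothing_apply_le hA hτ _) hτ.le

theorem smoothing_sub_smoothing {σ : ℝ} (hσ : 0 < σ) :
    smoothing A σ - smoothing A τ =
      (Complex.I * ((σ - τ : ℝ) : ℂ)) • (smoothed A τ * smoothing A σ) := by
  ext x
  have h1 := smoothing_sub_apply hA hτ ⟨_, smoothing_mem_domain hA hσ x⟩
  have h2 := sub_smoothed (A := A) hσ x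
  have h3 := smoothing_apply hA hτ ⟨_, smoothing_mem_domain hA hσ x⟩
  rw [apply_smoothing hA hσ] at h1 h3
  simp only at h1 h3
  have h4 : smoothing A σ x - (Complex.I * τ) • smoothed A σ x =
      x + (Complex.I * ((σ - τ : ℝ) : ℂ)) • smoothed A σ x := by
    rw [sub_eq_iff_eq_add] at h2
    nth_rw 1 [h2]
    push_cast
    module
  rw [h4, map_add, map_smul, h3] at h1
  exact sub_eq_of_eq_add' h1.symm

omit hτ in
theorem tendsto_smoothing_apply (x : E) :
    Tendsto (fun τ => smoothing A τ x) (𝓝[>] 0) (𝓝 x) := by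
  rw [Metric.tendsto_nhds]
  intro ε hε
  obtain ⟨φ, hφ, hxφ⟩ := Metric.mem_closure_iff.1
    (hA.dense_domain x : x ∈ closure (A.domain : Set E)) (ε / 3) (by positivity)
  have hlt : ∀ᶠ τ : ℝ in 𝓝[>] 0, τ * ‖A ⟨φ, hφ⟩‖ < ε / 3 := by
    have h1 : Tendsto (fun τ : ℝ => τ * ‖A ⟨φ, hφ⟩‖) (𝓝[>] 0) (𝓝 0) := by
      refine Tendsto.mono_left ?_ nhdsWithin_le_nhds
      exact (continuous_id.mul continuous_const).tendsto' _ _ (by simp)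
    exact h1.eventually_lt_const (by positivity)
  filter_upwards [hlt, self_mem_nhdsWithin] with τ h1 hτ
  have h2 := norm_smoothing_apply_sub_le hA hτ ⟨φ, hφ⟩
  have h3 := norm_smoothing_apply_le hA hτ (x - φ)
  rw [dist_eq_norm] at hxφ ⊢
  have h4 : smoothing A τ x - x =
      smoothing A τ (x - φ) + (smoothing A τ φ - φ) - (x - φ) := by
    rw [map_sub]; abel
  rw [h4]
  have h5 := norm_sub_le (smoothing A τ (x - φ) + (smoothing A τ φ - φ)) (x - φ)
  have h6 := norm_add_le (smoothing A τ (x - φ)) (smoothing A τ φ - φ)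
  simp only at h2
  linarith

omit hτ in
theorem tendsto_smoothing_apply_of_tendsto {y : ℝ → E} {x : E}
    (hy : Tendsto y (𝓝[>] 0) (𝓝 x)) :
    Tendsto (fun τ => smoothing A τ (y τ)) (𝓝[>] 0) (𝓝 x) := by
  have h1 : Tendsto (fun τ => smoothing A τ (y τ - x)) (𝓝[>] 0) (𝓝 0) := by
    refine squeeze_zero_norm' ?_ ((hy.sub_const x).norm.trans_eq (by simp))
    filter_upwards [self_mem_nhdsWithin] with τ hτ
    exact norm_smoothing_apply_le hA hτ _
  simpa using h1.add (tendsto_smoothing_apply hA x)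

omit hτ in
/-- The commutator of an inverse. It is computed for the regularisation `A(1 - iτA)⁻¹` of `A`, and
`τ` is sent to `0`. -/
theorem HasComm.inv {S T T' : E →L[ℂ] E} (hT : HasComm A T T') (hTS : T * S = 1)
    (hST : S * T = 1) : HasComm A S (-(S * T' * S)) := fun ψ => by
  have key : ∀ τ : ℝ, 0 < τ → ∀ x, smoothed A τ (S x) =
      S (smoothed A τ x) - S (smoothing A τ (T' (smoothing A τ (S x)))) := fun τ hτ x => by
    obtain ⟨h1, h2⟩ := hT ⟨_, smoothing_mem_domain hA hτ (S x)⟩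
    have h3 := smoothing_sub_apply hA hτ ⟨_, h1⟩
    rw [h2, apply_smoothing hA hτ] at h3
    have h4 : T (smoothing A τ (S x)) -
        (Complex.I * τ) • (T (smoothed A τ (S x)) + T' (smoothing A τ (S x))) =
        x - (Complex.I * τ) • T' (smoothing A τ (S x)) := by
      have h5 := congrArg T (sub_smoothed (A := A) hτ (S x))
      rw [map_sub, map_smul, ← mul_apply_eq_comp T S, hTS, one_apply_eq_self] at h5
      rw [smul_add, ← sub_sub, h5]
    simp only at h3
    rw [h4, map_sub, map_smul] at h3
    have h5 := congrArg S h3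
    rw [← mul_apply_eq_comp S T, hST, one_apply_eq_self, map_sub, map_smul] at h5
    have hτ' : (τ : ℂ) ≠ 0 := by exact_mod_cast hτ.ne'
    have h6 : (Complex.I / τ : ℂ) * (Complex.I * τ) = -1 := by
      field_simp
      simp
    rw [smoothed, smul_apply, sub_apply, one_apply_eq_self, smul_apply, sub_apply,
      one_apply_eq_self, map_smul, map_sub]
    generalize S (smoothing A τ (T' (smoothing A τ (S x)))) = X at h5 ⊢
    rw [← h5]
    have h7 : (Complex.I / τ : ℂ) • (Complex.I * τ : ℂ) • X = -X := by
      rw [smul_smul, h6, neg_one_smul]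
    simp only [smul_sub, h7]
    abel
  refine exists_mem_domain_of_inner hA fun φ => ?_
  have h1 : Tendsto (fun τ => inner ℂ (smoothed A τ (S ψ)) (φ : E)) (𝓝[>] 0)
      (𝓝 (inner ℂ (S (A ψ) + (-(S * T' * S)) ψ) (φ : E))) := by
    refine Tendsto.inner ?_ tendsto_const_nhds
    have h2 : Tendsto (fun τ => S (smoothing A τ (A ψ)) -
        S (smoothing A τ (T' (smoothing A τ (S ψ))))) (𝓝[>] 0)
        (𝓝 (S (A ψ) + (-(S * T' * S)) ψ)) := by
      rw [neg_apply, ← sub_eq_add_neg]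
      refine ((S.continuous.tendsto _).comp (tendsto_smoothing_apply hA _)).sub
        ((S.continuous.tendsto _).comp (tendsto_smoothing_apply_of_tendsto hA ?_))
      exact (T'.continuous.tendsto _).comp (tendsto_smoothing_apply hA _)
    refine h2.congr' ?_
    filter_upwards [self_mem_nhdsWithin] with τ hτ
    rw [key τ hτ, smoothing_apply hA hτ]
  have h2 : Tendsto (fun τ => inner ℂ (smoothing A τ (S ψ)) (A φ)) (𝓝[>] 0)
      (𝓝 (inner ℂ (S ψ) (A φ))) :=
    (tendsto_smoothing_apply hA _).inner tendsto_const_nhds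
  refine tendsto_nhds_unique (h1.congr' ?_) h2
  filter_upwards [self_mem_nhdsWithin] with τ hτ
  rw [← apply_smoothing hA hτ, symm_of_isSelfAdjoint hA]

theorem norm_smoothing_le : ‖smoothing A τ‖ ≤ 1 :=
  ContinuousLinearMap.opNorm_le_bound _ zero_le_one fun x => by
    simpa using norm_smoothing_apply_le hA hτ x

theorem hasDerivAt_smoothing :
    HasDerivAt (smoothing A) (Complex.I • (smoothed A τ * smoothing A τ)) τ := by
  have hcont : Tendsto (smoothing A) (𝓝 τ) (𝓝 (smoothing A τ)) := by
    rw [tendsto_iff_norm_sub_tendsto_zero]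
    have h1 : Tendsto (fun σ : ℝ => |σ - τ| * ‖smoothed A τ‖) (𝓝 τ) (𝓝 0) :=
      Continuous.tendsto' (by fun_prop) _ _ (by simp)
    refine squeeze_zero_norm' ?_ h1
    filter_upwards [lt_mem_nhds hτ] with σ hσ
    rw [norm_norm, smoothing_sub_smoothing hA hτ hσ, norm_smul, norm_mul, Complex.norm_I, one_mul,
      Complex.norm_real, Real.norm_eq_abs]
    refine mul_le_mul_of_nonneg_left ?_ (abs_nonneg _)
    refine (norm_mul_le _ _).trans ?_
    exact mul_le_of_le_one_right (norm_nonneg _) (norm_smoothing_le hA hσ)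
  rw [hasDerivAt_iff_tendsto_slope]
  have h1 : Tendsto (fun σ => Complex.I • (smoothed A τ * smoothing A σ)) (𝓝[≠] τ)
      (𝓝 (Complex.I • (smoothed A τ * smoothing A τ))) :=
    ((hcont.mono_left nhdsWithin_le_nhds).const_mul _).const_smul _
  refine h1.congr' ?_
  filter_upwards [self_mem_nhdsWithin, nhdsWithin_le_nhds (lt_mem_nhds hτ)] with σ hne hσ
  have hne' : ((σ - τ : ℝ) : ℂ) ≠ 0 := by
    exact_mod_cast sub_ne_zero.2 hne
  rw [slope_def_module, smoothing_sub_smoothing hA hτ hσ, ← Complex.coe_smul, smul_smul]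
  congr 1
  rw [Complex.ofReal_inv]
  field_simp

/-! ### Weights -/

section Weights

variable {s : ℝ} (hs : 0 < s) (hs' : s ≤ 1)

omit hA hτ in
theorem star_bracketNegPow (A : E →ₗ.[ℂ] E) (s : ℝ) :
    star (bracketNegPow A s) = bracketNegPow A s :=
  star_functionOf_ofReal _ _

theorem commute_bracketNegPow_smoothing : Commute (bracketNegPow A s) (smoothing A τ) :=
  (commute_functionOf_resolvent hA _ (neg_I_div_mem_resolventSet hA hτ)).smul_right _

theorem commute_bracketNegPow_smoothed : Commute (bracketNegPow A s) (smoothed A τ) :=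
  ((Commute.one_right _).sub_right (commute_bracketNegPow_smoothing hA hτ)).smul_right _

include hs

omit hτ in
theorem norm_bracketNegPow_le : ‖bracketNegPow A s‖ ≤ 1 :=
  ContinuousLinearMap.opNorm_le_bound _ zero_le_one fun x => by
    simpa using norm_bracketNegPow_apply_le hA hs x

include hs'

/-- The interpolation bound `‖A(1 - iτA)⁻¹⟨A⟩⁻ˢ‖ ≤ τˢ⁻¹`. -/
theorem norm_smoothed_mul_bracketNegPow_le :
    ‖smoothed A τ * bracketNegPow A s‖ ≤ τ ^ (s - 1) := by
  refine ContinuousLinearMap.opNorm_le_bound _ (by positivity) fun x => ?_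
  rw [← (commute_bracketNegPow_smoothed hA hτ).eq, mul_apply_eq_comp]
  have h1 := (resolvent_spec (neg_I_mem_resolventSet hA)).left_inv ⟨_, smoothing_mem_domain hA hτ x⟩
  have h2 := norm_bracketNegPow_sub_le hA hs hs' hτ
    (A ⟨_, smoothing_mem_domain hA hτ x⟩ - (-Complex.I) • smoothing A τ x)
  rw [h1, apply_smoothing hA hτ] at h2
  have h3 : smoothed A τ x - -Complex.I • smoothing A τ x - Complex.I • smoothing A τ x =
      smoothed A τ x := by module
  simp only at h2
  rwa [h3, sub_smoothed hτ] at h2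

end Weights

end Smoothing

end

section

variable {E : Type*} [NormedAddCommGroup E] [InnerProductSpace ℂ E]

/-! ### The commutator of the two unbounded operators -/

/-- The operator `[H, A]⁰ (H + i)⁻¹` is bounded, with norm `commN K`. -/
theorem exists_comm_mul_resolvent {H : E →ₗ.[ℂ] E} (hi : -Complex.I ∈ resolventSet H)
    {K : H.domain →ₗ[ℂ] E} (hK : ∃ M : ℝ, ∀ φ : H.domain, ‖K φ‖ ≤ M * (‖(φ : E)‖ + ‖H φ‖)) :
    ∃ K₀ : E →L[ℂ] E, (∀ φ : H.domain, K φ = K₀ (H φ + Complex.I • (φ : E))) ∧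
      ‖K₀‖ ≤ commN K := by
  obtain ⟨M, hM⟩ := hK
  set R := resolvent H (-Complex.I)
  have hR := resolvent_spec hi
  let L : E →ₗ[ℂ] E := K ∘ₗ (R.toLinearMap.codRestrict H.domain hR.mem_domain)
  have hL : ∀ x, L x = K ⟨R x, hR.mem_domain x⟩ := fun _ => rfl
  have hLb : ∀ x, ‖L x‖ ≤ (|M| * (2 * ‖R‖ + 1)) * ‖x‖ := fun x => by
    rw [hL]
    refine (hM _).trans ?_
    rw [apply_resolvent hi]
    have h1 := R.le_opNorm x
    have h2 := norm_add_le x (-Complex.I • R x)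
    rw [norm_smul, norm_neg, Complex.norm_I, one_mul] at h2
    calc M * (‖R x‖ + ‖x + -Complex.I • R x‖) ≤ |M| * (‖R x‖ + (‖x‖ + ‖R x‖)) := by
          gcongr
          exact le_abs_self M
      _ ≤ |M| * (‖R‖ * ‖x‖ + (‖x‖ + ‖R‖ * ‖x‖)) := by gcongr
      _ = _ := by ring
  have hcd : ∀ x, compDom K R x = L x := fun x => by
    rw [compDom, dif_pos (hR.mem_domain x), hL]
  refine ⟨L.mkContinuous _ hLb, fun φ => ?_, ?_⟩
  · have h1 := hR.left_inv φ
    rw [neg_smul, sub_neg_eq_add] at h1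
    rw [LinearMap.mkContinuous_apply, hL]
    congr 1
    exact Subtype.ext h1.symm
  · refine le_csInf ⟨_, by positivity, fun x => (hcd x).symm ▸ hLb x⟩ fun b hb => ?_
    refine ContinuousLinearMap.opNorm_le_bound _ hb.1 fun x => ?_
    rw [LinearMap.mkContinuous_apply, ← hcd]
    exact hb.2 x

/-- The joint graph of `A` and `H` on the subspace `D`. -/
def jointGraph (H A : E →ₗ.[ℂ] E) (D : Submodule ℂ E) : Set (E × E × E) :=
  {p | ∃ φ ∈ D, ∃ (hA : φ ∈ A.domain) (hH : φ ∈ H.domain), p = (φ, A ⟨φ, hA⟩, H ⟨φ, hH⟩)}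

theorem forall_mem_closure_of_isClosed {X : Type*} [TopologicalSpace X] {s : Set X}
    {P : X → X → Prop} (hP : IsClosed {p : X × X | P p.1 p.2}) (h : ∀ x ∈ s, ∀ y ∈ s, P x y) :
    ∀ x ∈ closure s, ∀ y ∈ closure s, P x y := fun x hx y hy => by
  have h1 : (s ×ˢ s) ⊆ {p : X × X | P p.1 p.2} := fun p hp => h _ hp.1 _ hp.2
  have h2 := closure_minimal h1 hP
  rw [closure_prod_eq] at h2
  exact h2 (Set.mk_mem_prod hx hy)

section Commutator

variable [CompleteSpace E] {H A : E →ₗ.[ℂ] E} (hH : IsSelfAdjoint H) (hA : IsSelfAdjoint A)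
  {D : Submodule ℂ E} {ζ : ℕ → E →L[ℂ] E} (ha : DomainConditions H A D ζ)
  {K : H.domain →ₗ[ℂ] E} {c : ℝ} (hb : CommutatorConditions H A D K c)
  {K₀ : E →L[ℂ] E} (hK₀ : ∀ φ : H.domain, K φ = K₀ (H φ + Complex.I • (φ : E)))

omit [CompleteSpace E] in
include hb hK₀ in
/-- The commutator identity is continuous in the graph norms, and therefore extends from `D` to the
closure of the joint graph of `A` and `H` on `D`. -/
theorem inner_comm_of_mem_closure {p q : E × E × E} (hp : p ∈ closure (jointGraph H A D))
    (hq : q ∈ closure (jointGraph H A D)) :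
    inner ℂ p.2.1 q.2.2 - inner ℂ p.2.2 q.2.1 = inner ℂ (K₀ (p.2.2 + Complex.I • p.1)) q.1 := by
  refine forall_mem_closure_of_isClosed (P := fun p q : E × E × E =>
    inner ℂ p.2.1 q.2.2 - inner ℂ p.2.2 q.2.1 = inner ℂ (K₀ (p.2.2 + Complex.I • p.1)) q.1)
    (isClosed_eq (by fun_prop) (by fun_prop)) ?_ p hp q hq
  rintro _ ⟨φ, hφ, h1, h2, rfl⟩ _ ⟨ψ, hψ, h3, h4, rfl⟩
  simp only
  rw [hb.comm φ hφ ψ hψ h2 h1 h4 h3, hK₀]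

omit [CompleteSpace E] in
include hb hK₀ in
theorem inner_comm_antisymm_of_mem_closure {p q : E × E × E}
    (hp : p ∈ closure (jointGraph H A D)) (hq : q ∈ closure (jointGraph H A D)) :
    inner ℂ (K₀ (p.2.2 + Complex.I • p.1)) q.1 =
      -inner ℂ p.1 (K₀ (q.2.2 + Complex.I • q.1)) := by
  have h1 := inner_comm_of_mem_closure hb hK₀ hp hq
  have h2 := congrArg (starRingEnd ℂ) (inner_comm_of_mem_closure hb hK₀ hq hp)
  rw [map_sub, inner_conj_symm, inner_conj_symm, inner_conj_symm] at h2
  rw [← h1, ← h2]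
  ring

omit [CompleteSpace E] in
include hb hK₀ in
theorem norm_double_comm_le_of_mem_closure {p q : E × E × E}
    (hp : p ∈ closure (jointGraph H A D)) (hq : q ∈ closure (jointGraph H A D)) :
    ‖inner ℂ p.2.1 (Complex.I • K₀ (q.2.2 + Complex.I • q.1)) -
      inner ℂ (Complex.I • K₀ (p.2.2 + Complex.I • p.1)) q.2.1‖ ≤
      c * ‖q.1‖ * ‖p.2.2 + Complex.I • p.1‖ := by
  refine forall_mem_closure_of_isClosed (P := fun p q : E × E × E =>
    ‖inner ℂ p.2.1 (Complex.I • K₀ (q.2.2 + Complex.I • q.1)) -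
      inner ℂ (Complex.I • K₀ (p.2.2 + Complex.I • p.1)) q.2.1‖ ≤
      c * ‖q.1‖ * ‖p.2.2 + Complex.I • p.1‖)
    (isClosed_le (by fun_prop) (by fun_prop)) ?_ p hp q hq
  rintro _ ⟨φ, hφ, h1, h2, rfl⟩ _ ⟨ψ, hψ, h3, h4, rfl⟩
  have := hb.double_comm φ hφ ψ hψ h2 h1 h4 h3
  rwa [hK₀, hK₀] at this

include ha

/-- Regularisation by the sequence `ζ` approximates the vectors of `(H - z)⁻¹ D` by vectors of `D`,
in the graph norms of both `A` and `H`. -/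
theorem resolvent_mem_closure_jointGraph {z : ℂ} (hz : z ∈ resolventSet H) {φ : E} (hφ : φ ∈ D) :
    (resolvent H z φ, A ⟨_, ha.resolvent_stable z hz φ (ha.le_domain_A hφ)⟩,
      φ + z • resolvent H z φ) ∈ closure (jointGraph H A D) := by
  have h1 := ha.strong (resolvent H z φ)
  have h2 := ha.strong_A ⟨_, ha.resolvent_stable z hz φ (ha.le_domain_A hφ)⟩
  have h3 := ha.strong_H ⟨_, resolvent_mem_domain hz φ⟩
  rw [apply_resolvent hz] at h3
  refine mem_closure_of_tendsto (h1.prodMk_nhds (h2.prodMk_nhds h3))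
    (Eventually.of_forall fun n => ?_)
  exact ⟨_, ha.regularity n z hz φ hφ, _, _, rfl⟩

include hA in
/-- The core property of `D`, expressed through the graph of `A`. -/
theorem mem_closure_graph_core (φ : A.domain) :
    ((φ : E), A φ) ∈ closure {p : E × E | ∃ ψ, ∃ h : ψ ∈ D, p = (ψ, A ⟨ψ, ha.le_domain_A h⟩)} := by
  have hcl : (A.domRestrict D).IsClosable :=
    LinearPMap.IsClosable.leIsClosable (LinearPMap.IsClosed.isClosable hA.isClosed)
      LinearPMap.domRestrict_le
  have h1 := hcl.graph_closure_eq_closure_graph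
  rw [ha.core_A.closure_eq] at h1
  have h2 : ((φ : E), A φ) ∈ A.graph := A.mem_graph φ
  rw [← h1] at h2
  refine closure_mono ?_ h2
  intro p hp
  obtain ⟨ψ, h3, h4⟩ := (LinearPMap.mem_graph_iff _).1 hp
  have hψ : (ψ : E) ∈ D := by
    have : (ψ : E) ∈ D ⊓ A.domain := ψ.2
    exact this.1
  exact ⟨ψ, hψ, Prod.ext h3.symm (h4.symm.trans (LinearPMap.domRestrict_apply rfl))⟩

include hH hb hK₀

omit hA in
/-- The bounded operator `[H, A]⁰ (H + i)⁻¹` inherits the antisymmetry of `[H, A]⁰`. -/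
theorem inner_comm_antisymm (x y : E) :
    inner ℂ (K₀ x) (resolvent H (-Complex.I) y) =
      -inner ℂ (resolvent H (-Complex.I) x) (K₀ y) := by
  have hi := neg_I_mem_resolventSet hH
  refine forall_mem_closure_of_isClosed (s := (D : Set E)) (P := fun x y : E =>
    inner ℂ (K₀ x) (resolvent H (-Complex.I) y) = -inner ℂ (resolvent H (-Complex.I) x) (K₀ y))
    (isClosed_eq (by fun_prop) (by fun_prop)) ?_ x (ha.dense x) y (ha.dense y)
  intro φ hφ ψ hψ
  have h := inner_comm_antisymm_of_mem_closure hb hK₀ (resolvent_mem_closure_jointGraph ha hi hφ)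
    (resolvent_mem_closure_jointGraph ha hi hψ)
  simpa using h

include hA

/-- The commutator `[A, (H - w)⁻¹] = (H - w)⁻¹ [H, A]⁰ (H - w)⁻¹`. -/
theorem hasComm_resolvent {w : ℂ} (hw : w.im ≠ 0) :
    HasComm A (resolvent H w)
      (resolvent H w * (K₀ * (1 + (w + Complex.I) • resolvent H w))) := by
  have hw' : (starRingEnd ℂ w).im ≠ 0 := by simpa using hw
  have h1 := mem_resolventSet_of_im_ne_zero hH hw
  have h2 := mem_resolventSet_of_im_ne_zero hH hw'
  have hadj : ∀ x y, inner ℂ (resolvent H (starRingEnd ℂ w) x) y =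
      inner ℂ x (resolvent H w y) := fun x y => by
    rw [← star_resolvent hH hw, ContinuousLinearMap.star_eq_adjoint,
      ContinuousLinearMap.adjoint_inner_left]
  set R' := resolvent H w * (K₀ * (1 + (w + Complex.I) • resolvent H w)) with hR'
  refine hasComm_of_inner hA fun φ ψ => ?_
  refine forall_mem_closure_of_isClosed (P := fun p q : E × E =>
    inner ℂ p.2 (resolvent H w q.1) - inner ℂ p.1 (resolvent H w q.2) = inner ℂ p.1 (R' q.1))
    (isClosed_eq (by fun_prop) (by fun_prop)) ?_ _ (mem_closure_graph_core hA ha φ) _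
    (mem_closure_graph_core hA ha ψ)
  rintro _ ⟨φ, hφ, rfl⟩ _ ⟨ψ, hψ, rfl⟩
  simp only
  have hp := resolvent_mem_closure_jointGraph ha h2 hφ
  have hq := resolvent_mem_closure_jointGraph ha h1 hψ
  have h3 := inner_comm_of_mem_closure hb hK₀ hp hq
  rw [inner_comm_antisymm_of_mem_closure hb hK₀ hp hq] at h3
  simp only [inner_add_left, inner_add_right, inner_smul_left, inner_smul_right,
    Complex.conj_conj] at h3
  have h4 := symm_of_isSelfAdjoint hA
    ⟨_, ha.resolvent_stable _ h2 φ (ha.le_domain_A hφ)⟩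
    ⟨_, ha.resolvent_stable _ h1 ψ (ha.le_domain_A hψ)⟩
  have h5 := symm_of_isSelfAdjoint hA
    ⟨_, ha.resolvent_stable _ h2 φ (ha.le_domain_A hφ)⟩ ⟨ψ, ha.le_domain_A hψ⟩
  have h6 := symm_of_isSelfAdjoint hA ⟨φ, ha.le_domain_A hφ⟩
    ⟨_, ha.resolvent_stable _ h1 ψ (ha.le_domain_A hψ)⟩
  rw [hadj] at h5
  have h7 : inner ℂ φ (R' ψ) = inner ℂ (resolvent H (starRingEnd ℂ w) φ)
      (K₀ (ψ + w • resolvent H w ψ + Complex.I • resolvent H w ψ)) := by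
    rw [hadj, hR']
    simp [add_smul, add_assoc]
  rw [h7, h6, ← h5]
  simp only at h4
  linear_combination (-1 : ℂ) * h3 + w * h4

/-- Since `D` is a core for `A` and the commutator of `A` with the resolvent is bounded, the
condition `φ ∈ D` of `resolvent_mem_closure_jointGraph` can be relaxed to `φ ∈ D(A)`. -/
theorem resolvent_mem_closure_jointGraph_of_mem_domain {w : ℂ} (hw : w.im ≠ 0) (φ : A.domain) :
    (resolvent H w φ, resolvent H w (A φ) +
      (resolvent H w * (K₀ * (1 + (w + Complex.I) • resolvent H w))) φ,
      φ + w • resolvent H w φ) ∈ closure (jointGraph H A D) := by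
  have hz := mem_resolventSet_of_im_ne_zero hH hw
  set R' := resolvent H w * (K₀ * (1 + (w + Complex.I) • resolvent H w)) with hR'
  have h1 := map_mem_closure (f := fun p : E × E =>
    (resolvent H w p.1, resolvent H w p.2 + R' p.1, p.1 + w • resolvent H w p.1))
    (t := closure (jointGraph H A D)) (by fun_prop) (mem_closure_graph_core hA ha φ) ?_
  · rwa [closure_closure] at h1
  rintro _ ⟨φ, hφ, rfl⟩
  obtain ⟨h2, h3⟩ := hasComm_resolvent hH hA ha hb hK₀ hw ⟨φ, ha.le_domain_A hφ⟩
  simp only at h2 h3 ⊢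
  rw [← h3]
  exact resolvent_mem_closure_jointGraph ha hz hφ

/-- The regularised commutator `δ² (H - w̄)⁻¹ i[H, A]⁰ (H - w)⁻¹` has a bounded commutator with
`A`. -/
theorem exists_hasComm_regularised {w : ℂ} (hw : w.im ≠ 0) {δ k ℓ : ℝ} (hδ : 0 < δ)
    (hR : δ * ‖resolvent H w‖ ≤ 1)
    (hU : δ * ‖1 + (w + Complex.I) • resolvent H w‖ ≤ ℓ)
    (hk : δ * ‖K₀ * (1 + (w + Complex.I) • resolvent H w)‖ ≤ k) :
    ∃ B' : E →L[ℂ] E, ‖B'‖ ≤ c * ℓ + 2 * k ^ 2 / δ ∧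
      HasComm A (((δ ^ 2 : ℝ) : ℂ) • (star (resolvent H w) *
        (Complex.I • (K₀ * (1 + (w + Complex.I) • resolvent H w))))) B' := by
  set R := resolvent H w with hRdef
  set U := 1 + (w + Complex.I) • R with hUdef
  have hc := hb.pos
  have hk0 : 0 ≤ k := le_trans (by positivity) hk
  have hℓ0 : 0 ≤ ℓ := le_trans (by positivity) hU
  have hRU : R = resolvent H (-Complex.I) * U := by
    have h1 := resolvent_sub_resolvent (mem_resolventSet_of_im_ne_zero hH hw)
      (neg_I_mem_resolventSet hH)
    rw [sub_neg_eq_add, sub_eq_iff_eq_add] at h1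
    rw [hUdef, mul_add, mul_one, mul_smul_comm, add_comm]
    exact h1
  have hsymm : ∀ x y, inner ℂ (R x) (Complex.I • (K₀ * U) y) =
      inner ℂ (Complex.I • (K₀ * U) x) (R y) := fun x y => by
    rw [hRU, inner_smul_left, inner_smul_right, Complex.conj_I]
    simp only [mul_apply_eq_comp]
    rw [inner_comm_antisymm hH ha hb hK₀]
    ring
  refine exists_hasComm_of_bound hA (by positivity) fun φ ψ => ?_
  -- apart from the double commutator of `H` with `A`, the commutator contains two terms in
  -- which `A` is commuted with a resolvent
  have key := norm_double_comm_le_of_mem_closure hb hK₀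
    (resolvent_mem_closure_jointGraph_of_mem_domain hH hA ha hb hK₀ hw φ)
    (resolvent_mem_closure_jointGraph_of_mem_domain hH hA ha hb hK₀ hw ψ)
  have hUx : ∀ x : E, x + w • R x + Complex.I • R x = U x := fun x => by
    simp [hUdef, add_smul, add_assoc]
  simp only [← hRdef, ← hUdef, hUx] at key
  set X := inner ℂ (R (A φ) + (R * (K₀ * U)) φ) (Complex.I • K₀ (U ψ)) -
    inner ℂ (Complex.I • K₀ (U φ)) (R (A ψ) + (R * (K₀ * U)) ψ) with hX
  have hBe : ∀ x y, inner ℂ x ((((δ ^ 2 : ℝ) : ℂ) • (star R * (Complex.I • (K₀ * U)))) y) =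
      ((δ ^ 2 : ℝ) : ℂ) * inner ℂ (R x) (Complex.I • (K₀ * U) y) := fun x y => by
    rw [smul_apply, inner_smul_right, mul_apply_eq_comp, ContinuousLinearMap.star_eq_adjoint,
      ContinuousLinearMap.adjoint_inner_right, smul_apply]
  have hform : inner ℂ (A φ) ((((δ ^ 2 : ℝ) : ℂ) • (star R * (Complex.I • (K₀ * U)))) ψ) -
      inner ℂ (φ : E) ((((δ ^ 2 : ℝ) : ℂ) • (star R * (Complex.I • (K₀ * U)))) (A ψ)) =
      ((δ ^ 2 : ℝ) : ℂ) * (X - inner ℂ (R ((K₀ * U) φ)) (Complex.I • (K₀ * U) ψ) +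
        inner ℂ (Complex.I • (K₀ * U) φ) (R ((K₀ * U) ψ))) := by
    rw [hBe, hBe, hsymm φ, hX, inner_add_left, inner_add_right]
    simp only [mul_apply_eq_comp]
    ring
  rw [hform, norm_mul, Complex.norm_real, Real.norm_of_nonneg (by positivity)]
  have hY : ∀ x : E, δ * ‖(K₀ * U) x‖ ≤ k * ‖x‖ := fun x =>
    calc δ * ‖(K₀ * U) x‖ ≤ δ * (‖K₀ * U‖ * ‖x‖) := by
          gcongr
          exact ContinuousLinearMap.le_opNorm _ _
      _ = (δ * ‖K₀ * U‖) * ‖x‖ := by ring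
      _ ≤ _ := by gcongr
  have hRx : ∀ x : E, δ * ‖R x‖ ≤ ‖x‖ := fun x =>
    calc δ * ‖R x‖ ≤ δ * (‖R‖ * ‖x‖) := by
          gcongr
          exact ContinuousLinearMap.le_opNorm _ _
      _ = (δ * ‖R‖) * ‖x‖ := by ring
      _ ≤ 1 * ‖x‖ := by gcongr
      _ = _ := one_mul _
  have hUx' : δ * ‖U φ‖ ≤ ℓ * ‖(φ : E)‖ :=
    calc δ * ‖U φ‖ ≤ δ * (‖U‖ * ‖(φ : E)‖) := by
          gcongr
          exact ContinuousLinearMap.le_opNorm _ _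
      _ = (δ * ‖U‖) * ‖(φ : E)‖ := by ring
      _ ≤ _ := by gcongr
  have hkey : δ ^ 2 * ‖X‖ ≤ c * ℓ * (‖(φ : E)‖ * ‖(ψ : E)‖) :=
    calc δ ^ 2 * ‖X‖ ≤ δ ^ 2 * (c * ‖R ψ‖ * ‖U φ‖) := by gcongr
      _ = c * (δ * ‖R ψ‖) * (δ * ‖U φ‖) := by ring
      _ ≤ c * ‖(ψ : E)‖ * (ℓ * ‖(φ : E)‖) := by
          gcongr
          exact hRx _
      _ = _ := by ring
  have hterm : ∀ x y : E, δ ^ 2 * (‖R ((K₀ * U) x)‖ * ‖(K₀ * U) y‖) ≤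
      k ^ 2 / δ * (‖x‖ * ‖y‖) := fun x y => by
    rw [div_mul_eq_mul_div, le_div_iff₀ hδ]
    calc δ ^ 2 * (‖R ((K₀ * U) x)‖ * ‖(K₀ * U) y‖) * δ =
          (δ * (δ * ‖R ((K₀ * U) x)‖)) * (δ * ‖(K₀ * U) y‖) := by ring
      _ ≤ (δ * ‖(K₀ * U) x‖) * (k * ‖y‖) := by
          refine mul_le_mul ?_ (hY _) (by positivity) (by positivity)
          exact mul_le_mul_of_nonneg_left (hRx _) hδ.le
      _ ≤ (k * ‖x‖) * (k * ‖y‖) := mul_le_mul_of_nonneg_right (hY _) (by positivity)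
      _ = _ := by ring
  have h1 : ‖inner ℂ (R ((K₀ * U) φ)) (Complex.I • (K₀ * U) ψ)‖ ≤
      ‖R ((K₀ * U) φ)‖ * ‖(K₀ * U) ψ‖ := by
    refine (norm_inner_le_norm _ _).trans_eq ?_
    rw [norm_smul, Complex.norm_I, one_mul]
  have h2 : ‖inner ℂ (Complex.I • (K₀ * U) φ) (R ((K₀ * U) ψ))‖ ≤
      ‖R ((K₀ * U) ψ)‖ * ‖(K₀ * U) φ‖ := by
    refine (norm_inner_le_norm _ _).trans_eq ?_
    rw [norm_smul, Complex.norm_I, one_mul, mul_comm]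
  have h3 := norm_add_le (X - inner ℂ (R ((K₀ * U) φ)) (Complex.I • (K₀ * U) ψ))
    (inner ℂ (Complex.I • (K₀ * U) φ) (R ((K₀ * U) ψ)))
  have h4 := norm_sub_le X (inner ℂ (R ((K₀ * U) φ)) (Complex.I • (K₀ * U) ψ))
  calc δ ^ 2 * _ ≤ δ ^ 2 * (‖X‖ + ‖R ((K₀ * U) φ)‖ * ‖(K₀ * U) ψ‖ +
        ‖R ((K₀ * U) ψ)‖ * ‖(K₀ * U) φ‖) := by
        gcongr
        linarith
    _ = δ ^ 2 * ‖X‖ + δ ^ 2 * (‖R ((K₀ * U) φ)‖ * ‖(K₀ * U) ψ‖) +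
        δ ^ 2 * (‖R ((K₀ * U) ψ)‖ * ‖(K₀ * U) φ‖) := by ring
    _ ≤ c * ℓ * (‖(φ : E)‖ * ‖(ψ : E)‖) + k ^ 2 / δ * (‖(φ : E)‖ * ‖(ψ : E)‖) +
        k ^ 2 / δ * (‖(ψ : E)‖ * ‖(φ : E)‖) :=
        add_le_add (add_le_add hkey (hterm _ _)) (hterm _ _)
    _ = _ := by ring

end Commutator

end

section

variable {E : Type*} [NormedAddCommGroup E] [InnerProductSpace ℂ E]

/-! ### Energy estimates -/

theorem shiftOp_neg_smul_one (R : E →L[ℂ] E) (w : ℂ) :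
    shiftOp R (-(w • 1)) = 1 - (w + Complex.I) • R := by
  rw [shiftOp, sub_mul, neg_mul, smul_mul_assoc, smul_mul_assoc, one_mul]
  module

/-- The resolvent at `w` expressed through the resolvent at `-i`. -/
theorem shiftOp_mul_one_add_resolvent {T : E →ₗ.[ℂ] E} (hi : -Complex.I ∈ resolventSet T) {w : ℂ}
    (hw : w ∈ resolventSet T) :
    shiftOp (resolvent T (-Complex.I)) (-(w • 1)) * (1 + (w + Complex.I) • resolvent T w) = 1 ∧
    (1 + (w + Complex.I) • resolvent T w) * shiftOp (resolvent T (-Complex.I)) (-(w • 1)) = 1 ∧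
    resolvent T (-Complex.I) * (1 + (w + Complex.I) • resolvent T w) = resolvent T w := by
  have h1 := resolvent_sub_resolvent hw hi
  have h2 := (commute_resolvent hw hi).eq
  rw [sub_neg_eq_add] at h1
  rw [shiftOp_neg_smul_one]
  set R := resolvent T (-Complex.I)
  set Rw := resolvent T w
  refine ⟨?_, ?_, ?_⟩
  · have h3 : (1 - (w + Complex.I) • R) * (1 + (w + Complex.I) • Rw) =
        1 + (w + Complex.I) • ((Rw - R) - (w + Complex.I) • (R * Rw)) := by
      simp only [mul_add, sub_mul, smul_mul_assoc, mul_smul_comm, one_mul, mul_one]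
      module
    rw [h3, h1, sub_self, smul_zero, add_zero]
  · have h3 : (1 + (w + Complex.I) • Rw) * (1 - (w + Complex.I) • R) =
        1 + (w + Complex.I) • ((Rw - R) - (w + Complex.I) • (Rw * R)) := by
      simp only [mul_sub, add_mul, smul_mul_assoc, mul_smul_comm, one_mul, mul_one]
      module
    rw [h3, h1, h2, sub_self, smul_zero, add_zero]
  · rw [mul_add, mul_one, mul_smul_comm, ← h1]
    abel

theorem isUnit_shiftOp_resolvent {T : E →ₗ.[ℂ] E} (hi : -Complex.I ∈ resolventSet T) {w : ℂ}
    (hw : w ∈ resolventSet T) : IsUnit (shiftOp (resolvent T (-Complex.I)) (-(w • 1))) := by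
  obtain ⟨h1, h2, -⟩ := shiftOp_mul_one_add_resolvent hi hw
  exact ⟨⟨_, _, h1, h2⟩, rfl⟩

theorem shiftInv_resolvent {T : E →ₗ.[ℂ] E} (hi : -Complex.I ∈ resolventSet T) {w : ℂ}
    (hw : w ∈ resolventSet T) :
    shiftInv (resolvent T (-Complex.I)) (-(w • 1)) = 1 + (w + Complex.I) • resolvent T w := by
  obtain ⟨h1, h2, -⟩ := shiftOp_mul_one_add_resolvent hi hw
  exact Ring.inverse_unit ⟨_, _, h1, h2⟩

theorem pertInv_resolvent {T : E →ₗ.[ℂ] E} (hi : -Complex.I ∈ resolventSet T) {w : ℂ}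
    (hw : w ∈ resolventSet T) :
    pertInv (resolvent T (-Complex.I)) (-(w • 1)) = resolvent T w := by
  rw [pertInv, shiftInv_resolvent hi hw]
  exact (shiftOp_mul_one_add_resolvent hi hw).2.2

/-- The perturbation `-z - iτB` of `H`. -/
def dissipation (B : E →L[ℂ] E) (z : ℂ) (τ : ℝ) : E →L[ℂ] E :=
  -(z • 1) - (Complex.I * τ) • B

theorem shiftOp_dissipation (R B : E →L[ℂ] E) (z : ℂ) (τ : ℝ) (ψ : E) :
    shiftOp R (dissipation B z τ) ψ =
      ψ - (z + Complex.I) • R ψ - (Complex.I * τ) • B (R ψ) := by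
  simp only [shiftOp, dissipation, add_apply, one_apply_eq_self, mul_apply_eq_comp, sub_apply,
    neg_apply, smul_apply]
  module

variable [CompleteSpace E]

theorem star_dissipation {B : E →L[ℂ] E} (hB : star B = B) (z : ℂ) (τ : ℝ) :
    star (dissipation B z τ) = dissipation B (starRingEnd ℂ z) (-τ) := by
  simp only [dissipation, star_sub, star_neg, star_smul, star_one, hB, Complex.star_def, map_mul,
    Complex.conj_I, Complex.conj_ofReal]
  push_cast
  module

/-- The data on which the energy estimates are based: `R = (H + i)⁻¹`, a spectral cutoff `F` of `H`
near `Re z`, and a bounded self-adjoint operator `B` which is positive on the range of `F`. All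
quantities are measured in units of the energy `δ`. -/
structure EnergyData (R F B : E →L[ℂ] E) (z : ℂ) (δ M : ℝ) : Prop where
  normal : IsStarNormal R
  symm : star R - R = (2 * Complex.I) • (star R * R)
  δ_pos : 0 < δ
  M_nonneg : 0 ≤ M
  im_nonneg : 0 ≤ z.im
  star_B : star B = B
  norm_B : ‖B‖ ≤ M * δ
  cut : ∀ ψ, δ * ‖(1 - F) (R ψ)‖ ≤ ‖ψ - (z + Complex.I) • R ψ‖
  cut_conj : ∀ ψ, δ * ‖(1 - F) (R ψ)‖ ≤ ‖ψ - (starRingEnd ℂ z + Complex.I) • R ψ‖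
  pos : ∀ u, δ / 36 * ‖F u‖ ^ 2 ≤ (inner ℂ (F u) (B (F u))).re

/-- A constant which dominates the loss in the energy estimates. -/
def lossConst (M : ℝ) : ℝ := 72 * M ^ 2 + M + 1

/-- The energy estimates hold for `0 < τ ≤ maxTime M`. -/
def maxTime (M : ℝ) : ℝ := (24 * lossConst M)⁻¹

theorem one_le_lossConst {M : ℝ} (hM : 0 ≤ M) : 1 ≤ lossConst M := by
  unfold lossConst; nlinarith [sq_nonneg M]

theorem maxTime_pos {M : ℝ} (hM : 0 ≤ M) : 0 < maxTime M := by
  have := one_le_lossConst hM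
  unfold maxTime; positivity

theorem maxTime_le_one {M : ℝ} (hM : 0 ≤ M) : maxTime M ≤ 1 := by
  have := one_le_lossConst hM
  exact inv_le_one_of_one_le₀ (by linarith)

/-- For `φ = (H + i)⁻¹ψ` this is `-Im ⟪φ, (H - z - iτB)φ⟫ = Im z ‖φ‖² + τ⟪φ, Bφ⟫`. -/
theorem im_inner_shiftOp_dissipation {R B : E →L[ℂ] E}
    (hR : star R - R = (2 * Complex.I) • (star R * R)) (z : ℂ) (τ : ℝ) (ψ : E) :
    -(inner ℂ (R ψ) (shiftOp R (dissipation B z τ) ψ)).im =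
      z.im * ‖R ψ‖ ^ 2 + τ * (inner ℂ (R ψ) (B (R ψ))).re := by
  have h4 : (inner ℂ (R ψ) (R ψ) : ℂ) = ((‖R ψ‖ ^ 2 : ℝ) : ℂ) := by
    rw [inner_self_eq_norm_sq_to_K]; norm_cast
  have h1 : (inner ℂ (R ψ) ψ).im = ‖R ψ‖ ^ 2 := by
    have h2 := congrArg (fun T : E →L[ℂ] E => inner ℂ ψ (T ψ)) hR
    simp only [sub_apply, smul_apply, mul_apply_eq_comp, inner_sub_right, inner_smul_right,
      ContinuousLinearMap.star_eq_adjoint, ContinuousLinearMap.adjoint_inner_right] at h2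
    rw [← inner_conj_symm ψ (R ψ), h4] at h2
    have h3 := congrArg Complex.im h2
    simp only [Complex.sub_im, Complex.conj_im, Complex.mul_im, Complex.mul_re, Complex.re_ofNat,
      Complex.im_ofNat, Complex.I_re, Complex.I_im, Complex.ofReal_re, Complex.ofReal_im] at h3
    linarith
  rw [shiftOp_dissipation, inner_sub_right, inner_sub_right, inner_smul_right, inner_smul_right, h4]
  simp only [Complex.sub_im, h1, Complex.mul_im, Complex.add_im, Complex.I_im, Complex.ofReal_re,
    Complex.ofReal_im, Complex.mul_re, Complex.I_re]
  ring

section Energy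

variable {R F B : E →L[ℂ] E} {z : ℂ} {δ M : ℝ}

/-- Positivity of `B` up to an error outside of the range of the cutoff. -/
theorem EnergyData.re_inner_ge (h : EnergyData R F B z δ M) (u : E) :
    δ * (‖u‖ ^ 2 / 144 - lossConst M * ‖(1 - F) u‖ ^ 2) ≤ (inner ℂ u (B u)).re := by
  have hδ := h.δ_pos
  have hM := h.M_nonneg
  set p := F u
  set q := (1 - F) u with hq
  have hu : u = p + q := by simp [p, q]
  have hBq : ∀ x y : E, ‖inner ℂ x (B y)‖ ≤ M * δ * (‖x‖ * ‖y‖) := fun x y => by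
    refine (norm_inner_le_norm _ _).trans ?_
    calc ‖x‖ * ‖B y‖ ≤ ‖x‖ * (M * δ * ‖y‖) := by
          gcongr
          exact (B.le_opNorm y).trans (mul_le_mul_of_nonneg_right h.norm_B (norm_nonneg _))
      _ = _ := by ring
  have hsymm : (inner ℂ p (B q)).re = (inner ℂ q (B p)).re := by
    have h1 : inner ℂ p (B q) = inner ℂ (B p) q := by
      nth_rw 1 [← h.star_B]
      rw [ContinuousLinearMap.star_eq_adjoint, ContinuousLinearMap.adjoint_inner_right]
    rw [h1, ← inner_conj_symm, Complex.conj_re]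
  have hexp : (inner ℂ u (B u)).re = (inner ℂ p (B p)).re + 2 * (inner ℂ q (B p)).re +
      (inner ℂ q (B q)).re := by
    nth_rw 1 [hu]
    nth_rw 1 [hu]
    rw [map_add, inner_add_left, inner_add_right, inner_add_right]
    simp only [Complex.add_re, hsymm]
    ring
  have h1 := h.pos u
  have h2 := (Complex.abs_re_le_norm _).trans (hBq q p)
  have h3 := (Complex.abs_re_le_norm _).trans (hBq q q)
  have h4 := neg_le_of_abs_le h2
  have h5 := neg_le_of_abs_le h3
  have h6 : ‖u‖ ^ 2 ≤ 2 * ‖p‖ ^ 2 + 2 * ‖q‖ ^ 2 := by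
    have h7 : ‖u‖ ≤ ‖p‖ + ‖q‖ := by
      nth_rw 1 [hu]
      exact norm_add_le _ _
    nlinarith [norm_nonneg u, sq_nonneg (‖p‖ - ‖q‖)]
  rw [hexp]
  have h8 : ‖u‖ ^ 2 / 144 - lossConst M * ‖q‖ ^ 2 ≤
      ‖p‖ ^ 2 / 36 - 2 * M * (‖q‖ * ‖p‖) - M * (‖q‖ * ‖q‖) := by
    unfold lossConst
    nlinarith [sq_nonneg (‖p‖ - 72 * M * ‖q‖), sq_nonneg ‖q‖]
  have h9 := mul_le_mul_of_nonneg_left h8 hδ.le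
  linarith

/-- The energy estimate, for `H - z - iτB` (if `0 ≤ τ`) and for its adjoint. -/
theorem EnergyData.energy_aux (h : EnergyData R F B z δ M) {ζ : ℂ} {σ t : ℝ}
    (hcut : ∀ ψ, δ * ‖(1 - F) (R ψ)‖ ≤ ‖ψ - (ζ + Complex.I) • R ψ‖)
    (hσ : |σ| = 1) (hζ : ζ.im = σ * z.im) (ht : 0 ≤ t) (ht' : t ≤ maxTime M) (ψ : E) :
    z.im * ‖R ψ‖ ^ 2 + t * δ / 288 * ‖R ψ‖ ^ 2 ≤
      ‖inner ℂ (R ψ) (shiftOp R (dissipation B ζ (σ * t)) ψ)‖ +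
        2 * lossConst M * t / δ * ‖shiftOp R (dissipation B ζ (σ * t)) ψ‖ ^ 2 := by
  have hδ := h.δ_pos
  have hM := h.M_nonneg
  have hb := one_le_lossConst hM
  have hσ2 : σ * σ = 1 := by rw [← abs_mul_abs_self, hσ, one_mul]
  set u := R ψ with hu
  set x := shiftOp R (dissipation B ζ (σ * t)) ψ with hx
  set b := lossConst M with hbdef
  have h1 := im_inner_shiftOp_dissipation (B := B) h.symm ζ (σ * t) ψ
  rw [← hx, ← hu, hζ] at h1
  have h2 : z.im * ‖u‖ ^ 2 + t * (inner ℂ u (B u)).re ≤ ‖inner ℂ u x‖ := by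
    have h3 : z.im * ‖u‖ ^ 2 + t * (inner ℂ u (B u)).re = -(σ * (inner ℂ u x).im) := by
      rw [← mul_neg, h1]
      linear_combination (-(z.im * ‖u‖ ^ 2 + t * (inner ℂ u (B u)).re)) * hσ2
    rw [h3]
    refine (neg_le_abs _).trans ?_
    rw [abs_mul, hσ, one_mul]
    exact Complex.abs_im_le_norm _
  have h4 : δ * ‖(1 - F) u‖ ≤ ‖x‖ + t * M * δ * ‖u‖ := by
    refine (hcut ψ).trans ?_
    have h5 : ψ - (ζ + Complex.I) • R ψ = x + (Complex.I * ((σ * t : ℝ) : ℂ)) • B u := by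
      rw [hx, shiftOp_dissipation, hu]
      module
    rw [h5]
    refine (norm_add_le _ _).trans (add_le_add le_rfl ?_)
    rw [norm_smul, norm_mul, Complex.norm_I, one_mul, Complex.norm_real, Real.norm_eq_abs, abs_mul,
      hσ, one_mul, abs_of_nonneg ht]
    calc t * ‖B u‖ ≤ t * (M * δ * ‖u‖) := by
          gcongr
          exact (B.le_opNorm u).trans (mul_le_mul_of_nonneg_right h.norm_B (norm_nonneg _))
      _ = _ := by ring
  have h5 : ‖(1 - F) u‖ ^ 2 ≤ 2 * ‖x‖ ^ 2 / δ ^ 2 + 2 * (t * M) ^ 2 * ‖u‖ ^ 2 := by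
    have h6 : (δ * ‖(1 - F) u‖) ^ 2 ≤ (‖x‖ + t * M * δ * ‖u‖) ^ 2 :=
      pow_le_pow_left₀ (by positivity) h4 2
    have h7 : 2 * ‖x‖ ^ 2 / δ ^ 2 + 2 * (t * M) ^ 2 * ‖u‖ ^ 2 =
        (2 * ‖x‖ ^ 2 + 2 * (t * M * δ * ‖u‖) ^ 2) / δ ^ 2 := by
      field_simp
    rw [h7, le_div_iff₀ (by positivity)]
    nlinarith [sq_nonneg (‖x‖ - t * M * δ * ‖u‖)]
  -- the choice of `maxTime` allows the error to be absorbed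
  have h6 : b * (2 * (t * M) ^ 2) ≤ 1 / 288 := by
    have h7 : M ^ 2 ≤ b := by rw [hbdef]; unfold lossConst; nlinarith [sq_nonneg M]
    have h8 : t * (24 * b) ≤ 1 := by
      rwa [maxTime, ← hbdef, ← one_div, le_div_iff₀ (by positivity)] at ht'
    have h9 : (t * (24 * b)) ^ 2 ≤ 1 := pow_le_one₀ (by positivity) h8
    have h10 : b * (2 * (t * M) ^ 2) ≤ b * (2 * (t ^ 2 * b)) := by
      rw [mul_pow]
      gcongr
    nlinarith
  have h7 := h.re_inner_ge u
  have h8 : b * ‖(1 - F) u‖ ^ 2 ≤ 2 * b * ‖x‖ ^ 2 / δ ^ 2 + ‖u‖ ^ 2 / 288 := by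
    calc b * ‖(1 - F) u‖ ^ 2 ≤ b * (2 * ‖x‖ ^ 2 / δ ^ 2 + 2 * (t * M) ^ 2 * ‖u‖ ^ 2) := by gcongr
      _ = 2 * b * ‖x‖ ^ 2 / δ ^ 2 + b * (2 * (t * M) ^ 2) * ‖u‖ ^ 2 := by ring
      _ ≤ 2 * b * ‖x‖ ^ 2 / δ ^ 2 + 1 / 288 * ‖u‖ ^ 2 := by gcongr
      _ = _ := by ring
  have h9 : t * (δ * (‖u‖ ^ 2 / 288 - 2 * b * ‖x‖ ^ 2 / δ ^ 2)) ≤ t * (inner ℂ u (B u)).re := by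
    refine mul_le_mul_of_nonneg_left (le_trans ?_ h7) ht
    exact mul_le_mul_of_nonneg_left (by linarith) hδ.le
  have h10 : t * (δ * (‖u‖ ^ 2 / 288 - 2 * b * ‖x‖ ^ 2 / δ ^ 2)) =
      t * δ / 288 * ‖u‖ ^ 2 - 2 * b * t / δ * ‖x‖ ^ 2 := by
    field_simp
  linarith

theorem EnergyData.energy (h : EnergyData R F B z δ M) {t : ℝ} (ht : 0 ≤ t) (ht' : t ≤ maxTime M)
    (ψ : E) :
    z.im * ‖R ψ‖ ^ 2 + t * δ / 288 * ‖R ψ‖ ^ 2 ≤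
      ‖inner ℂ (R ψ) (shiftOp R (dissipation B z t) ψ)‖ +
        2 * lossConst M * t / δ * ‖shiftOp R (dissipation B z t) ψ‖ ^ 2 := by
  have := h.energy_aux (σ := 1) h.cut (by simp) (by simp) ht ht' ψ
  rwa [one_mul] at this

theorem EnergyData.energy_star (h : EnergyData R F B z δ M) {t : ℝ} (ht : 0 ≤ t)
    (ht' : t ≤ maxTime M) (ψ : E) :
    z.im * ‖R ψ‖ ^ 2 + t * δ / 288 * ‖R ψ‖ ^ 2 ≤
      ‖inner ℂ (R ψ) (shiftOp R (star (dissipation B z t)) ψ)‖ +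
        2 * lossConst M * t / δ * ‖shiftOp R (star (dissipation B z t)) ψ‖ ^ 2 := by
  have := h.energy_aux (σ := -1) h.cut_conj (by simp) (by simp) ht ht' ψ
  rwa [neg_one_mul, ← star_dissipation h.star_B] at this

/-- With `u = Rψ` and `x = (H - z - iτB)u`, the energy estimate implies that `H - z - iτB` is
bounded below. -/
theorem EnergyData.lower_bound (h : EnergyData R F B z δ M) {t : ℝ} (ht : 0 ≤ t)
    (ht' : t ≤ maxTime M) {u x : E}
    (hE : z.im * ‖u‖ ^ 2 + t * δ / 288 * ‖u‖ ^ 2 ≤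
      ‖inner ℂ u x‖ + 2 * lossConst M * t / δ * ‖x‖ ^ 2) :
    t * δ / (600 * lossConst M) * ‖u‖ ≤ ‖x‖ := by
  have hδ := h.δ_pos
  have hb := one_le_lossConst h.M_nonneg
  have ht1 := ht'.trans (maxTime_le_one h.M_nonneg)
  set b := lossConst M
  have h1 : ‖inner ℂ u x‖ ≤ ‖u‖ * ‖x‖ := norm_inner_le_norm _ _
  have h2 : 0 ≤ z.im * ‖u‖ ^ 2 := mul_nonneg h.im_nonneg (sq_nonneg _)
  set X := t * δ * ‖u‖ with hX
  have hX0 : 0 ≤ X := by positivity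
  have h3 : X ^ 2 / 288 ≤ X * ‖x‖ + 2 * b * ‖x‖ ^ 2 := by
    have h4 : t * δ * (t * δ / 288 * ‖u‖ ^ 2) ≤
        t * δ * (‖u‖ * ‖x‖ + 2 * b * t / δ * ‖x‖ ^ 2) := by
      refine mul_le_mul_of_nonneg_left (by linarith) (by positivity)
    have h5 : t * δ * (2 * b * t / δ * ‖x‖ ^ 2) = 2 * b * t ^ 2 * ‖x‖ ^ 2 := by
      field_simp
    have h6 : 2 * b * t ^ 2 * ‖x‖ ^ 2 ≤ 2 * b * 1 * ‖x‖ ^ 2 := by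
      gcongr
      exact pow_le_one₀ ht ht1
    have h7 : t * δ * (t * δ / 288 * ‖u‖ ^ 2) = X ^ 2 / 288 := by rw [hX]; ring
    have h8 : t * δ * (‖u‖ * ‖x‖) = X * ‖x‖ := by rw [hX]; ring
    rw [mul_add, h5, h7, h8] at h4
    linarith
  rw [div_mul_eq_mul_div, div_le_iff₀ (by positivity), ← hX]
  by_contra! hcon
  have hx0 := norm_nonneg x
  have hxb : ‖x‖ ≤ X / 600 := by
    rw [le_div_iff₀ (by norm_num)]
    nlinarith
  have hxb2 : b * ‖x‖ ^ 2 ≤ X / 600 * (X / 600) := by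
    have h4 : b * ‖x‖ ≤ X / 600 := by linarith
    calc b * ‖x‖ ^ 2 = (b * ‖x‖) * ‖x‖ := by ring
      _ ≤ X / 600 * (X / 600) := by gcongr
  have hXpos : 0 < X := lt_of_le_of_lt (by positivity) hcon
  nlinarith [mul_le_mul_of_nonneg_left hxb hX0, mul_pos hXpos hXpos]

theorem EnergyData.isUnit (h : EnergyData R F B z δ M) {t : ℝ} (ht : 0 < t)
    (ht' : t ≤ maxTime M) : IsUnit (shiftOp R (dissipation B z t)) := by
  have := h.normal
  have hδ := h.δ_pos
  have hb := one_le_lossConst h.M_nonneg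
  exact isUnit_shiftOp h.symm (c := t * δ / (600 * lossConst M)) (by positivity)
    (fun x => h.lower_bound ht.le ht' (h.energy ht.le ht' x))
    (fun x => h.lower_bound ht.le ht' (h.energy_star ht.le ht' x))

theorem EnergyData.isUnit_star (h : EnergyData R F B z δ M) {t : ℝ} (ht : 0 < t)
    (ht' : t ≤ maxTime M) : IsUnit (shiftOp R (star (dissipation B z t))) := by
  have := h.normal
  have hδ := h.δ_pos
  have hb := one_le_lossConst h.M_nonneg
  refine isUnit_shiftOp h.symm (c := t * δ / (600 * lossConst M)) (by positivity)
    (fun x => h.lower_bound ht.le ht' (h.energy_star ht.le ht' x)) (fun x => ?_)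
  rw [star_star]
  exact h.lower_bound ht.le ht' (h.energy ht.le ht' x)

theorem EnergyData.norm_pertInv_le (h : EnergyData R F B z δ M) {t : ℝ} (ht : 0 < t)
    (ht' : t ≤ maxTime M) :
    ‖pertInv R (dissipation B z t)‖ ≤ 600 * lossConst M / (t * δ) := by
  have hδ := h.δ_pos
  have hb := one_le_lossConst h.M_nonneg
  refine ContinuousLinearMap.opNorm_le_bound _ (by positivity) fun x => ?_
  have h1 := h.lower_bound ht.le ht' (h.energy ht.le ht' (shiftInv R (dissipation B z t) x))
  rw [← mul_apply_eq_comp (shiftOp R _), shiftOp_mul_shiftInv (h.isUnit ht ht'),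
    one_apply_eq_self, div_mul_eq_mul_div, div_le_iff₀ (by positivity)] at h1
  rw [div_mul_eq_mul_div, le_div_iff₀ (by positivity), pertInv, mul_apply_eq_comp]
  linarith

/-- The consequence of the energy estimate for `(H - z - iτB)⁻¹ D`, in terms of the sandwiched
operator `D⋆ (H - z - iτB)⁻¹ D`. -/
theorem EnergyData.norm_mul_le_of_energy (h : EnergyData R F B z δ M) {t : ℝ} (ht : 0 ≤ t)
    (ht' : t ≤ maxTime M) {G D : E →L[ℂ] E} (hD : ‖D‖ ≤ 1)
    (hE : ∀ x, z.im * ‖G x‖ ^ 2 + t * δ / 288 * ‖G x‖ ^ 2 ≤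
      ‖inner ℂ (G x) x‖ + 2 * lossConst M * t / δ * ‖x‖ ^ 2) :
    √t * (δ * ‖G * D‖) ≤ 24 * lossConst M * √(1 + δ * ‖star D * G * D‖) ∧
    √(z.im * δ) * ‖G * D‖ ≤ 24 * lossConst M * √(1 + δ * ‖star D * G * D‖) := by
  have hδ := h.δ_pos
  have hb := one_le_lossConst h.M_nonneg
  have hz := h.im_nonneg
  have ht1 := ht'.trans (maxTime_le_one h.M_nonneg)
  set b := lossConst M
  set Φ := 1 + δ * ‖star D * G * D‖ with hΦ
  have hΦ1 : 1 ≤ Φ := by rw [hΦ]; linarith [mul_nonneg hδ.le (norm_nonneg (star D * G * D))]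
  have hv : ∀ v, δ * (z.im * ‖(G * D) v‖ ^ 2 + t * δ / 288 * ‖(G * D) v‖ ^ 2) ≤
      2 * b * Φ * ‖v‖ ^ 2 := fun v => by
    have h1 := hE (D v)
    have h2 : ‖inner ℂ (G (D v)) (D v)‖ ≤ ‖star D * G * D‖ * ‖v‖ ^ 2 := by
      rw [← inner_conj_symm, RCLike.norm_conj, ← ContinuousLinearMap.adjoint_inner_right,
        ← ContinuousLinearMap.star_eq_adjoint]
      refine (norm_inner_le_norm _ _).trans ?_
      have h3 := (star D * G * D).le_opNorm v
      simp only [mul_apply_eq_comp] at h3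
      nlinarith [norm_nonneg v]
    have h3 : ‖D v‖ ^ 2 ≤ ‖v‖ ^ 2 := by
      refine pow_le_pow_left₀ (norm_nonneg _) ((D.le_opNorm v).trans ?_) 2
      exact mul_le_of_le_one_left (norm_nonneg _) hD
    rw [mul_apply_eq_comp]
    calc δ * (z.im * ‖G (D v)‖ ^ 2 + t * δ / 288 * ‖G (D v)‖ ^ 2) ≤
          δ * (‖star D * G * D‖ * ‖v‖ ^ 2 + 2 * b * 1 / δ * ‖v‖ ^ 2) := by
          refine mul_le_mul_of_nonneg_left (h1.trans (add_le_add h2 ?_)) hδ.le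
          gcongr
      _ = (δ * ‖star D * G * D‖ + 2 * b) * ‖v‖ ^ 2 := by field_simp
      _ ≤ 2 * b * Φ * ‖v‖ ^ 2 := by
          gcongr
          rw [hΦ]
          nlinarith [mul_nonneg hδ.le (norm_nonneg (star D * G * D))]
  have key : ∀ r : ℝ, 0 ≤ r → (∀ v, r ^ 2 * ‖(G * D) v‖ ^ 2 ≤ 576 * b * Φ * ‖v‖ ^ 2) →
      r * ‖G * D‖ ≤ 24 * b * √Φ := fun r hr hrv => by
    rw [← abs_of_nonneg hr, ← Real.norm_eq_abs, ← norm_smul]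
    refine ContinuousLinearMap.opNorm_le_bound _ (by positivity) fun v => ?_
    rw [smul_apply, norm_smul, Real.norm_eq_abs, abs_of_nonneg hr]
    refine le_of_sq_le_sq ?_ (by positivity)
    have h1 := hrv v
    have h2 : (24 * b * √Φ * ‖v‖) ^ 2 = 576 * b ^ 2 * Φ * ‖v‖ ^ 2 := by
      rw [mul_pow, mul_pow, Real.sq_sqrt (by linarith)]
      ring
    rw [h2, mul_pow]
    refine h1.trans ?_
    gcongr
    nlinarith
  constructor
  · rw [← mul_assoc]
    refine key _ (by positivity) fun v => ?_
    rw [mul_pow, Real.sq_sqrt ht]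
    have h1 := hv v
    have h2 : 0 ≤ δ * (z.im * ‖(G * D) v‖ ^ 2) := by positivity
    nlinarith
  · refine key _ (by positivity) fun v => ?_
    rw [Real.sq_sqrt (by positivity)]
    have h1 := hv v
    have h2 : 0 ≤ δ * (t * δ / 288 * ‖(G * D) v‖ ^ 2) := by positivity
    have h3 : 0 ≤ b * Φ * ‖v‖ ^ 2 := by positivity
    nlinarith

theorem EnergyData.norm_pertInv_mul_le (h : EnergyData R F B z δ M) {t : ℝ} (ht : 0 < t)
    (ht' : t ≤ maxTime M) {D : E →L[ℂ] E} (hD : ‖D‖ ≤ 1) :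
    √t * (δ * ‖pertInv R (dissipation B z t) * D‖) ≤
      24 * lossConst M * √(1 + δ * ‖star D * pertInv R (dissipation B z t) * D‖) := by
  refine (h.norm_mul_le_of_energy ht.le ht' hD fun x => ?_).1
  have h1 := h.energy ht.le ht' (shiftInv R (dissipation B z t) x)
  rwa [← mul_apply_eq_comp (shiftOp R _), shiftOp_mul_shiftInv (h.isUnit ht ht'),
    one_apply_eq_self, ← mul_apply_eq_comp R] at h1

theorem EnergyData.norm_mul_pertInv_le (h : EnergyData R F B z δ M) {t : ℝ} (ht : 0 < t)
    (ht' : t ≤ maxTime M) {D : E →L[ℂ] E} (hD : ‖D‖ ≤ 1) :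
    √t * (δ * ‖star D * pertInv R (dissipation B z t)‖) ≤
      24 * lossConst M * √(1 + δ * ‖star D * pertInv R (dissipation B z t) * D‖) ∧
    √(z.im * δ) * ‖star D * pertInv R (dissipation B z t)‖ ≤
      24 * lossConst M * √(1 + δ * ‖star D * pertInv R (dissipation B z t) * D‖) := by
  have h1 := h.norm_mul_le_of_energy (G := pertInv R (star (dissipation B z t))) ht.le ht' hD
    fun x => by
      have h1 := h.energy_star ht.le ht' (shiftInv R (star (dissipation B z t)) x)
      rwa [← mul_apply_eq_comp (shiftOp R _), shiftOp_mul_shiftInv (h.isUnit_star ht ht'),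
        one_apply_eq_self, ← mul_apply_eq_comp R] at h1
  have h2 := star_pertInv h.symm (h.isUnit ht ht') (h.isUnit_star ht ht')
  have h3 : ‖pertInv R (star (dissipation B z t)) * D‖ =
      ‖star D * pertInv R (dissipation B z t)‖ := by
    rw [← norm_star, star_mul, ← h2, star_star]
  have h4 : ‖star D * pertInv R (star (dissipation B z t)) * D‖ =
      ‖star D * pertInv R (dissipation B z t) * D‖ := by
    rw [← norm_star, star_mul, star_mul, star_star, ← h2, star_star, mul_assoc]
  rwa [h3, h4] at h1

end Energy

end

section

variable {E : Type*} [NormedAddCommGroup E] [InnerProductSpace ℂ E] [CompleteSpace E]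

/-! ### The differential inequality -/

/-- The derivative of `(H - z - iτB)⁻¹` in `τ`. -/
theorem hasDerivAt_pertInv {R B : E →L[ℂ] E} {z : ℂ} {t : ℝ}
    (h : IsUnit (shiftOp R (dissipation B z t))) :
    HasDerivAt (fun τ : ℝ => pertInv R (dissipation B z τ))
      (Complex.I • (pertInv R (dissipation B z t) * B * pertInv R (dissipation B z t))) t := by
  have h1 : HasDerivAt (fun τ : ℝ => shiftOp R (dissipation B z τ)) (-(Complex.I • (B * R))) t := by
    have h2 : (fun τ : ℝ => shiftOp R (dissipation B z τ)) = fun τ : ℝ =>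
        shiftOp R (-(z • 1)) + τ • (-(Complex.I • (B * R))) := by
      funext τ
      rw [shiftOp, shiftOp, dissipation, ← Complex.coe_smul]
      simp only [sub_mul, smul_mul_assoc]
      module
    rw [h2]
    simpa using ((hasDerivAt_id t).smul_const (-(Complex.I • (B * R)))).const_add
      (shiftOp R (-(z • 1)))
  obtain ⟨u, hu⟩ := h
  have hinv : shiftInv R (dissipation B z t) = ↑u⁻¹ := by
    rw [shiftInv, ← hu, Ring.inverse_unit]
  have h3 : HasFDerivAt Ring.inverse
      (-((ContinuousLinearMap.mulLeftRight ℝ (E →L[ℂ] E)) ↑u⁻¹) ↑u⁻¹)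
      (shiftOp R (dissipation B z t)) := by
    rw [← hu]
    exact hasFDerivAt_ringInverse u
  have h4 := (h3.comp_hasDerivAt t h1).const_mul R
  refine h4.congr_deriv ?_
  rw [pertInv, hinv]
  simp only [neg_apply, ContinuousLinearMap.mulLeftRight_apply, mul_neg, neg_mul, neg_neg,
    smul_mul_assoc, mul_smul_comm, mul_assoc]

/-- The commutator `[A, (H - z - iτB)⁻¹]`. -/
theorem hasComm_pertInv {A : E →ₗ.[ℂ] E} (hA : IsSelfAdjoint A) {R K₀ B B' : E →L[ℂ] E} {z : ℂ}
    {t : ℝ} (hR : HasComm A R (R * K₀)) (hB : HasComm A B B')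
    (h : IsUnit (shiftOp R (dissipation B z t))) :
    HasComm A (pertInv R (dissipation B z t))
      (pertInv R (dissipation B z t) * K₀ * shiftInv R (dissipation B z t) +
        (Complex.I * t) • (pertInv R (dissipation B z t) * B' *
          pertInv R (dissipation B z t))) := by
  set V := dissipation B z t with hV
  have h1 : HasComm A (V - Complex.I • 1) ((-(Complex.I * t)) • B') := by
    have h2 := ((HasComm.one A).smul (-z - Complex.I)).add (hB.smul (-(Complex.I * t)))
    rw [smul_zero, zero_add] at h2
    have h3 : V - Complex.I • 1 = (-z - Complex.I) • 1 + (-(Complex.I * t)) • B := by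
      rw [hV, dissipation]
      module
    rwa [h3]
  have h2 := (HasComm.one A).add (h1.mul hR)
  rw [zero_add] at h2
  have h3 := hR.mul (h2.inv hA (shiftOp_mul_shiftInv h) (shiftInv_mul_shiftOp h))
  have h4 := pertInv_mul_shiftOp h
  have h5 : R * K₀ * shiftInv R V = pertInv R V * shiftOp R V * K₀ * shiftInv R V := by rw [h4]
  rw [h5] at h3
  change HasComm A (pertInv R V) _ at h3
  convert h3 using 1
  rw [pertInv, shiftOp]
  simp only [mul_add, add_mul, sub_mul, mul_sub, smul_mul_assoc, mul_smul_comm, mul_assoc, one_mul,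
    mul_one, mul_neg, neg_mul, neg_smul, neg_add_rev, neg_neg]
  module

/-- The commutator of `A` with a bounded operator, sandwiched by the weight `(1 - iτA)⁻¹W`. -/
theorem star_mul_comm_mul {A : E →ₗ.[ℂ] E} (hA : IsSelfAdjoint A) {G G' : E →L[ℂ] E}
    (hG : HasComm A G G') {t : ℝ} (ht : 0 < t) (W : E →L[ℂ] E) :
    star (smoothing A t * W) * G' * (smoothing A t * W) =
      star (smoothed A t * W) * G * (smoothing A t * W) -
        star (smoothing A t * W) * G * (smoothed A t * W) := by
  refine ContinuousLinearMap.ext fun y => ext_inner_left ℂ fun x => ?_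
  have h := hG.inner_sub hA ⟨_, smoothing_mem_domain hA ht (W x)⟩
    ⟨_, smoothing_mem_domain hA ht (W y)⟩
  rw [apply_smoothing hA ht, apply_smoothing hA ht] at h
  simp only [sub_apply, mul_apply_eq_comp, ContinuousLinearMap.star_eq_adjoint, inner_sub_right]
  rw [ContinuousLinearMap.adjoint_inner_right, ContinuousLinearMap.adjoint_inner_right,
    ContinuousLinearMap.adjoint_inner_right]
  exact h.symm

/-- The data which enter the differential inequality. Here `w = z + iδ`, `K` stands for a multiple
`θ[H, A]⁰(H + i)⁻¹` of the commutator, and `B` is the regularised commutator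
`θδ²(H - w̄)⁻¹ i[H, A]⁰ (H - w)⁻¹`. -/
structure CommutatorData (R F B K : E →L[ℂ] E) (z w : ℂ) (δ M : ℝ) : Prop extends
    EnergyData R F B z δ M where
  w_eq : w = z + Complex.I * δ
  im_le : z.im ≤ δ
  isUnit_w : IsUnit (shiftOp R (-(w • 1)))
  isUnit_conj_w : IsUnit (shiftOp R (-(starRingEnd ℂ w • 1)))
  norm_w : δ * ‖pertInv R (-(w • 1))‖ ≤ 1
  norm_K : ‖K * shiftInv R (-(w • 1))‖ ≤ M
  B_eq : B = ((δ ^ 2 : ℝ) : ℂ) •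
    (star (pertInv R (-(w • 1))) * (Complex.I • (K * shiftInv R (-(w • 1)))))

section Inequality

variable {R F B K : E →L[ℂ] E} {z w : ℂ} {δ M : ℝ}

/-- The dissipation `iGBG` coincides with the commutator `-GKG` up to terms which contain an
additional factor `G⁻¹ = H - z - iτB`. -/
theorem CommutatorData.pertInv_mul_B_mul_pertInv (h : CommutatorData R F B K z w δ M) {t : ℝ}
    (hu : IsUnit (shiftOp R (dissipation B z t))) :
    Complex.I • (pertInv R (dissipation B z t) * B * pertInv R (dissipation B z t)) =
      -(pertInv R (dissipation B z t) * K * shiftInv R (dissipation B z t)) +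
      pertInv R (dissipation B z t) * (K * shiftInv R (-(w • 1))) *
        (1 + (Complex.I * t) • (B * pertInv R (dissipation B z t))) -
      (Complex.I * δ) • ((1 + pertInv R (dissipation B z t) *
        ((2 * Complex.I * z.im) • 1 + (Complex.I * t) • B)) * star (pertInv R (-(w • 1))) *
        (K * shiftInv R (-(w • 1))) * pertInv R (dissipation B z t)) := by
  have hBe := h.B_eq
  have h1 := shiftInv_sub_shiftInv h.isUnit_w hu
  have h2 : star (pertInv R (-(w • 1))) = pertInv R (-(starRingEnd ℂ w • 1)) := by
    have h3 : star (-(w • (1 : E →L[ℂ] E))) = -(starRingEnd ℂ w • 1) := by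
      rw [star_neg, star_smul, star_one]; rfl
    have h4 := h.isUnit_conj_w
    rw [← h3] at h4 ⊢
    exact star_pertInv h.symm h.isUnit_w h4
  have h3 := pertInv_sub_pertInv hu h.isUnit_conj_w
  rw [← h2] at h3
  set G := pertInv R (dissipation B z t)
  set S := shiftInv R (dissipation B z t)
  set U := shiftInv R (-(w • 1))
  set Rs := star (pertInv R (-(w • 1)))
  have h4 : K * S = K * U * (1 + (Complex.I * t) • (B * G)) - (Complex.I * δ) • (K * U * G) := by
    have h5 : S = U - U * (dissipation B z t - -(w • 1)) * G := by rw [← h1]; abel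
    have h6 : dissipation B z t - -(w • 1) = (Complex.I * δ) • 1 - (Complex.I * t) • B := by
      rw [dissipation, h.w_eq]; module
    rw [h5, h6]
    simp only [mul_sub, sub_mul, mul_add, smul_mul_assoc, mul_smul_comm, mul_one, mul_assoc]
    module
  have h5 : (1 + G * ((2 * Complex.I * z.im) • 1 + (Complex.I * t) • B)) * Rs =
      G - (Complex.I * δ) • (G * Rs) := by
    have h6 : -(starRingEnd ℂ w • 1) - dissipation B z t =
        (2 * Complex.I * z.im + Complex.I * δ) • 1 + (Complex.I * t) • B := by
      have h7 : starRingEnd ℂ z = z - 2 * Complex.I * z.im := by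
        apply Complex.ext
        · simp
        · simp; ring
      rw [dissipation, h.w_eq, map_add, map_mul, Complex.conj_I, Complex.conj_ofReal, h7]
      module
    have h7 : G = Rs + G * (-(starRingEnd ℂ w • 1) - dissipation B z t) * Rs := by
      rw [← h3]; abel
    rw [h6] at h7
    have h8 : G - (Complex.I * δ) • (G * Rs) =
        Rs + G * ((2 * Complex.I * z.im + Complex.I * δ) • 1 + (Complex.I * t) • B) * Rs -
          (Complex.I * δ) • (G * Rs) := by rw [← h7]
    rw [h8]
    simp only [add_mul, mul_add, smul_mul_assoc, mul_smul_comm, mul_one, one_mul]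
    module
  rw [h5, mul_assoc G K S, h4, hBe]
  simp only [mul_sub, sub_mul, mul_add, smul_mul_assoc, mul_smul_comm, mul_one, mul_assoc,
    smul_smul, smul_sub]
  have h6 : Complex.I * (((δ ^ 2 : ℝ) : ℂ) * Complex.I) =
      Complex.I * (δ * (Complex.I * δ)) := by push_cast; ring
  simp only [h6]
  abel

/-- The constant in the differential inequality. -/
def growthConst (M : ℝ) : ℝ := 576 * lossConst M ^ 2 * (4 + 5 * M + 2 * M ^ 2)

/-- The sum of the bounds for the terms of the derivative of the sandwiched resolvent. Here `x` and
`y` stand for `δ‖GD‖` and `δ‖D⋆G‖`, and `p` is the bound for `A(1 - itA)⁻¹⟨A⟩⁻ˢ`. -/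
theorem derivative_bound_aux {t s m x y p : ℝ} (hM : 0 ≤ M) (ht : 0 < t) (ht1 : t ≤ 1)
    (hm : 1 ≤ m) (hx : 0 ≤ x) (hy : 0 ≤ y) (hxm : √t * x ≤ m) (hym : √t * y ≤ m)
    (hs : s ≤ 1) (hp : p = t ^ (s - 1)) :
    2 * p * (x + y) + t * M * (x * y) + y * M * (1 + t * M * x) +
      (1 + 2 * m + t * M * y) * M * x ≤
      t ^ (s - 3 / 2) * (m ^ 2 * (4 + 5 * M + 2 * M ^ 2)) := by
  have hp1 : 1 ≤ p := by
    rw [hp]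
    exact Real.one_le_rpow_of_pos_of_le_one_of_nonpos ht ht1 (by linarith)
  set r := √t with hr
  have hr0 : 0 < r := Real.sqrt_pos.2 ht
  have hr1 : r ≤ 1 := Real.sqrt_le_one.2 ht1
  have hrr : t = r * r := (Real.mul_self_sqrt ht.le).symm
  have hpr : t ^ (s - 3 / 2) = p / r := by
    rw [hp, hr, Real.sqrt_eq_rpow, ← Real.rpow_sub ht]
    congr 1
    ring
  rw [hpr, div_mul_eq_mul_div, le_div_iff₀ hr0]
  have htx : t * x ≤ m := by
    rw [hrr, mul_assoc]
    exact (mul_le_of_le_one_left (by positivity) hr1).trans hxm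
  have hty : t * y ≤ m := by
    rw [hrr, mul_assoc]
    exact (mul_le_of_le_one_left (by positivity) hr1).trans hym
  have e1 : 2 * p * (x + y) * r ≤ p * (4 * m ^ 2) := by
    have : (x + y) * r ≤ 2 * m := by linarith
    calc 2 * p * (x + y) * r = 2 * p * ((x + y) * r) := by ring
      _ ≤ 2 * p * (2 * m) := by gcongr
      _ = p * (4 * (m * 1)) := by ring
      _ ≤ p * (4 * (m * m)) := by gcongr
      _ = _ := by ring
  have e2 : t * M * (x * y) * r ≤ p * (M * m ^ 2) := by
    calc t * M * (x * y) * r = M * ((r * x) * (r * y)) * r := by rw [hrr]; ring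
      _ ≤ M * (m * m) * 1 := by gcongr
      _ = 1 * (M * m ^ 2) := by ring
      _ ≤ _ := by gcongr
  have e3 : y * M * (1 + t * M * x) * r ≤ p * (m ^ 2 * (M + M ^ 2)) := by
    calc y * M * (1 + t * M * x) * r = (r * y) * M * (1 + M * (t * x)) := by ring
      _ ≤ m * M * (m + M * m) := by gcongr
      _ = 1 * (m ^ 2 * (M + M ^ 2)) := by ring
      _ ≤ _ := by gcongr
  have e4 : (1 + 2 * m + t * M * y) * M * x * r ≤ p * (m ^ 2 * (3 * M + M ^ 2)) := by
    calc (1 + 2 * m + t * M * y) * M * x * r = (1 + 2 * m + M * (t * y)) * M * (r * x) := by ring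
      _ ≤ (m + 2 * m + M * m) * M * m := by gcongr
      _ = 1 * (m ^ 2 * (3 * M + M ^ 2)) := by ring
      _ ≤ _ := by gcongr
  calc _ = 2 * p * (x + y) * r + t * M * (x * y) * r + y * M * (1 + t * M * x) * r +
        (1 + 2 * m + t * M * y) * M * x * r := by ring
    _ ≤ p * (4 * m ^ 2) + p * (M * m ^ 2) + p * (m ^ 2 * (M + M ^ 2)) +
        p * (m ^ 2 * (3 * M + M ^ 2)) := add_le_add (add_le_add (add_le_add e1 e2) e3) e4
    _ = _ := by ring

/-- The sandwiched resolvent `D⋆ (H - z - iτB)⁻¹ D` with the weight `D = (1 - iτA)⁻¹⟨A⟩⁻ˢ`. -/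
def sandwich (A : E →ₗ.[ℂ] E) (s : ℝ) (R B : E →L[ℂ] E) (z : ℂ) (τ : ℝ) : E →L[ℂ] E :=
  star (smoothing A τ * bracketNegPow A s) * pertInv R (dissipation B z τ) *
    (smoothing A τ * bracketNegPow A s)

/-- The differential inequality for the sandwiched resolvent. The singularity `τˢ⁻³ᐟ²` is
integrable as `s > 1/2`. -/
theorem CommutatorData.exists_hasDerivAt_sandwich (h : CommutatorData R F B K z w δ M)
    {A : E →ₗ.[ℂ] E} (hA : IsSelfAdjoint A) {K₀ B' : E →L[ℂ] E} {θ : ℝ} (hθ : 0 ≤ θ) (hθ1 : θ ≤ 1)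
    (hK : K = (θ : ℂ) • K₀) (hR : HasComm A R (R * K₀)) (hB : HasComm A B B')
    (hB' : θ * ‖B'‖ ≤ M * δ) {s : ℝ} (hs : 0 < s) (hs' : s ≤ 1) {t : ℝ} (ht : 0 < t)
    (ht' : t ≤ maxTime M) :
    ∃ F' : E →L[ℂ] E, HasDerivAt (sandwich A s R B z) F' t ∧
      δ * ‖F'‖ ≤ growthConst M * t ^ (s - 3 / 2) * (1 + δ * ‖sandwich A s R B z t‖) := by
  have hδ := h.δ_pos
  have hM := h.M_nonneg
  have hz := h.im_nonneg
  have hu := h.isUnit ht ht'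
  have ht1 := ht'.trans (maxTime_le_one hM)
  have hbl := one_le_lossConst hM
  set W := bracketNegPow A s with hW
  set J := smoothing A t with hJ
  set AJ := smoothed A t with hAJ
  have hDn : ‖J * W‖ ≤ 1 := (norm_mul_le _ _).trans
    (mul_le_one₀ (norm_smoothing_le hA ht) (norm_nonneg _) (norm_bracketNegPow_le hA hs))
  have hDA : ‖AJ * W‖ ≤ t ^ (s - 1) := norm_smoothed_mul_bracketNegPow_le hA ht hs hs'
  have hx1 := h.norm_pertInv_mul_le ht ht' hDn
  obtain ⟨hy1, hy2⟩ := h.norm_mul_pertInv_le ht ht' hDn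
  have hdG := hasDerivAt_pertInv hu
  have hident := h.pertInv_mul_B_mul_pertInv hu
  have hcomm := star_mul_comm_mul hA (hasComm_pertInv hA hR hB hu) ht W
  have hFt : sandwich A s R B z t =
    star (J * W) * pertInv R (dissipation B z t) * (J * W) := rfl
  rw [hFt]
  have hnB := h.norm_B
  have hnw := h.norm_w
  have hnY := h.norm_K
  set G := pertInv R (dissipation B z t) with hG
  set S := shiftInv R (dissipation B z t)
  set U := shiftInv R (-(w • 1))
  set Rs := star (pertInv R (-(w • 1))) with hRs
  set D := J * W with hD
  set DA := AJ * W
  set D' := Complex.I • (AJ * J) * W with hD'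
  have hdD : HasDerivAt (fun τ => smoothing A τ * W) D' t :=
    (hasDerivAt_smoothing hA ht).mul_const W
  have hdDs : HasDerivAt (fun τ => star (smoothing A τ * W)) (star D') t := hdD.star
  have hD'n : ‖D'‖ ≤ t ^ (s - 1) := by
    have h1 : D' = Complex.I • (J * DA) := by
      have h2 : Commute J AJ := ((Commute.one_right _).sub_right (Commute.refl _)).smul_right _
      rw [hD', ← h2.eq, smul_mul_assoc, mul_assoc]
    rw [h1, norm_smul, Complex.norm_I, one_mul]
    refine (norm_mul_le _ _).trans ((mul_le_of_le_one_left (norm_nonneg _) ?_).trans hDA)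
    exact norm_smoothing_le hA ht
  refine ⟨_, (hdDs.mul hdG).mul hdD, ?_⟩
  have hRsn : δ * ‖Rs‖ ≤ 1 := by rwa [hRs, norm_star]
  set x := δ * ‖G * D‖ with hx
  set y := δ * ‖star D * G‖ with hy
  set Y := K * U
  set m := 24 * lossConst M * √(1 + δ * ‖star D * G * D‖) with hm
  have hm1 : 1 ≤ m := by
    have h1 : 1 ≤ √(1 + δ * ‖star D * G * D‖) := by
      rw [Real.one_le_sqrt]
      linarith [mul_nonneg hδ.le (norm_nonneg (star D * G * D))]
    rw [hm]
    nlinarith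
  have hη : z.im * ‖star D * G‖ ≤ m := by
    refine le_trans (mul_le_mul_of_nonneg_right ?_ (norm_nonneg _)) hy2
    refine Real.le_sqrt_of_sq_le ?_
    rw [pow_two]
    exact mul_le_mul_of_nonneg_left h.im_le hz
  have hGK : (θ : ℂ) • (star D * (G * K₀ * S + (Complex.I * t) • (G * B' * G)) * D) =
      star D * (G * K * S) * D + (Complex.I * t * θ) • (star D * G * B' * (G * D)) := by
    rw [hK]
    simp only [mul_add, add_mul, smul_add, smul_mul_assoc, mul_smul_comm, mul_assoc, smul_smul]
    congr 2
    ring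
  rw [hcomm] at hGK
  have hmain : star D * (Complex.I • (G * B * G)) * D =
      -((θ : ℂ) • (star DA * (G * D) - star D * G * DA)) +
      (Complex.I * t * θ) • (star D * G * B' * (G * D)) +
      star D * G * Y * (D + (Complex.I * t) • (B * (G * D))) -
      (Complex.I * δ) • ((star D + star D * G *
        ((2 * Complex.I * z.im) • 1 + (Complex.I * t) • B)) * Rs * Y * (G * D)) := by
    have h1 : star DA * (G * D) = star DA * G * D := (mul_assoc _ _ _).symm
    rw [hident, h1, hGK]
    simp only [mul_add, add_mul, mul_sub, sub_mul, smul_mul_assoc, mul_smul_comm, mul_assoc,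
      mul_one, one_mul, mul_neg, neg_mul]
    abel
  have e1 : ‖star D' * G * D‖ ≤ t ^ (s - 1) * ‖G * D‖ := by
    rw [mul_assoc]
    refine (norm_mul_le _ _).trans ?_
    rw [norm_star]
    gcongr
  have e2 : ‖star D * G * D'‖ ≤ ‖star D * G‖ * t ^ (s - 1) := by
    refine (norm_mul_le _ _).trans ?_
    gcongr
  have e3 : ‖(θ : ℂ) • (star DA * (G * D) - star D * G * DA)‖ ≤
      t ^ (s - 1) * ‖G * D‖ + ‖star D * G‖ * t ^ (s - 1) := by
    rw [norm_smul, Complex.norm_real, Real.norm_of_nonneg hθ]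
    refine (mul_le_of_le_one_left (norm_nonneg _) hθ1).trans ((norm_sub_le _ _).trans ?_)
    refine add_le_add ((norm_mul_le _ _).trans ?_) ((norm_mul_le _ _).trans ?_)
    · rw [norm_star]
      gcongr
    · gcongr
  have e4 : ‖(Complex.I * t * θ) • (star D * G * B' * (G * D))‖ ≤
      t * (‖star D * G‖ * (M * δ) * ‖G * D‖) := by
    rw [norm_smul, norm_mul, norm_mul, Complex.norm_I, one_mul, Complex.norm_real,
      Complex.norm_real, Real.norm_of_nonneg hθ, Real.norm_of_nonneg ht.le]
    calc t * θ * ‖star D * G * B' * (G * D)‖ ≤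
          t * θ * (‖star D * G‖ * ‖B'‖ * ‖G * D‖) := by
          gcongr
          exact (norm_mul_le _ _).trans (mul_le_mul_of_nonneg_right (norm_mul_le _ _)
            (norm_nonneg _))
      _ = t * (‖star D * G‖ * (θ * ‖B'‖) * ‖G * D‖) := by ring
      _ ≤ _ := by gcongr
  have e5 : ‖star D * G * Y * (D + (Complex.I * t) • (B * (G * D)))‖ ≤
      ‖star D * G‖ * M * (1 + t * (M * δ * ‖G * D‖)) := by
    refine (norm_mul_le _ _).trans ?_
    refine mul_le_mul ((norm_mul_le _ _).trans (by gcongr)) ?_ (norm_nonneg _) (by positivity)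
    refine (norm_add_le _ _).trans (add_le_add hDn ?_)
    rw [norm_smul, norm_mul, Complex.norm_I, one_mul, Complex.norm_real, Real.norm_of_nonneg ht.le]
    gcongr
    exact (norm_mul_le _ _).trans (by gcongr)
  have e6 : ‖(Complex.I * δ) • ((star D + star D * G *
        ((2 * Complex.I * z.im) • 1 + (Complex.I * t) • B)) * Rs * Y * (G * D))‖ ≤
      (1 + 2 * m + t * M * y) * M * ‖G * D‖ := by
    have h1 : ‖star D + star D * G * ((2 * Complex.I * z.im) • 1 + (Complex.I * t) • B)‖ ≤
        1 + 2 * m + t * M * y := by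
      rw [mul_add, mul_smul_comm, mul_one, mul_smul_comm, ← add_assoc]
      refine (norm_add_le _ _).trans (add_le_add ((norm_add_le _ _).trans (add_le_add ?_ ?_)) ?_)
      · rwa [norm_star]
      · rw [norm_smul, norm_mul, norm_mul, Complex.norm_I, mul_one, Complex.norm_real,
          Real.norm_of_nonneg hz, Complex.norm_ofNat, mul_assoc]
        gcongr
      · rw [norm_smul, norm_mul, Complex.norm_I, one_mul, Complex.norm_real,
          Real.norm_of_nonneg ht.le]
        calc t * ‖star D * G * B‖ ≤ t * (‖star D * G‖ * (M * δ)) := by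
              gcongr
              exact (norm_mul_le _ _).trans (by gcongr)
          _ = _ := by rw [hy]; ring
    rw [norm_smul, norm_mul, Complex.norm_I, one_mul, Complex.norm_real, Real.norm_of_nonneg hδ.le]
    calc δ * _ ≤ δ * ((1 + 2 * m + t * M * y) * ‖Rs‖ * M * ‖G * D‖) := by
          refine mul_le_mul_of_nonneg_left ?_ hδ.le
          refine (norm_mul_le _ _).trans (mul_le_mul_of_nonneg_right ?_ (norm_nonneg _))
          refine (norm_mul_le _ _).trans (mul_le_mul ?_ hnY (norm_nonneg _) (by positivity))
          exact (norm_mul_le _ _).trans (mul_le_mul_of_nonneg_right h1 (norm_nonneg _))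
      _ = (1 + 2 * m + t * M * y) * (δ * ‖Rs‖) * M * ‖G * D‖ := by ring
      _ ≤ (1 + 2 * m + t * M * y) * 1 * M * ‖G * D‖ := by gcongr
      _ = _ := by ring
  have htot : ‖(star D' * G + star D * (Complex.I • (G * B * G))) * D + star D * G * D'‖ ≤
      2 * t ^ (s - 1) * (‖G * D‖ + ‖star D * G‖) + t * (‖star D * G‖ * (M * δ) * ‖G * D‖) +
      ‖star D * G‖ * M * (1 + t * (M * δ * ‖G * D‖)) + (1 + 2 * m + t * M * y) * M * ‖G * D‖ := by
    rw [add_mul, hmain]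
    refine (norm_add_le _ _).trans ?_
    refine (add_le_add (norm_add_le _ _) le_rfl).trans ?_
    have h1 := norm_sub_le (-((θ : ℂ) • (star DA * (G * D) - star D * G * DA)) +
      (Complex.I * t * θ) • (star D * G * B' * (G * D)) +
      star D * G * Y * (D + (Complex.I * t) • (B * (G * D))))
      ((Complex.I * δ) • ((star D + star D * G *
        ((2 * Complex.I * z.im) • 1 + (Complex.I * t) • B)) * Rs * Y * (G * D)))
    have h2 := norm_add_le (-((θ : ℂ) • (star DA * (G * D) - star D * G * DA)) +
      (Complex.I * t * θ) • (star D * G * B' * (G * D)))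
      (star D * G * Y * (D + (Complex.I * t) • (B * (G * D))))
    have h3 := norm_add_le (-((θ : ℂ) • (star DA * (G * D) - star D * G * DA)))
      ((Complex.I * t * θ) • (star D * G * B' * (G * D)))
    rw [norm_neg] at h3
    linarith
  have hfin := derivative_bound_aux hM ht ht1 hm1 (by positivity) (by positivity) hx1 hy1 hs' rfl
  refine (mul_le_mul_of_nonneg_left htot hδ.le).trans (le_trans (le_of_eq ?_) (hfin.trans_eq ?_))
  · rw [hx, hy]
    ring
  · have h1 : m ^ 2 = 576 * lossConst M ^ 2 * (1 + δ * ‖star D * G * D‖) := by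
      rw [hm, mul_pow, Real.sq_sqrt (by positivity)]
      ring
    rw [h1, growthConst]
    ring

end Inequality

end

section

/-! ### Integration of the differential inequality -/

section Gronwall

variable {X : Type*} [NormedAddCommGroup X] [NormedSpace ℝ X]

/-- A Gronwall estimate for the inequality `‖h'‖ ≤ C tᵃ⁻¹ (1 + ‖h‖)` on `(0, t₀]`, whose
coefficient is singular but integrable at `0`. In the variable `y = tᵃ` the coefficient is the
constant `C / a`. -/
theorem gronwall_of_singular {h h' : ℝ → X} {C a t₀ : ℝ} (hC : 0 < C) (ha : 0 < a) (ht₀ : 0 < t₀)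
    (hd : ∀ t, 0 < t → t ≤ t₀ → HasDerivAt h (h' t) t)
    (hb : ∀ t, 0 < t → t ≤ t₀ → ‖h' t‖ ≤ C * t ^ (a - 1) * (1 + ‖h t‖)) :
    (∀ t, 0 < t → t ≤ t₀ → 1 + ‖h t‖ ≤ (1 + ‖h t₀‖) * Real.exp (C / a * t₀ ^ a)) ∧
    ∀ t, 0 < t → t ≤ t₀ → ∀ t', 0 < t' → t' ≤ t₀ →
      ‖h t - h t'‖ ≤ C / a * ((1 + ‖h t₀‖) * Real.exp (C / a * t₀ ^ a)) * |t ^ a - t' ^ a| := by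
  -- the functions `h` and `h'` in the variable `y = tᵃ`
  set k : ℝ → X := fun y => h (y ^ a⁻¹) with hk
  set k' : ℝ → X := fun y => (a⁻¹ * y ^ (a⁻¹ - 1)) • h' (y ^ a⁻¹) with hk'
  set y₀ := t₀ ^ a with hy₀
  have hy₀pos : 0 < y₀ := by positivity
  set c := C / a with hc
  have hcpos : 0 < c := by positivity
  have hinv : ∀ t : ℝ, 0 < t → (t ^ a) ^ a⁻¹ = t := fun t ht => Real.rpow_rpow_inv ht.le ha.ne'
  have hle : ∀ y, 0 < y → y ≤ y₀ → 0 < y ^ a⁻¹ ∧ y ^ a⁻¹ ≤ t₀ := fun y hy hy' =>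
    ⟨by positivity, by
      rw [← hinv t₀ ht₀]
      exact Real.rpow_le_rpow hy.le hy' (by positivity)⟩
  have hkd : ∀ y, 0 < y → y ≤ y₀ → HasDerivAt k (k' y) y := fun y hy hy' => by
    have h1 := Real.hasDerivAt_rpow_const (x := y) (p := a⁻¹) (Or.inl hy.ne')
    exact (hd _ (hle y hy hy').1 (hle y hy hy').2).scomp y h1
  have hkb : ∀ y, 0 < y → y ≤ y₀ → ‖k' y‖ ≤ c * (1 + ‖k y‖) := fun y hy hy' => by
    have h1 := hb _ (hle y hy hy').1 (hle y hy hy').2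
    have h2 : y ^ (a⁻¹ - 1) * (y ^ a⁻¹) ^ (a - 1) = 1 := by
      rw [← Real.rpow_mul hy.le, ← Real.rpow_add hy]
      have : a⁻¹ - 1 + a⁻¹ * (a - 1) = 0 := by field_simp; ring
      rw [this, Real.rpow_zero]
    rw [hk', norm_smul, Real.norm_of_nonneg (by positivity)]
    calc a⁻¹ * y ^ (a⁻¹ - 1) * ‖h' (y ^ a⁻¹)‖ ≤
          a⁻¹ * y ^ (a⁻¹ - 1) * (C * (y ^ a⁻¹) ^ (a - 1) * (1 + ‖h (y ^ a⁻¹)‖)) := by gcongr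
      _ = (C / a) * (y ^ (a⁻¹ - 1) * (y ^ a⁻¹) ^ (a - 1)) * (1 + ‖h (y ^ a⁻¹)‖) := by
          field_simp
      _ = _ := by rw [h2, mul_one]
  set b := (1 + ‖h t₀‖) * Real.exp (c * y₀) with hbdef
  have hk₀ : k y₀ = h t₀ := by simp only [hk, hy₀, hinv t₀ ht₀]
  have hbound : ∀ y, 0 < y → y ≤ y₀ → 1 + ‖k y‖ ≤ b := fun y hy hy' => by
    have hr : ∀ r ∈ Set.Icc 0 (y₀ - y), 0 < y₀ - r ∧ y₀ - r ≤ y₀ := fun r hr =>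
      ⟨by linarith [hr.2], by linarith [hr.1]⟩
    have hgd : ∀ r ∈ Set.Icc 0 (y₀ - y), HasDerivAt (fun r => k (y₀ - r)) (-k' (y₀ - r)) r :=
      fun r hr' => (hkd _ (hr r hr').1 (hr r hr').2).comp_const_sub y₀ r
    -- the initial value is prescribed at `y₀`, so that time runs backwards
    have h1 := norm_le_gronwallBound_of_norm_deriv_right_le (f := fun r => k (y₀ - r))
      (f' := fun r => -k' (y₀ - r)) (δ := ‖h t₀‖) (K := c) (ε := c) (a := 0) (b := y₀ - y)
      (fun r hr' => (hgd r hr').continuousAt.continuousWithinAt)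
      (fun r hr' => (hgd r (Set.Ico_subset_Icc_self hr')).hasDerivWithinAt)
      (by simp [hk₀])
      (fun r hr' => by
        have hr'' := Set.Ico_subset_Icc_self hr'
        rw [norm_neg]
        linarith [hkb _ (hr r hr'').1 (hr r hr'').2])
      (y₀ - y) ⟨by linarith, le_rfl⟩
    rw [gronwallBound_of_K_ne_0 hcpos.ne', div_self hcpos.ne', sub_zero, sub_sub_cancel] at h1
    have h2 : Real.exp (c * (y₀ - y)) ≤ Real.exp (c * y₀) := by
      apply Real.exp_le_exp.2
      gcongr
      linarith
    rw [hbdef]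
    nlinarith [norm_nonneg (h t₀)]
  have hb' : ∀ t, 0 < t → t ≤ t₀ → 0 < t ^ a ∧ t ^ a ≤ y₀ := fun t ht ht' =>
    ⟨by positivity, Real.rpow_le_rpow ht.le ht' ha.le⟩
  constructor
  · intro t ht ht'
    have h1 := hbound _ (hb' t ht ht').1 (hb' t ht ht').2
    simp only [hk, hinv t ht] at h1
    exact h1
  · intro t ht ht' t' hs hs'
    have h1 := (convex_Ioc (0 : ℝ) y₀).norm_image_sub_le_of_norm_hasDerivWithin_le (f := k)
      (f' := k') (C := c * b) (fun y hy => (hkd y hy.1 hy.2).hasDerivWithinAt)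
      (fun y hy => (hkb y hy.1 hy.2).trans
        (mul_le_mul_of_nonneg_left (hbound y hy.1 hy.2) hcpos.le))
      (hb' t' hs hs') (hb' t ht ht')
    simp only [hk, hinv t ht, hinv t' hs] at h1
    exact h1

omit [NormedSpace ℝ X] in
/-- A family of functions of `t ∈ (0, t₀]` which satisfies a uniform Hölder condition converges
uniformly as `t → 0`. -/
theorem exists_tendstoUniformlyOn {Z : Type*} [CompleteSpace X] {F : ℝ → Z → X} {Ω : Set Z}
    {a t₀ L : ℝ} (ha : 0 < a) (ht₀ : 0 < t₀) (hL : 0 ≤ L)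
    (hF : ∀ z ∈ Ω, ∀ t, 0 < t → t ≤ t₀ → ∀ t', 0 < t' → t' ≤ t₀ →
      ‖F t z - F t' z‖ ≤ L * |t ^ a - t' ^ a|) :
    ∃ Λ : Z → X, TendstoUniformlyOn F Λ (𝓝[>] 0) Ω := by
  have hcau : UniformCauchySeqOn F (𝓝[>] 0) Ω := by
    intro u hu
    obtain ⟨ε, hε, hεu⟩ := Metric.mem_uniformity_dist.1 hu
    have h1 : Tendsto (fun t : ℝ => L * t ^ a) (𝓝[>] 0) (𝓝 0) := by
      have h2 : Tendsto (fun t : ℝ => L * t ^ a) (𝓝 0) (𝓝 (L * 0 ^ a)) :=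
        ((Real.continuousAt_rpow_const 0 a (Or.inr ha.le)).tendsto).const_mul L
      rw [Real.zero_rpow ha.ne', mul_zero] at h2
      exact h2.mono_left nhdsWithin_le_nhds
    have h2 : ∀ᶠ t : ℝ in 𝓝[>] 0, 0 < t ∧ t ≤ t₀ ∧ L * t ^ a < ε / 2 := by
      filter_upwards [self_mem_nhdsWithin, Ioc_mem_nhdsGT ht₀,
        h1.eventually_lt_const (half_pos hε)] with t h3 h4 h5
      exact ⟨h3, h4.2, h5⟩
    filter_upwards [h2.prod_mk h2] with m hm z hz
    apply hεu
    rw [dist_eq_norm]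
    obtain ⟨⟨h3, h4, h5⟩, h6, h7, h8⟩ := hm
    have h9 := hF z hz _ h3 h4 _ h6 h7
    have h10 : |m.1 ^ a - m.2 ^ a| ≤ m.1 ^ a + m.2 ^ a := by
      have h11 : 0 ≤ m.1 ^ a := by positivity
      have h12 : 0 ≤ m.2 ^ a := by positivity
      rw [abs_le]
      constructor <;> linarith
    have h11 := mul_le_mul_of_nonneg_left h10 hL
    linarith
  have hlim : ∀ z, ∃ x, z ∈ Ω → Tendsto (fun t => F t z) (𝓝[>] 0) (𝓝 x) := fun z => by
    by_cases hz : z ∈ Ω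
    · obtain ⟨x, hx⟩ := cauchy_map_iff_exists_tendsto.1 (hcau.cauchy_map hz)
      exact ⟨x, fun _ => hx⟩
    · exact ⟨0, fun h => absurd h hz⟩
  choose Λ hΛ using hlim
  exact ⟨Λ, hcau.tendstoUniformlyOn_of_tendsto fun z hz => hΛ z hz⟩

end Gronwall

end

section

variable {E : Type*} [NormedAddCommGroup E] [InnerProductSpace ℂ E] [CompleteSpace E]

/-! ### Uniform resolvent estimates -/

/-- The regularised commutator `θδ²(H - w̄)⁻¹ i[H, A]⁰ (H - w)⁻¹`, where `K₀ = [H, A]⁰(H + i)⁻¹`. -/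
def regularised (H : E →ₗ.[ℂ] E) (K₀ : E →L[ℂ] E) (θ δ : ℝ) (w : ℂ) : E →L[ℂ] E :=
  ((δ ^ 2 : ℝ) : ℂ) • (star (resolvent H w) *
    (Complex.I • (((θ : ℂ) • K₀) * (1 + (w + Complex.I) • resolvent H w))))

theorem tendsto_pertInv {X : Type*} {l : Filter X} {R : E →L[ℂ] E} {V : X → E →L[ℂ] E}
    {V₀ : E →L[ℂ] E} (hV : Tendsto V l (𝓝 V₀)) (hu : IsUnit (shiftOp R V₀)) :
    Tendsto (fun x => pertInv R (V x)) l (𝓝 (pertInv R V₀)) := by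
  obtain ⟨u, hu⟩ := hu
  have h1 : Tendsto (fun x => shiftOp R (V x)) l (𝓝 (shiftOp R V₀)) :=
    ((hV.sub_const _).mul_const R).const_add 1
  have h2 : ContinuousAt Ring.inverse (shiftOp R V₀) := hu ▸ NormedRing.inverse_continuousAt u
  exact (h2.tendsto.comp h1).const_mul R

theorem continuousOn_resolvent {T : E →ₗ.[ℂ] E} (hi : -Complex.I ∈ resolventSet T) :
    ContinuousOn (resolvent T) (resolventSet T) := by
  intro w hw
  refine ContinuousWithinAt.congr_of_mem (f := fun w =>
    pertInv (resolvent T (-Complex.I)) (-(w • 1))) ?_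
    (fun w hw => (pertInv_resolvent hi hw).symm) hw
  refine tendsto_pertInv ?_ (isUnit_shiftOp_resolvent hi hw)
  have : Continuous fun w : ℂ => -(w • (1 : E →L[ℂ] E)) := by fun_prop
  exact this.continuousWithinAt

theorem tendsto_smoothing_mul_bracketNegPow {A : E →ₗ.[ℂ] E} (hA : IsSelfAdjoint A) {s : ℝ}
    (hs : 0 < s) (hs' : s ≤ 1) :
    Tendsto (fun τ => smoothing A τ * bracketNegPow A s) (𝓝[>] 0) (𝓝 (bracketNegPow A s)) := by
  rw [tendsto_iff_norm_sub_tendsto_zero]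
  have h1 : Tendsto (fun τ : ℝ => τ ^ s) (𝓝[>] 0) (𝓝 0) := by
    have h2 := (Real.continuousAt_rpow_const 0 s (Or.inr hs.le)).tendsto
    rw [Real.zero_rpow hs.ne'] at h2
    exact h2.mono_left nhdsWithin_le_nhds
  refine squeeze_zero_norm' ?_ h1
  filter_upwards [self_mem_nhdsWithin] with τ hτ
  have hτ : 0 < τ := hτ
  have h2 : smoothing A τ * bracketNegPow A s - bracketNegPow A s =
      (Complex.I * τ) • (smoothed A τ * bracketNegPow A s) := by
    ext x
    have h3 := sub_smoothed (A := A) hτ (bracketNegPow A s x)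
    rw [sub_eq_iff_eq_add'] at h3
    rw [sub_apply, mul_apply_eq_comp, h3]
    simp
  rw [h2, norm_norm, norm_smul, norm_mul, Complex.norm_I, one_mul, Complex.norm_real,
    Real.norm_of_nonneg hτ.le]
  calc τ * ‖smoothed A τ * bracketNegPow A s‖ ≤ τ * τ ^ (s - 1) := by
        gcongr
        exact norm_smoothed_mul_bracketNegPow_le hA hτ hs hs'
    _ = τ ^ s := by rw [← Real.rpow_one_add' hτ.le (by linarith)]; congr 1; ring

section Strip

variable {H A : E →ₗ.[ℂ] E} {D : Submodule ℂ E} {ζ : ℕ → E →L[ℂ] E} {K : H.domain →ₗ[ℂ] E}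
  {c lam α δ : ℝ} {f : ℝ → ℝ} {K₀ : E →L[ℂ] E} {C : ℝ}

/-- The half of the strip `|Re z - lam| ≤ δ`, `|Im z| ≤ δ` which lies in the closed upper half
plane. -/
def strip (lam δ : ℝ) : Set ℂ := {z | |z.re - lam| ≤ δ ∧ 0 ≤ z.im ∧ z.im ≤ δ}

/-- The scale-invariant bound `M` on the data `CommutatorData`. -/
def dataConst (C : ℝ) : ℝ := 2 * C + 8 * C ^ 2

/-- The shift `w = z + iδ` keeps `w` at distance at least `δ` from the real axis, uniformly in the
strip. -/
theorem norm_resolvent_shifted_le (hH : IsSelfAdjoint H) (hδ : 0 < δ) {z : ℂ}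
    (hz : z ∈ strip lam δ) :
    δ * ‖resolvent H (z + Complex.I * δ)‖ ≤ 1 ∧
    δ * ‖1 + (z + Complex.I * δ + Complex.I) • resolvent H (z + Complex.I * δ)‖ ≤
      2 * (1 + |lam| + 2 * δ) := by
  obtain ⟨hz1, hz2, hz3⟩ := hz
  have him : (z + Complex.I * δ).im = z.im + δ := by simp
  have h1 : ‖resolvent H (z + Complex.I * δ)‖ ≤ δ⁻¹ := by
    refine (norm_resolvent_le hH (by rw [him]; positivity)).trans ?_
    rw [him, abs_of_pos (by positivity)]
    gcongr
    linarith
  have h2 : δ * ‖resolvent H (z + Complex.I * δ)‖ ≤ 1 := by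
    calc _ ≤ δ * δ⁻¹ := by gcongr
      _ = 1 := mul_inv_cancel₀ hδ.ne'
  refine ⟨h2, ?_⟩
  have h3 : ‖z + Complex.I * δ + Complex.I‖ ≤ 1 + |lam| + 3 * δ := by
    refine (Complex.norm_le_abs_re_add_abs_im _).trans ?_
    have h4 : |z.re| ≤ |lam| + δ := by
      have := abs_sub_abs_le_abs_sub z.re lam
      linarith
    have h5 : |z.im + δ + 1| = z.im + δ + 1 := abs_of_pos (by linarith)
    simp only [Complex.add_re, Complex.add_im, Complex.mul_re, Complex.mul_im, Complex.I_re,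
      Complex.I_im, Complex.ofReal_re, Complex.ofReal_im, zero_mul, one_mul, mul_zero, sub_zero,
      zero_add, add_zero, h5]
    linarith
  have h4 : ‖(1 : E →L[ℂ] E)‖ ≤ 1 := ContinuousLinearMap.norm_id_le
  calc _ ≤ δ * (1 + (1 + |lam| + 3 * δ) * ‖resolvent H (z + Complex.I * δ)‖) := by
        gcongr
        refine (norm_add_le _ _).trans (add_le_add h4 ?_)
        rw [norm_smul]
        gcongr
    _ = δ + (1 + |lam| + 3 * δ) * (δ * ‖resolvent H (z + Complex.I * δ)‖) := by ring
    _ ≤ δ + (1 + |lam| + 3 * δ) * 1 := by gcongr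
    _ ≤ _ := by linarith [abs_nonneg lam]

/-- The positive commutator estimate turns into positivity of the regularised commutator. -/
theorem re_inner_regularised_ge (hH : IsSelfAdjoint H) (hc : PositiveCommutator H K lam α δ f)
    (hK₀ : ∀ φ : H.domain, K φ = K₀ (H φ + Complex.I • (φ : E))) {z : ℂ}
    (hz : z ∈ strip lam δ) (u : E) :
    δ / 36 * ‖realFunctionOf H f u‖ ^ 2 ≤ (inner ℂ (realFunctionOf H f u)
      (regularised H K₀ (δ / α) δ (z + Complex.I * δ) (realFunctionOf H f u))).re := by
  obtain ⟨hz1, hz2, hz3⟩ := hz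
  have hδ := hc.δ_pos
  have hα := hc.α_pos
  have hi := neg_I_mem_resolventSet hH
  set w := z + Complex.I * δ with hwdef
  have him : w.im = z.im + δ := by simp [hwdef]
  have hre : w.re = z.re := by simp [hwdef]
  have hw : w ∈ resolventSet H := mem_resolventSet_of_im_ne_zero hH (by rw [him]; positivity)
  obtain ⟨e1, e2, e3⟩ := shiftOp_mul_one_add_resolvent hi hw
  rw [shiftOp_neg_smul_one] at e1
  set R := resolvent H (-Complex.I)
  set Rw := resolvent H w
  set U := 1 + (w + Complex.I) • Rw with hU
  set F := realFunctionOf H f with hF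
  have hFR : Commute F R := commute_functionOf_resolvent hH _ hi
  have hFRw : Commute F Rw := commute_functionOf_resolvent hH _ hw
  have hFU : Commute F U := (Commute.one_right F).add_right (hFRw.smul_right _)
  have hFs : star F = F := star_functionOf_ofReal H f
  have hFi : ∀ x y, inner ℂ x (F y) = inner ℂ (F x) y := fun x y => by
    nth_rw 1 [← hFs]
    rw [ContinuousLinearMap.star_eq_adjoint, ContinuousLinearMap.adjoint_inner_right]
  have hFp : F (Rw u) = R (F (U u)) := by
    rw [← e3]
    exact congrArg (fun T : E →L[ℂ] E => T (U u)) hFR.eq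
  have hcd : compDom K F (Rw u) = K₀ (F (U u)) := by
    have hmem : F (Rw u) ∈ H.domain := hFp ▸ resolvent_mem_domain hi _
    rw [compDom, dif_pos hmem, hK₀]
    have h1 : (⟨F (Rw u), hmem⟩ : H.domain) = ⟨R (F (U u)), resolvent_mem_domain hi _⟩ :=
      Subtype.ext hFp
    rw [h1, apply_resolvent hi]
    congr 1
    module
  have hest := hc.estimate (Rw u)
  rw [← hF, hcd, hFi (Rw u) (F (Rw u)), hFi (Rw u) (Complex.I • _),
    inner_self_eq_norm_sq_to_K] at hest
  have hest' : α * ‖F (Rw u)‖ ^ 2 ≤ (inner ℂ (F (Rw u)) (Complex.I • K₀ (F (U u)))).re := by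
    refine le_trans (le_of_eq ?_) hest
    norm_cast
  have hval : inner ℂ (F u) (regularised H K₀ (δ / α) δ w (F u)) =
      ((δ ^ 2 * (δ / α) : ℝ) : ℂ) * inner ℂ (F (Rw u)) (Complex.I • K₀ (F (U u))) := by
    have h1 : Rw (F u) = F (Rw u) := congrArg (fun T : E →L[ℂ] E => T u) hFRw.eq.symm
    have h2 : U (F u) = F (U u) := congrArg (fun T : E →L[ℂ] E => T u) hFU.eq.symm
    have h3 : regularised H K₀ (δ / α) δ w = ((δ ^ 2 : ℝ) : ℂ) •
      (star Rw * (Complex.I • (((δ / α : ℝ) : ℂ) • K₀ * U))) := rfl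
    rw [h3]
    simp only [smul_apply, mul_apply_eq_comp, inner_smul_right,
      ContinuousLinearMap.star_eq_adjoint, ContinuousLinearMap.adjoint_inner_right]
    rw [← h1, ← h2]
    push_cast
    ring
  -- on the support of `f`, `|x - w| ≤ |x - lam| + |lam - Re w| + Im w ≤ 3δ + δ + 2δ`
  have hlow : ‖F u‖ ≤ 6 * δ * ‖F (Rw u)‖ := by
    have h1 := norm_realFunctionOf_sub_le hH hc.smooth.continuous hc.compact_support (w := w)
      (c := 6 * δ) (by positivity) (fun x hx => ?_) (U u)
    · have h2 : U u - (w + Complex.I) • R (U u) = u := by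
        simpa using congrArg (fun T : E →L[ℂ] E => T u) e1
      have h3 : R (U u) = Rw u := congrArg (fun T : E →L[ℂ] E => T u) e3
      rwa [h2, h3] at h1
    · have h2 : |x - lam| ≤ 3 * δ := by
        by_contra! hcon
        exact hx (hc.eq_zero x hcon)
      refine (Complex.norm_le_abs_re_add_abs_im _).trans ?_
      have h3 : |x - z.re| ≤ |x - lam| + |z.re - lam| := by
        rw [abs_sub_comm z.re]
        exact abs_sub_le _ _ _
      have h4 : |-(z.im + δ)| = z.im + δ := by rw [abs_neg, abs_of_nonneg (by linarith)]
      simp only [Complex.sub_re, Complex.sub_im, Complex.ofReal_re, Complex.ofReal_im, hre, him,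
        zero_sub, h4]
      linarith
  rw [hval, Complex.re_ofReal_mul]
  calc δ / 36 * ‖F u‖ ^ 2 ≤ δ / 36 * (6 * δ * ‖F (Rw u)‖) ^ 2 := by gcongr
    _ = δ ^ 2 * (δ / α) * (α * ‖F (Rw u)‖ ^ 2) := by field_simp; ring
    _ ≤ _ := by gcongr

/-- The hypotheses provide the data for the differential inequality, with bounds which depend on
`C` only. -/
theorem exists_commutatorData (hH : IsSelfAdjoint H) (hA : IsSelfAdjoint A)
    (ha : DomainConditions H A D ζ) (hb : CommutatorConditions H A D K c)
    (hc : PositiveCommutator H K lam α δ f)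
    (hK₀ : ∀ φ : H.domain, K φ = K₀ (H φ + Complex.I • (φ : E))) (hC : 0 < C) (hδα : δ ≤ α)
    (hN : ‖K₀‖ * (1 + |lam| + 2 * δ) ≤ C * α)
    (hc2 : (1 + |lam| + 2 * δ) * c * δ ≤ C * α ^ 2) {z : ℂ} (hz : z ∈ strip lam δ) :
    CommutatorData (resolvent H (-Complex.I)) (realFunctionOf H f)
      (regularised H K₀ (δ / α) δ (z + Complex.I * δ)) (((δ / α : ℝ) : ℂ) • K₀) z
      (z + Complex.I * δ) δ (dataConst C) ∧
    ∃ B' : E →L[ℂ] E, HasComm A (regularised H K₀ (δ / α) δ (z + Complex.I * δ)) B' ∧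
      δ / α * ‖B'‖ ≤ dataConst C * δ := by
  obtain ⟨hR, hU⟩ := norm_resolvent_shifted_le hH hc.δ_pos hz
  have hpos := re_inner_regularised_ge hH hc hK₀ hz
  have hδ := hc.δ_pos
  have hα := hc.α_pos
  have hcpos := hb.pos
  have hi := neg_I_mem_resolventSet hH
  set w := z + Complex.I * δ with hwdef
  have him : w.im = z.im + δ := by simp [hwdef]
  have hw0 : w.im ≠ 0 := by
    rw [him]
    linarith [hz.2.1]
  have hw : w ∈ resolventSet H := mem_resolventSet_of_im_ne_zero hH hw0
  have hw' : starRingEnd ℂ w ∈ resolventSet H :=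
    mem_resolventSet_of_im_ne_zero hH (by simpa using hw0)
  have hk : δ * ‖K₀ * (1 + (w + Complex.I) • resolvent H w)‖ ≤ 2 * (C * α) := by
    calc _ ≤ δ * (‖K₀‖ * ‖1 + (w + Complex.I) • resolvent H w‖) := by
          gcongr
          exact norm_mul_le _ _
      _ = ‖K₀‖ * (δ * ‖1 + (w + Complex.I) • resolvent H w‖) := by ring
      _ ≤ ‖K₀‖ * (2 * (1 + |lam| + 2 * δ)) := by gcongr
      _ = 2 * (‖K₀‖ * (1 + |lam| + 2 * δ)) := by ring
      _ ≤ _ := by gcongr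
  have hregeq : regularised H K₀ (δ / α) δ w = ((δ / α : ℝ) : ℂ) • (((δ ^ 2 : ℝ) : ℂ) •
      (star (resolvent H w) * (Complex.I • (K₀ * (1 + (w + Complex.I) • resolvent H w))))) := by
    rw [regularised]
    simp only [smul_mul_assoc, mul_smul_comm]
    module
  have hθ : 0 ≤ δ / α := by positivity
  have hY : ‖(((δ / α : ℝ) : ℂ) • K₀) * (1 + (w + Complex.I) • resolvent H w)‖ ≤ 2 * C := by
    rw [smul_mul_assoc, norm_smul, Complex.norm_real, Real.norm_of_nonneg hθ, div_mul_eq_mul_div,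
      div_le_iff₀ hα]
    linarith
  have hM : 2 * C ≤ dataConst C := by unfold dataConst; nlinarith [sq_nonneg C]
  have hstar : star (regularised H K₀ (δ / α) δ w) = regularised H K₀ (δ / α) δ w := by
    obtain ⟨-, -, e3⟩ := shiftOp_mul_one_add_resolvent hi hw
    rw [hregeq]
    set R := resolvent H (-Complex.I)
    set Rw := resolvent H w
    set U := 1 + (w + Complex.I) • Rw with hU
    have h1 : star (star Rw * (Complex.I • (K₀ * U))) = star Rw * (Complex.I • (K₀ * U)) := by
      refine ContinuousLinearMap.ext fun y => ext_inner_left ℂ fun x => ?_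
      rw [ContinuousLinearMap.star_eq_adjoint (star Rw * _),
        ContinuousLinearMap.adjoint_inner_right, mul_apply_eq_comp, mul_apply_eq_comp,
        ContinuousLinearMap.star_eq_adjoint, ContinuousLinearMap.adjoint_inner_right,
        ContinuousLinearMap.adjoint_inner_left, ← e3, smul_apply, smul_apply, inner_smul_left,
        inner_smul_right, Complex.conj_I]
      simp only [mul_apply_eq_comp]
      rw [inner_comm_antisymm hH ha hb hK₀]
      ring
    rw [star_smul, star_smul, h1, Complex.star_def, Complex.conj_ofReal,
      Complex.conj_ofReal]
  have hnorm : ‖regularised H K₀ (δ / α) δ w‖ ≤ 2 * C * δ := by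
    rw [regularised, norm_smul, Complex.norm_real, Real.norm_of_nonneg (by positivity)]
    calc _ ≤ δ ^ 2 * (‖resolvent H w‖ *
          ‖(((δ / α : ℝ) : ℂ) • K₀) * (1 + (w + Complex.I) • resolvent H w)‖) := by
          gcongr
          refine (norm_mul_le _ _).trans ?_
          rw [norm_star, norm_smul, Complex.norm_I, one_mul]
      _ = δ * ‖resolvent H w‖ *
          ‖(((δ / α : ℝ) : ℂ) • K₀) * (1 + (w + Complex.I) • resolvent H w)‖ * δ := by ring
      _ ≤ 1 * (2 * C) * δ := by gcongr
      _ = _ := by ring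
  refine ⟨{
    normal := isStarNormal_resolvent hH
    symm := star_resolvent_sub hH
    δ_pos := hδ
    M_nonneg := by linarith
    im_nonneg := hz.2.1
    star_B := hstar
    norm_B := hnorm.trans (by gcongr)
    cut := norm_one_sub_realFunctionOf_resolvent_le hH hc.smooth.continuous hc.compact_support
      hc.nonneg hc.le_one hc.eq_one hz.1
    cut_conj := norm_one_sub_realFunctionOf_resolvent_le hH hc.smooth.continuous hc.compact_support
      hc.nonneg hc.le_one hc.eq_one (by simpa using hz.1)
    pos := hpos
    w_eq := hwdef
    im_le := hz.2.2
    isUnit_w := isUnit_shiftOp_resolvent hi hw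
    isUnit_conj_w := isUnit_shiftOp_resolvent hi hw'
    norm_w := by rwa [pertInv_resolvent hi hw]
    norm_K := by
      rw [shiftInv_resolvent hi hw]
      exact hY.trans hM
    B_eq := by rw [shiftInv_resolvent hi hw, pertInv_resolvent hi hw, regularised] }, ?_⟩
  obtain ⟨B', hB', hcomm⟩ := exists_hasComm_regularised hH hA ha hb hK₀ hw0 hδ hR hU hk
  refine ⟨((δ / α : ℝ) : ℂ) • B', hregeq ▸ hcomm.smul _, ?_⟩
  rw [norm_smul, Complex.norm_real, Real.norm_of_nonneg hθ]
  have h1 : (δ / α) ^ 2 ≤ 1 := pow_le_one₀ hθ ((div_le_one hα).2 hδα)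
  calc δ / α * (δ / α * ‖B'‖) ≤
        δ / α * (δ / α * (c * (2 * (1 + |lam| + 2 * δ)) + 2 * (2 * (C * α)) ^ 2 / δ)) := by gcongr
    _ = 2 * δ / α ^ 2 * ((1 + |lam| + 2 * δ) * c * δ) + 8 * C ^ 2 * δ := by
        field_simp
        ring
    _ ≤ 2 * δ / α ^ 2 * (C * α ^ 2) + 8 * C ^ 2 * δ := by gcongr
    _ = _ := by
        unfold dataConst
        field_simp

end Strip

end

section

variable {E : Type*} [NormedAddCommGroup E] [InnerProductSpace ℂ E] [CompleteSpace E]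

/-! ### Boundary values of the resolvent -/

/-- The constant in the resolvent estimate: the value at `τ = maxTime`, where the dissipation bounds
the resolvent, times the growth factor of the differential inequality. -/
def resolventConst (C s : ℝ) : ℝ :=
  (1 + 600 * lossConst (dataConst C) / maxTime (dataConst C)) *
    Real.exp (growthConst (dataConst C) / (s - 1 / 2) * maxTime (dataConst C) ^ (s - 1 / 2))

theorem dataConst_nonneg {C : ℝ} (hC : 0 < C) : 0 ≤ dataConst C := by
  unfold dataConst
  positivity

theorem resolventConst_nonneg {C : ℝ} (hC : 0 < C) (s : ℝ) : 0 ≤ resolventConst C s := by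
  have h1 := one_le_lossConst (dataConst_nonneg hC)
  have h2 := maxTime_pos (dataConst_nonneg hC)
  unfold resolventConst
  positivity

section Sandwich

variable {A : E →ₗ.[ℂ] E} {s : ℝ}

/-- The regularisation of the weights and the dissipation disappear in the limit, wherever the
limiting resolvent exists. -/
theorem tendsto_sandwich (hA : IsSelfAdjoint A) (hs : 0 < s) (hs' : s ≤ 1) {R : E →L[ℂ] E}
    (B : E →L[ℂ] E) {z : ℂ} (hu : IsUnit (shiftOp R (-(z • 1)))) :
    Tendsto (sandwich A s R B z) (𝓝[>] 0)
      (𝓝 (bracketNegPow A s * pertInv R (-(z • 1)) * bracketNegPow A s)) := by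
  have h1 := tendsto_smoothing_mul_bracketNegPow hA hs hs'
  have h2 : Tendsto (fun τ : ℝ => dissipation B z τ) (𝓝[>] 0) (𝓝 (-(z • 1))) := by
    have h3 : Continuous fun τ : ℝ => dissipation B z τ := by
      unfold dissipation
      fun_prop
    exact (h3.tendsto' 0 _ (by simp [dissipation])).mono_left nhdsWithin_le_nhds
  have h3 := (h1.star.mul (tendsto_pertInv h2 hu)).mul h1
  rwa [star_bracketNegPow] at h3

theorem norm_sandwich_le (hA : IsSelfAdjoint A) (hs : 0 < s) (R B : E →L[ℂ] E) (z : ℂ) {τ : ℝ}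
    (hτ : 0 < τ) : ‖sandwich A s R B z τ‖ ≤ ‖pertInv R (dissipation B z τ)‖ := by
  have h1 : ‖smoothing A τ * bracketNegPow A s‖ ≤ 1 := (norm_mul_le _ _).trans
    (mul_le_one₀ (norm_smoothing_le hA hτ) (norm_nonneg _) (norm_bracketNegPow_le hA hs))
  calc _ ≤ ‖star (smoothing A τ * bracketNegPow A s)‖ * ‖pertInv R (dissipation B z τ)‖ *
        ‖smoothing A τ * bracketNegPow A s‖ := norm_mul₃_le
    _ ≤ 1 * ‖pertInv R (dissipation B z τ)‖ * 1 := by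
        rw [norm_star]
        gcongr
    _ = _ := by ring

end Sandwich

variable {H A : E →ₗ.[ℂ] E} {D : Submodule ℂ E} {ζ : ℕ → E →L[ℂ] E} {K : H.domain →ₗ[ℂ] E}
  {c lam α δ : ℝ} {f : ℝ → ℝ} {C s : ℝ}

/-- The sandwiched resolvent extends continuously to the closed strip: the differential inequality
holds up to the real axis, where the dissipation makes `H - z - iτB` invertible. -/
theorem exists_continuousOn_strip (hH : IsSelfAdjoint H) (hA : IsSelfAdjoint A)
    (ha : DomainConditions H A D ζ) (hb : CommutatorConditions H A D K c)
    (hc : PositiveCommutator H K lam α δ f) (hC : 0 < C) (hδα : δ ≤ α)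
    (hN : commN K * (1 + |lam| + 2 * δ) ≤ C * α)
    (hc2 : (1 + |lam| + 2 * δ) * c * δ ≤ C * α ^ 2) (hs : 1 / 2 < s) (hs' : s ≤ 1) :
    ∃ Λ : ℂ → E →L[ℂ] E, ContinuousOn Λ (strip lam δ) ∧
      (∀ z ∈ strip lam δ, ‖Λ z‖ ≤ resolventConst C s * δ⁻¹) ∧
      ∀ z ∈ strip lam δ, z ∈ resolventSet H →
        Λ z = bracketNegPow A s * resolvent H z * bracketNegPow A s := by
  have hδ := hc.δ_pos
  have hi := neg_I_mem_resolventSet hH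
  obtain ⟨K₀, hK₀, hK₀N⟩ := exists_comm_mul_resolvent hi hb.bounded
  have hN' : ‖K₀‖ * (1 + |lam| + 2 * δ) ≤ C * α :=
    (mul_le_mul_of_nonneg_right hK₀N (by positivity)).trans hN
  have hdata := fun z hz => exists_commutatorData hH hA ha hb hc hK₀ hC hδα hN' hc2 (z := z) hz
  have hR : HasComm A (resolvent H (-Complex.I)) (resolvent H (-Complex.I) * K₀) := by
    simpa using hasComm_resolvent hH hA ha hb hK₀ (w := -Complex.I) (by simp)
  have hM := dataConst_nonneg hC
  have ht₀ := maxTime_pos hM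
  have hG : 0 < growthConst (dataConst C) := by
    have := one_le_lossConst hM
    unfold growthConst
    positivity
  have hs0 : 0 < s := by linarith
  have ha0 : 0 < s - 1 / 2 := by linarith
  set R := resolvent H (-Complex.I)
  set B : ℂ → E →L[ℂ] E := fun z => regularised H K₀ (δ / α) δ (z + Complex.I * δ)
  set F : ℝ → ℂ → E →L[ℂ] E := fun t z => δ • sandwich A s R (B z) z t with hF
  set M := dataConst C with hMdef
  set t₀ := maxTime M with ht₀def
  set b := (1 + 600 * lossConst M / t₀) with hb
  have hF₀ : ∀ z ∈ strip lam δ, 1 + ‖F t₀ z‖ ≤ b := fun z hz => by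
    have h1 := (hdata z hz).1.norm_pertInv_le ht₀ le_rfl
    have h2 := (norm_sandwich_le hA hs0 R (B z) z ht₀).trans h1
    rw [hF, norm_smul, Real.norm_of_nonneg hδ.le, hb]
    have h3 : δ * ‖sandwich A s R (B z) z t₀‖ ≤ δ * (600 * lossConst M / (t₀ * δ)) := by gcongr
    have h4 : δ * (600 * lossConst M / (t₀ * δ)) = 600 * lossConst M / t₀ := by field_simp
    linarith
  have hgron : ∀ z ∈ strip lam δ, (∀ t, 0 < t → t ≤ t₀ → 1 + ‖F t z‖ ≤ resolventConst C s) ∧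
      ∀ t, 0 < t → t ≤ t₀ → ∀ t', 0 < t' → t' ≤ t₀ → ‖F t z - F t' z‖ ≤
        growthConst M / (s - 1 / 2) * resolventConst C s *
          |t ^ (s - 1 / 2) - t' ^ (s - 1 / 2)| := fun z hz => by
    obtain ⟨hd, B', hB', hB'n⟩ := hdata z hz
    have hder : ∀ t, ∃ F' : E →L[ℂ] E, 0 < t → t ≤ t₀ → HasDerivAt (sandwich A s R (B z) z) F' t ∧
        δ * ‖F'‖ ≤ growthConst M * t ^ (s - 3 / 2) * (1 + δ * ‖sandwich A s R (B z) z t‖) :=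
      fun t => by
        by_cases ht : 0 < t ∧ t ≤ t₀
        · obtain ⟨F', hF'⟩ := hd.exists_hasDerivAt_sandwich hA (div_nonneg hδ.le hc.α_pos.le)
            ((div_le_one hc.α_pos).2 hδα) rfl hR hB' hB'n hs0 hs' ht.1 ht.2
          exact ⟨F', fun _ _ => hF'⟩
        · exact ⟨0, fun h1 h2 => absurd ⟨h1, h2⟩ ht⟩
    choose F' hF' using hder
    have hn : ∀ x : E →L[ℂ] E, ‖δ • x‖ = δ * ‖x‖ := fun x => by
      rw [norm_smul, Real.norm_of_nonneg hδ.le]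
    obtain ⟨h1, h2⟩ := gronwall_of_singular (h := fun t => F t z) (h' := fun t => δ • F' t) hG ha0
      ht₀ (fun t ht ht' => (hF' t ht ht').1.const_smul δ) (fun t ht ht' => by
        have h1 := (hF' t ht ht').2
        simp only [hF, hn]
        rwa [show s - 1 / 2 - 1 = s - 3 / 2 by ring])
    have h3 : (1 + ‖F t₀ z‖) * Real.exp (growthConst M / (s - 1 / 2) * t₀ ^ (s - 1 / 2)) ≤
        resolventConst C s := by
      rw [resolventConst]
      exact mul_le_mul_of_nonneg_right (hF₀ z hz) (Real.exp_pos _).le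
    refine ⟨fun t ht ht' => (h1 t ht ht').trans h3, fun t ht ht' t' h4 h5 =>
      (h2 t ht ht' t' h4 h5).trans ?_⟩
    gcongr
  have hRC := resolventConst_nonneg hC s
  obtain ⟨Λ, hΛ⟩ := exists_tendstoUniformlyOn ha0 ht₀ (by positivity)
    fun z hz => (hgron z hz).2
  have hcont : ∀ t, 0 < t → t ≤ t₀ → ContinuousOn (F t) (strip lam δ) := fun t ht ht' z hz => by
    have h1 : ContinuousOn (fun z : ℂ => resolvent H (z + Complex.I * δ)) (strip lam δ) := by
      refine (continuousOn_resolvent hi).comp (by fun_prop) fun z hz => ?_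
      refine mem_resolventSet_of_im_ne_zero hH ?_
      have : (z + Complex.I * δ).im = z.im + δ := by simp
      rw [this]
      linarith [hz.2.1]
    have h2 : ContinuousOn B (strip lam δ) := by
      have h3 : ContinuousOn (fun z : ℂ => star (resolvent H (z + Complex.I * δ)))
        (strip lam δ) := h1.star
      simp only [B, regularised]
      fun_prop
    have h3 : ContinuousOn (fun z => dissipation (B z) z t) (strip lam δ) := by
      unfold dissipation
      fun_prop
    have h4 := tendsto_pertInv (h3 z hz) ((hdata z hz).1.isUnit ht ht')
    exact (((tendsto_const_nhds.mul h4).mul tendsto_const_nhds).const_smul δ :)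
  have hΛF : ContinuousOn Λ (strip lam δ) := by
    refine hΛ.continuousOn (Eventually.frequently ?_)
    filter_upwards [Ioc_mem_nhdsGT ht₀] with t ht
    exact hcont t ht.1 ht.2
  refine ⟨fun z => δ⁻¹ • Λ z, fun z hz => (hΛF z hz).const_smul δ⁻¹, fun z hz => ?_,
    fun z hz hzr => ?_⟩
  · have h1 : ‖Λ z‖ ≤ resolventConst C s := by
      refine le_of_tendsto (hΛ.tendsto_at hz).norm ?_
      filter_upwards [Ioc_mem_nhdsGT ht₀] with t ht
      linarith [(hgron z hz).1 t ht.1 ht.2]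
    rw [norm_smul, Real.norm_of_nonneg (by positivity), mul_comm]
    gcongr
  · have h1 := (tendsto_sandwich hA hs0 hs' (B z) (isUnit_shiftOp_resolvent hi hzr)).const_smul δ
    rw [pertInv_resolvent hi hzr] at h1
    simp only [tendsto_nhds_unique (hΛ.tendsto_at hz) h1, inv_smul_smul₀ hδ.ne']

theorem star_sandwich_resolvent (hH : IsSelfAdjoint H) {z : ℂ} (hz : z.im ≠ 0) :
    star (bracketNegPow A s * resolvent H z * bracketNegPow A s) =
      bracketNegPow A s * resolvent H (starRingEnd ℂ z) * bracketNegPow A s := by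
  rw [star_mul, star_mul, star_bracketNegPow, star_resolvent hH hz, mul_assoc]

/-- The resolvent estimate in the strip implies the one for all `z`: above the strip the bound is
trivial, and the lower half plane is covered by taking adjoints. -/
theorem norm_sandwich_resolvent_le (hH : IsSelfAdjoint H) (hA : IsSelfAdjoint A) (hδ : 0 < δ)
    (hC : 0 < C) (hs : 0 < s)
    (h : ∀ z ∈ strip lam δ, z ∈ resolventSet H →
      ‖bracketNegPow A s * resolvent H z * bracketNegPow A s‖ ≤ resolventConst C s * δ⁻¹)
    {z : ℂ} (hz : z ∈ resolventSet H) (hre : |z.re - lam| ≤ δ) :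
    ‖bracketNegPow A s * resolvent H z * bracketNegPow A s‖ ≤ (resolventConst C s + 1) * δ⁻¹ := by
  have hRC := resolventConst_nonneg hC s
  have hup : ∀ z ∈ resolventSet H, |z.re - lam| ≤ δ → 0 ≤ z.im →
      ‖bracketNegPow A s * resolvent H z * bracketNegPow A s‖ ≤
        (resolventConst C s + 1) * δ⁻¹ := fun z hz hre him => by
    rcases le_or_gt z.im δ with h1 | h1
    · refine (h z ⟨hre, him, h1⟩ hz).trans ?_
      gcongr
      linarith
    · have h2 : ‖resolvent H z‖ ≤ δ⁻¹ := by
        refine (norm_resolvent_le hH (by linarith)).trans ?_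
        rw [abs_of_nonneg him]
        gcongr
      have h3 := norm_bracketNegPow_le hA hs
      calc _ ≤ ‖bracketNegPow A s‖ * ‖resolvent H z‖ * ‖bracketNegPow A s‖ := norm_mul₃_le
        _ ≤ 1 * δ⁻¹ * 1 := by gcongr
        _ = (0 + 1) * δ⁻¹ := by ring
        _ ≤ _ := by gcongr
  rcases le_or_gt 0 z.im with him | him
  · exact hup z hz hre him
  · rw [← norm_star, star_sandwich_resolvent hH him.ne]
    have him' : 0 < (starRingEnd ℂ z).im := by simpa using him
    exact hup _ (mem_resolventSet_of_im_ne_zero hH him'.ne') (by simpa using hre) him'.le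

theorem tendsto_boundary_value (hH : IsSelfAdjoint H) (hδ : 0 < δ) {Λ : ℂ → E →L[ℂ] E}
    (hΛ : ContinuousOn Λ (strip lam δ)) (h : ∀ z ∈ strip lam δ, z ∈ resolventSet H →
      Λ z = bracketNegPow A s * resolvent H z * bracketNegPow A s)
    {μ : ℝ} (hμ : μ ∈ Set.Ioo (lam - δ) (lam + δ)) :
    Tendsto (fun ε : ℝ => bracketNegPow A s * resolvent H ((μ : ℂ) + Complex.I * ε) *
      bracketNegPow A s) (𝓝[>] 0) (𝓝 (Λ μ)) := by
  have hμ' : |μ - lam| ≤ δ := by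
    rw [abs_le]
    constructor <;> linarith [hμ.1, hμ.2]
  have hmem : ∀ ε ∈ Set.Ioc 0 δ, (μ : ℂ) + Complex.I * (ε : ℝ) ∈ strip lam δ := fun ε hε =>
    ⟨by simpa using hμ', by simpa using hε.1.le, by simpa using hε.2⟩
  have h0 : (μ : ℂ) ∈ strip lam δ := ⟨by simpa using hμ', by simp, by simpa using hδ.le⟩
  have h1 : Tendsto (fun ε : ℝ => (μ : ℂ) + Complex.I * ε) (𝓝[>] 0) (𝓝[strip lam δ] (μ : ℂ)) := by
    refine tendsto_nhdsWithin_iff.2 ⟨?_, ?_⟩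
    · have h2 : Continuous fun ε : ℝ => (μ : ℂ) + Complex.I * ε := by fun_prop
      exact (h2.tendsto' 0 _ (by simp)).mono_left nhdsWithin_le_nhds
    · filter_upwards [Ioc_mem_nhdsGT hδ] with ε hε
      exact hmem ε hε
  refine ((hΛ _ h0).tendsto.comp h1).congr' ?_
  filter_upwards [Ioc_mem_nhdsGT hδ] with ε hε
  refine h _ (hmem ε hε) (mem_resolventSet_of_im_ne_zero hH ?_)
  simpa using hε.1.ne'

omit [CompleteSpace E] in
theorem continuousOn_boundary_value {Λ : ℂ → E →L[ℂ] E} (hΛ : ContinuousOn Λ (strip lam δ)) :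
    ContinuousOn (fun μ : ℝ => Λ μ) (Set.Ioo (lam - δ) (lam + δ)) := by
  refine hΛ.comp Complex.continuous_ofReal.continuousOn fun μ hμ => ?_
  have hδ : 0 ≤ δ := by linarith [hμ.1, hμ.2]
  refine ⟨?_, by simp, by simpa using hδ⟩
  rw [Complex.ofReal_re, abs_le]
  constructor <;> linarith [hμ.1, hμ.2]

/-! ### The constants of the commutator method -/

omit [InnerProductSpace ℂ E] [CompleteSpace E] in
theorem opNorm_nonneg (L : E → E) : 0 ≤ opNorm L :=
  Real.sInf_nonneg fun _ h => h.1

/-- Only the trivial bound `S ≥ 0` for the factor `(1 + S)²` of `constZero` is needed. -/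
theorem commN_mul_le_of_constZero_le (hδ : 0 < δ) (hα : 0 < α)
    (h : constZero K lam α δ f ≤ C * (δ / α)⁻¹ * δ⁻¹) :
    commN K * (1 + |lam| + 2 * δ) ≤ C * α := by
  have hN : 0 ≤ commN K := opNorm_nonneg _
  have h1 : 1 ≤ (1 + commS K f α) ^ 2 :=
    one_le_pow₀ (le_add_of_nonneg_right (sq_nonneg _))
  have h2 : commN K * (1 + |lam| + 2 * δ) * 1 ≤
      commN K * (1 + |lam| + 2 * δ) * (1 + commS K f α) ^ 2 := by gcongr
  have h3 : commN K * (1 + |lam| + 2 * δ) * (1 + commS K f α) ^ 2 =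
      δ ^ 2 * constZero K lam α δ f := by
    unfold constZero
    field_simp
  have h4 : δ ^ 2 * (C * (δ / α)⁻¹ * δ⁻¹) = C * α := by field_simp
  have h5 := mul_le_mul_of_nonneg_left h (sq_nonneg δ)
  linarith

omit [CompleteSpace E] in
/-- Only the term of `constOne` with `c` is needed. -/
theorem mul_le_of_constOne_le (hδ : 0 < δ) (hα : 0 < α) (hc : 0 < c)
    (h : constOne K c lam α δ f ≤ C * (δ / α)⁻¹) :
    (1 + |lam| + 2 * δ) * c * δ ≤ C * α ^ 2 := by
  have hΔ : 0 ≤ fourierDelta f :=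
    mul_nonneg (by positivity) (MeasureTheory.integral_nonneg fun t => by positivity)
  set L := 1 + |lam| + 3 * δ with hL
  have hLpos : 0 < L := by positivity
  have h1 : α⁻¹ * L * (c + 0) ≤ C * (δ / α)⁻¹ := by
    refine le_trans ?_ h
    unfold constOne
    gcongr
    have hN : 0 ≤ commN K := opNorm_nonneg _
    positivity
  have h2 : (1 + |lam| + 2 * δ) * c * δ ≤ L * c * δ := by
    gcongr
    linarith
  have h3 := mul_le_mul_of_nonneg_left h1 (mul_pos hα hδ).le
  have h4 : α * δ * (α⁻¹ * L * (c + 0)) = L * c * δ := by field_simp; ring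
  have h5 : α * δ * (C * (δ / α)⁻¹) = C * α ^ 2 := by field_simp
  linarith

end

end Mourre

end

theorem mainTheorem4 {E : Type*} [NormedAddCommGroup E] [InnerProductSpace ℂ E] [CompleteSpace E]
    {ι : Type*}
    (H A : ι → E →ₗ.[ℂ] E)
    (hH : ∀ ν, IsSelfAdjoint (H ν)) (hA : ∀ ν, IsSelfAdjoint (A ν))
    (D : ι → Submodule ℂ E) (ζ : ι → ℕ → E →L[ℂ] E)
    (K : ∀ ν, (H ν).domain →ₗ[ℂ] E) (c : ι → ℝ)
    (lam α δ : ι → ℝ) (fν : ι → ℝ → ℝ)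
    (cond_a : ∀ ν, Mourre.DomainConditions (H ν) (A ν) (D ν) (ζ ν))
    (cond_b : ∀ ν, Mourre.CommutatorConditions (H ν) (A ν) (D ν) (K ν) (c ν))
    (cond_c : ∀ ν, Mourre.PositiveCommutator (H ν) (K ν) (lam ν) (α ν) (δ ν) (fν ν))
    (hε : ∀ ν, δ ν / α ν ≤ 1)
    (f : ℝ → ℝ) (hf : ContDiff ℝ ∞ f) (hf_supp : HasCompactSupport f)
    (hfν : ∀ ν x, fν ν x = f ((x - lam ν) / δ ν))
    (C : ℝ) (hC : 0 < C)
    (hC_zero : ∀ ν, Mourre.constZero (K ν) (lam ν) (α ν) (δ ν) (fν ν) ≤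
      C * (δ ν / α ν)⁻¹ * (δ ν)⁻¹)
    (hC_half : ∀ ν, Mourre.constHalf (K ν) (lam ν) (α ν) (δ ν) (fν ν) ≤
      C * (δ ν / α ν) ^ (-(1 / 2) : ℝ) * (δ ν) ^ (-(1 / 2) : ℝ))
    (hC_one : ∀ ν, Mourre.constOne (K ν) (c ν) (lam ν) (α ν) (δ ν) (fν ν) ≤
      C * (δ ν / α ν)⁻¹)
    (hC_comm : ∀ ν, Mourre.commF (K ν) (fν ν) ≤ C * α ν)
    (s : ℝ) (hs : 1 / 2 < s) (hs' : s ≤ 1) :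
    (∃ Cs : ℝ, 0 < Cs ∧ ∀ ν, ∀ z ∈ Mourre.resolventSet (H ν), |z.re - lam ν| ≤ δ ν →
      ‖Mourre.bracketNegPow (A ν) s ∘L Mourre.resolvent (H ν) z ∘L
        Mourre.bracketNegPow (A ν) s‖ ≤ Cs * (δ ν)⁻¹) ∧
    (∀ ν, ∃ Rplus Rminus : ℝ → E →L[ℂ] E,
      (∀ μ ∈ Set.Ioo (lam ν - δ ν) (lam ν + δ ν),
        Tendsto (fun ε : ℝ => Mourre.bracketNegPow (A ν) s ∘L
            Mourre.resolvent (H ν) ((μ : ℂ) - Complex.I * (ε : ℂ)) ∘L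
            Mourre.bracketNegPow (A ν) s) (𝓝[>] 0) (𝓝 (Rplus μ)) ∧
        Tendsto (fun ε : ℝ => Mourre.bracketNegPow (A ν) s ∘L
            Mourre.resolvent (H ν) ((μ : ℂ) + Complex.I * (ε : ℂ)) ∘L
            Mourre.bracketNegPow (A ν) s) (𝓝[>] 0) (𝓝 (Rminus μ))) ∧
      ContinuousOn Rplus (Set.Ioo (lam ν - δ ν) (lam ν + δ ν)) ∧
      ContinuousOn Rminus (Set.Ioo (lam ν - δ ν) (lam ν + δ ν))) := by
  have hδ := fun ν => (cond_c ν).δ_pos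
  have hs0 : 0 < s := by linarith
  have key := fun ν => Mourre.exists_continuousOn_strip (hH ν) (hA ν) (cond_a ν) (cond_b ν)
    (cond_c ν) hC ((div_le_one (cond_c ν).α_pos).1 (hε ν))
    (Mourre.commN_mul_le_of_constZero_le (hδ ν) (cond_c ν).α_pos (hC_zero ν))
    (Mourre.mul_le_of_constOne_le (hδ ν) (cond_c ν).α_pos (cond_b ν).pos (hC_one ν)) hs hs'
  have hmul : ∀ W T : E →L[ℂ] E, W ∘L T ∘L W = W * T * W := fun W T => (mul_assoc _ _ _).symm
  simp only [hmul]
  refine ⟨⟨Mourre.resolventConst C s + 1,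
    add_pos_of_nonneg_of_pos (Mourre.resolventConst_nonneg hC s) one_pos, fun ν z hz hre => ?_⟩,
    fun ν => ?_⟩
  · obtain ⟨Λ, -, hb, hΛ⟩ := key ν
    exact Mourre.norm_sandwich_resolvent_le (hH ν) (hA ν) (hδ ν) hC hs0
      (fun z hz hzr => hΛ z hz hzr ▸ hb z hz) hz hre
  · obtain ⟨Λ, hcont, -, hΛ⟩ := key ν
    refine ⟨fun μ => star (Λ μ), fun μ => Λ μ, fun μ hμ => ?_,
      (Mourre.continuousOn_boundary_value hcont).star, Mourre.continuousOn_boundary_value hcont⟩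
    have h1 := Mourre.tendsto_boundary_value (hH ν) (hδ ν) hcont hΛ hμ
    -- the boundary value from the lower half plane is the adjoint of the one from the upper
    refine ⟨h1.star.congr' ?_, h1⟩
    filter_upwards [self_mem_nhdsWithin] with ε hε
    have hε : 0 < ε := hε
    rw [Mourre.star_sandwich_resolvent (hH ν) (by simpa using hε.ne')]
    congr 3
    simp [sub_eq_add_neg]
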